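/- **Lemma 2.1.** Let $n\ge 2$, let $M^{n+1}$ be a compact smooth manifold with (possibly empty) boundary $\partial M$, and let $m\ge 4$ be an integer. Let $\mathcal M^m$ be the set of all Riemannian metrics of class $C^m$ on $M$, with the $C^m$ topology (uniform convergence, on compact subsets of charts, of the metric coefficients and their derivatives of order at most $m$), and let $\mathcal M^\infty\subset\mathcal M^m$ be the set of smooth metrics. For $g\in\mathcal M^m$ let $H_g:\partial M\to\mathbb R$ be the mean curvature of $\partial M$ in $(M,g)$ with respect to the outward unit normal, that is, the trace (with respect to the metric induced on $\partial M$) of $(X,Y)\mapsto -\langle\nabla_XY,\nu\rangle$. A function on $\partial M$ that is at least $C^2$ is called Morse if its Hessian is nondegenerate at each of its critical points. Put $$\mathcal S^m=\{g\in\mathcal M^m : H_g \text{ is a Morse function on } \partial M\},\qquad \mathcal S=\mathcal S^m\cap\mathcal M^\infty .$$ Then: 1. $\mathcal S^m$ is open in $\mathcal M^m$, and $\mathcal S$ is open in $\mathcal M^\infty$ with respect to the $C^m$ topology. 2. $\mathcal S$ is dense in $\mathcal M^m$ (hence so is $\mathcal S^m$). 3. For every $g\in\mathcal M^\infty$ and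 every neighbourhood $U$ of $g$ in $\mathcal M^m$ there is a smooth function $u:M\to\mathbb R$ with $u=0$ on $\partial M$ such that $e^{2u}g\in U\cap\mathcal S$. -/

import Mathlib

open scoped Manifold ContDiff Topology

noncomputable section

namespace BoundaryMorse

/-- The model vector space `ℝⁿ⁺¹` of the manifold. -/
abbrev E (n : ℕ) : Type := EuclideanSpace ℝ (Fin (n + 1))

/-- The space of bilinear forms on `ℝⁿ⁺¹`. -/
abbrev Bil (n : ℕ) : Type := E n →L[ℝ] E n →L[ℝ] ℝ

/-! ### Hypersurface geometry of `{x₀ = 0}` in the half-space `{x₀ ≥ 0}`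

Here `G` is a Riemannian metric in coordinates: `G x` is the inner product on `ℝⁿ⁺¹` at `x`. -/

/-- The coordinate vector field `∂ᵢ`. -/
def coordVec (n : ℕ) (i : Fin (n + 1)) : E n := EuclideanSpace.single i 1

/-- The matrix `(g_{ij})` of the metric at `x`. -/
def gramMatrix {n : ℕ} (G : E n → Bil n) (x : E n) : Matrix (Fin (n + 1)) (Fin (n + 1)) ℝ :=
  Matrix.of fun i j => G x (coordVec n i) (coordVec n j)

/-- The matrix `(g_{ab})`, `a, b ≥ 1`, of the metric induced on the hypersurface `{x₀ = 0}`. -/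
def boundaryGramMatrix {n : ℕ} (G : E n → Bil n) (x : E n) : Matrix (Fin n) (Fin n) ℝ :=
  Matrix.of fun a b => G x (coordVec n a.succ) (coordVec n b.succ)

/-- The Levi-Civita connection of `G` on constant vector fields, by the Koszul formula:
`⟨∇_u v, w⟩ = ½ (∂_u ⟨v, w⟩ + ∂_v ⟨u, w⟩ - ∂_w ⟨u, v⟩)`, with derivatives taken in the half-space
`{x₀ ≥ 0}`. -/
def koszul {n : ℕ} (G : E n → Bil n) (x u v w : E n) : ℝ :=
  (fderivWithin ℝ G (Set.range (𝓡∂ (n + 1))) x u v w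
    + fderivWithin ℝ G (Set.range (𝓡∂ (n + 1))) x v u w
    - fderivWithin ℝ G (Set.range (𝓡∂ (n + 1))) x w u v) / 2

/-- The outward unit normal of `{x₀ = 0}` with respect to `G`, with components
`νⁱ = - g^{i0} / √(g^{00})`. -/
def outwardNormal {n : ℕ} (G : E n → Bil n) (x : E n) : E n :=
  WithLp.toLp 2 fun i => - (gramMatrix G x)⁻¹ i 0 / √((gramMatrix G x)⁻¹ 0 0)

/-- The second fundamental form `A(∂_a, ∂_b) = - ⟨∇_{∂_a} ∂_b, ν⟩ = ⟨∇_{∂_a} ν, ∂_b⟩` of `{x₀ = 0}`,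
with `ν` the outward unit normal. -/
def secondFundamentalForm {n : ℕ} (G : E n → Bil n) (x : E n) : Matrix (Fin n) (Fin n) ℝ :=
  Matrix.of fun a b => - koszul G x (coordVec n a.succ) (coordVec n b.succ) (outwardNormal G x)

/-- The mean curvature of `{x₀ = 0}`: the trace of the second fundamental form with respect to the
induced metric. With this normalization the unit ball of `ℝ³` has boundary mean curvature `2`. -/
def localMeanCurvature {n : ℕ} (G : E n → Bil n) (x : E n) : ℝ :=
  ((boundaryGramMatrix G x)⁻¹ * secondFundamentalForm G x).trace

/-! ### Metrics on a manifold with boundary -/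

variable (n : ℕ) (M : Type*) [TopologicalSpace M] [ChartedSpace (EuclideanHalfSpace (n + 1)) M]
  [IsManifold (𝓡∂ (n + 1)) ∞ M]

/-- The Riemannian metrics of class `C^m` on the `(n+1)`-dimensional manifold with boundary `M`. -/
abbrev Metric (m : ℕ) : Type _ :=
  Bundle.ContMDiffRiemannianMetric (𝓡∂ (n + 1)) (m : ℕ∞ω) (E n)
    (fun x : M => TangentSpace (𝓡∂ (n + 1)) x)

variable {n M} {m : ℕ}

/-- The metric `g` in the coordinates `φ` of the preferred chart at `p`: at the point `y` of the
half-space it is `(v, w) ↦ g (Dφ⁻¹(y) v, Dφ⁻¹(y) w)`. -/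
def localMetric (g : Metric n M m) (p : M) (y : E n) : Bil n :=
  let D : E n →L[ℝ] E n := mfderivWithin 𝓘(ℝ, E n) (𝓡∂ (n + 1))
    (extChartAt (𝓡∂ (n + 1)) p).symm (Set.range (𝓡∂ (n + 1))) y
  let B : Bil n := g.inner ((extChartAt (𝓡∂ (n + 1)) p).symm y)
  B.bilinearComp D D

/-- The `C^m` topology on the `C^m` metrics: the coarsest topology for which, in each chart and for
each `k ≤ m`, the `k`-th derivative of the coordinate expression of the metric depends continuously
on the metric, for uniform convergence on the compact subsets of the image of the chart. -/
instance metricTopology : TopologicalSpace (Metric n M m) :=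
  ⨅ (p : M) (k : Fin (m + 1)), TopologicalSpace.induced
    (fun g : Metric n M m =>
      UniformOnFun.ofFun {K : Set (E n) | IsCompact K ∧ K ⊆ (extChartAt (𝓡∂ (n + 1)) p).target}
        (iteratedFDerivWithin ℝ (k : ℕ) (localMetric g p) (Set.range (𝓡∂ (n + 1)))))
    inferInstance

/-- The mean curvature `H_g : ∂M → ℝ` of `∂M` in `(M, g)` with respect to the outward unit
normal, computed at each boundary point in the preferred chart there (the value does not depend on
the chart). -/
def boundaryMeanCurvature (g : Metric n M m) (p : (𝓡∂ (n + 1)).boundary M) : ℝ :=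
  localMeanCurvature (localMetric g (p : M)) (extChartAt (𝓡∂ (n + 1)) (p : M) p)

/-- `g` is a smooth metric. -/
def IsSmoothMetric (g : Metric n M m) : Prop :=
  ContMDiff (𝓡∂ (n + 1)) ((𝓡∂ (n + 1)).prod 𝓘(ℝ, Bil n)) ∞
    (fun x : M => Bundle.TotalSpace.mk' (Bil n)
      (E := fun x : M => TangentSpace (𝓡∂ (n + 1)) x →L[ℝ] TangentSpace (𝓡∂ (n + 1)) x →L[ℝ] ℝ)
      x (g.inner x))

/-! ### Morse functions on the boundary -/

/-- The inverse of the boundary chart at `p ∈ ∂M` induced by the chart of `M` at `p`: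
`x' ↦ φ⁻¹(0, x')`. -/
def boundaryParam (p : (𝓡∂ (n + 1)).boundary M) (x : EuclideanSpace ℝ (Fin n)) : M :=
  (extChartAt (𝓡∂ (n + 1)) (p : M)).symm (WithLp.toLp 2 (Fin.cons (α := fun _ => ℝ) 0 x))

/-- The coordinates `x' ∈ ℝⁿ` of `p ∈ ∂M` in the boundary chart at `p`, so `φ(p) = (0, x')`. -/
def boundaryCoord (p : (𝓡∂ (n + 1)).boundary M) : EuclideanSpace ℝ (Fin n) :=
  WithLp.toLp 2 fun a => extChartAt (𝓡∂ (n + 1)) (p : M) p a.succ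

/-- The coordinate expression near `p` of a function `f` on `∂M` in the boundary chart at `p`. The
parametrization takes values in `∂M` near the coordinates of `p`; elsewhere the value is
irrelevant. -/
def boundaryExpr (f : (𝓡∂ (n + 1)).boundary M → ℝ) (p : (𝓡∂ (n + 1)).boundary M)
    (x : EuclideanSpace ℝ (Fin n)) : ℝ :=
  Function.extend Subtype.val f (fun _ : M => 0) (boundaryParam p x)

/-- A function on `∂M` is Morse if it is twice continuously differentiable and its Hessian is
nondegenerate at each of its critical points. (For a function of class `C^k` with `k ≥ 2`, in
particular for a smooth function, the first condition holds.) -/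
def IsMorse (f : (𝓡∂ (n + 1)).boundary M → ℝ) : Prop :=
  ∀ p : (𝓡∂ (n + 1)).boundary M,
    ContDiffAt ℝ 2 (boundaryExpr f p) (boundaryCoord p) ∧
    (fderiv ℝ (boundaryExpr f p) (boundaryCoord p) = 0 →
      ∀ v : EuclideanSpace ℝ (Fin n),
        (∀ w, fderiv ℝ (fderiv ℝ (boundaryExpr f p)) (boundaryCoord p) v w = 0) → v = 0)

variable (n M m)

/-- The `C^m` metrics whose boundary mean curvature is a Morse function on `∂M`. -/
def morseMetrics : Set (Metric n M m) := {g | IsMorse (boundaryMeanCurvature g)}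

/-- The smooth metrics, as a subset of the `C^m` metrics. -/
def smoothMetrics : Set (Metric n M m) := {g | IsSmoothMetric g}

end BoundaryMorse

end

noncomputable section

namespace BoundaryMorse
open Set Filter

/-! In a chart, the mean curvature of the boundary is a smooth function (`meanCurvatureJet`) of the
value and first derivative of the metric coefficients, as long as the metric is positive definite.
The coordinate expression of `H_g` therefore depends continuously on `g` with a loss of one
derivative, and its Hessian is controlled by three derivatives of `g`.

Openness. A nonzero differential and an injective Hessian are both open conditions, so nondegeneracy
is open jointly in the metric and the boundary point (`isOpen_setOf_morseAt`). Compactness of the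
boundary makes it open in the metric alone. To compare points in one fixed chart one needs
coordinate invariance of the mean curvature (`IsBoundaryChange.localMeanCurvature_pullback`) and of
nondegeneracy (`nondegAt_boundaryExpr`).

Conformal perturbation. If `u = x₀ ψ` near a boundary point, then `e^{2u} g` agrees with `g` on the
boundary there, and its mean curvature is `H_g - n ψ |dx₀|_g` (`localMeanCurvature_conformal`). A
suitable `ψ`, cut off by a bump function, adds a prescribed linear function `⟨a, x⟩` to `H_g` in the
boundary chart. By Sard's theorem for the gradient map, `H_g + ⟨a, x⟩` has only nondegenerate
critical points for almost every `a` (`exists_nondegAt_add_inner`). Finitely many such perturbations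
cover the boundary; by openness each can be taken so small that it preserves nondegeneracy on the
compact sets already treated (`exists_conformal_morse`).

Density. A `C^m` metric is approximated by smooth ones (`dense_smoothMetrics`): chart expressions
are extended to the half-space, averaged over translates pointing into the interior, so that no
values outside the half-space are used, and glued by a partition of unity. Averages and convex
combinations of inner products are inner products. The conformal perturbation is then applied to the
smooth approximation.

Continuity in the `C^m` topology is handled through `FamilyContDiff`, joint continuity of the
derivatives in parameter and point. This notion is stable under products, composition and change of
coordinates, so no norm estimates are needed; `familyContDiff_localMetric` and `continuousAt_metric`
translate between it and the topology. -/

/-! ### Families of functions with jointly continuous derivatives -/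

section Family

variable {ι : Type*} [TopologicalSpace ι]
  {V : Type} [NormedAddCommGroup V] [NormedSpace ℝ V]

/-- The family `f i`, `i` near `i₀`, consists of functions on `S` near `x` whose derivatives of
order at most `k` depend continuously at `(i₀, x)` on the parameter and the point. -/
def FamilyContDiff : (k : ℕ) → {F : Type} → [NormedAddCommGroup F] → [NormedSpace ℝ F] →
    (f : ι → V → F) → (S : Set V) → (i₀ : ι) → (x : V) → Prop
  | 0, _, _, _, f, S, i₀, x =>
      ContinuousWithinAt (fun p : ι × V => f p.1 p.2) (univ ×ˢ S) (i₀, x)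
  | k + 1, _, _, _, f, S, i₀, x =>
      ContinuousWithinAt (fun p : ι × V => f p.1 p.2) (univ ×ˢ S) (i₀, x) ∧
      (∀ᶠ p in 𝓝[univ ×ˢ S] ((i₀, x) : ι × V), DifferentiableWithinAt ℝ (f p.1) S p.2) ∧
      FamilyContDiff k (fun i y => fderivWithin ℝ (f i) S y) S i₀ x

variable {F G H : Type} [NormedAddCommGroup F] [NormedSpace ℝ F] [NormedAddCommGroup G]
  [NormedSpace ℝ G] [NormedAddCommGroup H] [NormedSpace ℝ H]
  {S : Set V} {i₀ : ι} {x : V} {k : ℕ} {f f' : ι → V → F} {g : ι → V → G}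

theorem FamilyContDiff.continuousWithinAt (h : FamilyContDiff k f S i₀ x) :
    ContinuousWithinAt (fun p : ι × V => f p.1 p.2) (univ ×ˢ S) (i₀, x) := by
  cases k with
  | zero => exact h
  | succ k => exact h.1

theorem FamilyContDiff.of_succ {k : ℕ} : ∀ {F : Type} [NormedAddCommGroup F] [NormedSpace ℝ F]
    {f : ι → V → F}, FamilyContDiff (k + 1) f S i₀ x → FamilyContDiff k f S i₀ x := by
  induction k with
  | zero => intro F _ _ f h; exact h.1
  | succ k ih => intro F _ _ f h; exact ⟨h.1, h.2.1, ih h.2.2⟩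

theorem FamilyContDiff.of_le {j : ℕ} (h : FamilyContDiff k f S i₀ x) (hj : j ≤ k) :
    FamilyContDiff j f S i₀ x := by
  induction k, hj using Nat.le_induction with
  | base => exact h
  | succ k _ ih => exact ih h.of_succ

-- Derivatives are taken at a fixed parameter, so a property holding near the pair has to be
-- available on a whole neighbourhood in the slice through each nearby pair.
omit [NormedSpace ℝ V] in
theorem eventually_slice {P : ι × V → Prop} {S : Set V} {i₀ : ι} {x : V}
    (h : ∀ᶠ p in 𝓝[univ ×ˢ S] ((i₀, x) : ι × V), P p) :
    ∀ᶠ p in 𝓝[univ ×ˢ S] ((i₀, x) : ι × V), ∀ᶠ y in 𝓝[S] p.2, P (p.1, y) := by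
  rw [← eventually_eventually_nhdsWithin] at h
  filter_upwards [h] with p hp
  rw [show p = (p.1, p.2) from rfl, nhdsWithin_prod_eq, nhdsWithin_univ] at hp
  exact hp.curry.self_of_nhds

omit [NormedSpace ℝ V] in
theorem eventually_mem_snd : ∀ᶠ p in 𝓝[univ ×ˢ S] ((i₀, x) : ι × V), p.2 ∈ S := by
  filter_upwards [self_mem_nhdsWithin] with p hp using hp.2

omit [NormedSpace ℝ V] in
theorem eventually_snd {P : V → Prop} (h : ∀ᶠ y in 𝓝[S] x, P y) :
    ∀ᶠ p in 𝓝[univ ×ˢ S] ((i₀, x) : ι × V), P p.2 := by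
  rw [nhdsWithin_prod_eq]
  exact h.prod_inr _

/-- Agreement near the pair passes to slices and hence to derivatives. The codomain is quantified
inside the induction, here and below, because each derivative takes values in a new space. -/
theorem FamilyContDiff.congr (hx : x ∈ S) {k : ℕ} : ∀ {F : Type} [NormedAddCommGroup F]
    [NormedSpace ℝ F] {f f' : ι → V → F}, FamilyContDiff k f S i₀ x →
    (∀ᶠ p in 𝓝[univ ×ˢ S] ((i₀, x) : ι × V), f' p.1 p.2 = f p.1 p.2) →
    FamilyContDiff k f' S i₀ x := by
  have hx' : ((i₀, x) : ι × V) ∈ (univ : Set ι) ×ˢ S := ⟨mem_univ _, hx⟩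
  induction k with
  | zero =>
    intro F _ _ f f' h he
    exact ContinuousWithinAt.congr_of_eventuallyEq h he (he.self_of_nhdsWithin hx')
  | succ k ih =>
    intro F _ _ f f' h he
    have hs := eventually_slice he
    refine ⟨h.1.congr_of_eventuallyEq he (he.self_of_nhdsWithin hx'), ?_, ih h.2.2 ?_⟩
    · filter_upwards [h.2.1, hs, he] with p hp hp' hp''
      exact hp.congr_of_eventuallyEq hp' hp''
    · filter_upwards [hs, he] with p hp hp'
      exact EventuallyEq.fderivWithin_eq hp hp'

theorem FamilyContDiff.const (hS : UniqueDiffOn ℝ S) (hx : x ∈ S) {k : ℕ} :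
    ∀ {F : Type} [NormedAddCommGroup F] [NormedSpace ℝ F] {f : V → F},
    ContDiffWithinAt ℝ k f S x → FamilyContDiff k (fun _ : ι => f) S i₀ x := by
  have key : ∀ {F : Type} [NormedAddCommGroup F] [NormedSpace ℝ F] {f : V → F},
      ContinuousWithinAt f S x →
      ContinuousWithinAt (fun p : ι × V => f p.2) (univ ×ˢ S) (i₀, x) := fun {F} _ _ f h =>
    ContinuousWithinAt.comp (t := S) (f := Prod.snd) (x := ((i₀, x) : ι × V)) h
      continuous_snd.continuousWithinAt fun p hp => hp.2
  induction k with
  | zero => intro F _ _ f h; exact key h.continuousWithinAt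
  | succ k ih =>
    intro F _ _ f h
    refine ⟨key h.continuousWithinAt, eventually_snd ?_, ih ?_⟩
    · have := (h.of_le (m := 1) (by norm_cast; omega)).eventually (by simp)
      rw [insert_eq_of_mem hx] at this
      filter_upwards [this] with y hy using hy.differentiableWithinAt (by simp)
    · exact h.fderivWithin_right hS (by norm_cast) hx

theorem FamilyContDiff.clm_comp (hS : UniqueDiffOn ℝ S) (hx : x ∈ S) {k : ℕ} :
    ∀ {F G : Type} [NormedAddCommGroup F] [NormedSpace ℝ F] [NormedAddCommGroup G]
    [NormedSpace ℝ G] {f : ι → V → F} (L : F →L[ℝ] G), FamilyContDiff k f S i₀ x →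
    FamilyContDiff k (fun i y => L (f i y)) S i₀ x := by
  induction k with
  | zero => intro F G _ _ _ _ f L h; exact L.continuous.continuousAt.comp_continuousWithinAt h
  | succ k ih =>
    intro F G _ _ _ _ f L h
    refine ⟨L.continuous.continuousAt.comp_continuousWithinAt h.1, ?_, ?_⟩
    · filter_upwards [h.2.1] with p hp
      exact L.differentiableAt.comp_differentiableWithinAt _ hp
    · refine (ih (ContinuousLinearMap.compL ℝ V F G L) h.2.2).congr hx ?_
      filter_upwards [h.2.1, eventually_mem_snd] with p hp hp'
      exact (L.hasFDerivAt.comp_hasFDerivWithinAt p.2 hp.hasFDerivWithinAt).fderivWithin (hS _ hp')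

theorem FamilyContDiff.add (hS : UniqueDiffOn ℝ S) (hx : x ∈ S) {k : ℕ} :
    ∀ {F : Type} [NormedAddCommGroup F] [NormedSpace ℝ F]
    {f g : ι → V → F}, FamilyContDiff k f S i₀ x → FamilyContDiff k g S i₀ x →
    FamilyContDiff k (fun i y => f i y + g i y) S i₀ x := by
  induction k with
  | zero => intro F _ _ f g h h'; exact ContinuousWithinAt.add h h'
  | succ k ih =>
    intro F _ _ f g h h'
    refine ⟨h.1.add h'.1, ?_, (ih h.2.2 h'.2.2).congr hx ?_⟩
    · filter_upwards [h.2.1, h'.2.1] with p hp hp' using hp.add hp'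
    · filter_upwards [h.2.1, h'.2.1, eventually_mem_snd] with p hp hp' hp''
      exact fderivWithin_fun_add (hS _ hp'') hp hp'

/-- Leibniz rule: the derivative is a sum of two bilinear expressions in one factor and the
derivative of the other, to which the induction hypothesis applies. -/
theorem FamilyContDiff.bilin (hS : UniqueDiffOn ℝ S) (hx : x ∈ S) {k : ℕ} :
    ∀ {F G H : Type} [NormedAddCommGroup F] [NormedSpace ℝ F] [NormedAddCommGroup G]
    [NormedSpace ℝ G] [NormedAddCommGroup H] [NormedSpace ℝ H] {f : ι → V → F} {g : ι → V → G}
    (B : F →L[ℝ] G →L[ℝ] H), FamilyContDiff k f S i₀ x → FamilyContDiff k g S i₀ x →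
    FamilyContDiff k (fun i y => B (f i y) (g i y)) S i₀ x := by
  have key : ∀ {F G H : Type} [NormedAddCommGroup F] [NormedSpace ℝ F] [NormedAddCommGroup G]
      [NormedSpace ℝ G] [NormedAddCommGroup H] [NormedSpace ℝ H] {f : ι → V → F} {g : ι → V → G}
      (B : F →L[ℝ] G →L[ℝ] H),
      ContinuousWithinAt (fun p : ι × V => f p.1 p.2) (univ ×ˢ S) (i₀, x) →
      ContinuousWithinAt (fun p : ι × V => g p.1 p.2) (univ ×ˢ S) (i₀, x) →
      ContinuousWithinAt (fun p : ι × V => B (f p.1 p.2) (g p.1 p.2)) (univ ×ˢ S) (i₀, x) := by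
    intro F G H _ _ _ _ _ _ f g B h h'
    exact (B.continuous.continuousAt.comp_continuousWithinAt h).clm_apply h'
  induction k with
  | zero => intro F G H _ _ _ _ _ _ f g B h h'; exact key B h h'
  | succ k ih =>
    intro F G H _ _ _ _ _ _ f g B h h'
    refine ⟨key B h.1 h'.1, ?_, ?_⟩
    · filter_upwards [h.2.1, h'.2.1] with p hp hp'
      exact (B.hasFDerivWithinAt_of_bilinear hp.hasFDerivWithinAt
        hp'.hasFDerivWithinAt).differentiableWithinAt
    · refine (FamilyContDiff.add hS hx (ih (B.precompR V) h.of_succ h'.2.2)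
        (ih (B.precompL V) h.2.2 h'.of_succ)).congr hx ?_
      filter_upwards [h.2.1, h'.2.1, eventually_mem_snd] with p hp hp' hp''
      exact B.fderivWithin_of_bilinear hp hp' (hS _ hp'')

/-- By the chain rule the derivative is the bilinear composition of `Φ' ∘ f` with `f'`; the first
factor is covered by the induction hypothesis for `Φ'`, the second by assumption. -/
theorem FamilyContDiff.contDiffAt_comp (hS : UniqueDiffOn ℝ S) (hx : x ∈ S) {k : ℕ} :
    ∀ {F G : Type} [NormedAddCommGroup F] [NormedSpace ℝ F] [NormedAddCommGroup G]
    [NormedSpace ℝ G] {f : ι → V → F} {Φ : F → G}, ContDiffAt ℝ k Φ (f i₀ x) →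
    FamilyContDiff k f S i₀ x → FamilyContDiff k (fun i y => Φ (f i y)) S i₀ x := by
  induction k with
  | zero =>
    intro F G _ _ _ _ f Φ hΦ h
    exact ContinuousAt.comp_continuousWithinAt (f := fun p : ι × V => f p.1 p.2)
      (x := (i₀, x)) hΦ.continuousAt h
  | succ k ih =>
    intro F G _ _ _ _ f Φ hΦ h
    have hd : ∀ᶠ p in 𝓝[univ ×ˢ S] ((i₀, x) : ι × V), DifferentiableAt ℝ Φ (f p.1 p.2) := by
      have := (hΦ.of_le (m := 1) (by norm_cast; omega)).eventually (by simp)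
      filter_upwards [h.1.eventually this] with p hp using hp.differentiableAt (by simp)
    refine ⟨ContinuousAt.comp_continuousWithinAt (f := fun p : ι × V => f p.1 p.2)
      (x := (i₀, x)) hΦ.continuousAt h.1, ?_, ?_⟩
    · filter_upwards [h.2.1, hd] with p hp hp'
      exact hp'.comp_differentiableWithinAt _ hp
    · refine (FamilyContDiff.bilin hS hx (ContinuousLinearMap.compL ℝ V F G)
        (ih (hΦ.fderiv_right (m := k) (by norm_cast)) h.of_succ) h.2.2).congr hx ?_
      filter_upwards [h.2.1, hd, eventually_mem_snd] with p hp hp' hp''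
      exact fderiv_comp_fderivWithin p.2 hp' hp (hS _ hp'')

theorem FamilyContDiff.comp_inner {W : Type} [NormedAddCommGroup W] [NormedSpace ℝ W]
    {T : Set W} (hT : UniqueDiffOn ℝ T) {τ : W → V} {w : W} (hw : w ∈ T)
    (hmaps : ∀ᶠ y in 𝓝[T] w, τ y ∈ S) {k : ℕ} :
    ∀ {F : Type} [NormedAddCommGroup F] [NormedSpace ℝ F] {f : ι → V → F},
    ContDiffWithinAt ℝ k τ T w → FamilyContDiff k f S i₀ (τ w) →
    FamilyContDiff k (fun i y => f i (τ y)) T i₀ w := by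
  have ht : ContinuousWithinAt τ T w →
      Tendsto (fun p : ι × W => (p.1, τ p.2)) (𝓝[univ ×ˢ T] (i₀, w))
      (𝓝[univ ×ˢ S] (i₀, τ w)) := by
    intro h
    rw [nhdsWithin_prod_eq, nhdsWithin_prod_eq]
    exact (tendsto_id).prodMap (tendsto_nhdsWithin_iff.2 ⟨h, hmaps⟩)
  induction k with
  | zero =>
    intro F _ _ f hτ h
    exact Tendsto.comp (x := 𝓝[univ ×ˢ T] (i₀, w)) h (ht hτ.continuousWithinAt)
  | succ k ih =>
    intro F _ _ f hτ h
    have htτ := ht hτ.continuousWithinAt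
    have hd : ∀ᶠ p in 𝓝[univ ×ˢ T] ((i₀, w) : ι × W), DifferentiableWithinAt ℝ τ T p.2 := by
      apply eventually_snd
      have := (hτ.of_le (m := 1) (by norm_cast; omega)).eventually (by simp)
      rw [insert_eq_of_mem hw] at this
      filter_upwards [this] with y hy using hy.differentiableWithinAt (by simp)
    have hm : ∀ᶠ p in 𝓝[univ ×ˢ T] ((i₀, w) : ι × W), ∀ᶠ y in 𝓝[T] p.2, τ y ∈ S :=
      eventually_slice (P := fun p => τ p.2 ∈ S) (eventually_snd hmaps)
    have hfd := htτ.eventually h.2.1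
    have hcomp : ∀ᶠ p in 𝓝[univ ×ˢ T] ((i₀, w) : ι × W),
        HasFDerivWithinAt (fun y => f p.1 (τ y))
          ((fderivWithin ℝ (f p.1) S (τ p.2)).comp (fderivWithin ℝ τ T p.2)) T p.2 := by
      filter_upwards [hd, hm, hfd] with p hp hp' hp''
      -- `τ` maps into `S` only locally, so the chain rule is applied on the subset where it does;
      -- this subset is a neighbourhood within `T`.
      have h1 : HasFDerivWithinAt τ (fderivWithin ℝ τ T p.2) (T ∩ {y | τ y ∈ S}) p.2 :=
        hp.hasFDerivWithinAt.mono inter_subset_left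
      have h2 := HasFDerivWithinAt.comp (t := S) p.2 hp''.hasFDerivWithinAt h1 fun y hy => hy.2
      exact h2.mono_of_mem_nhdsWithin (inter_mem self_mem_nhdsWithin hp')
    refine ⟨Tendsto.comp (x := 𝓝[univ ×ˢ T] (i₀, w)) h.1 htτ, ?_, ?_⟩
    · filter_upwards [hcomp] with p hp using hp.differentiableWithinAt
    · refine (FamilyContDiff.bilin hT hw (ContinuousLinearMap.compL ℝ W V F)
        (ih (hτ.of_le (by norm_cast; omega)) h.2.2)
        (FamilyContDiff.const (f := fderivWithin ℝ τ T) hT hw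
          (hτ.fderivWithin_right hT (by norm_cast) hw))).congr hw ?_
      filter_upwards [hcomp, eventually_mem_snd] with p hp hp'
      exact hp.fderivWithin (hT _ hp')

theorem FamilyContDiff.param (hS : UniqueDiffOn ℝ S) (hx : x ∈ S) {c : ι → F}
    (hc : ContinuousAt c i₀) : FamilyContDiff k (fun i (_ : V) => c i) S i₀ x := by
  have h0 : ContinuousWithinAt (fun p : ι × V => c p.1) (univ ×ˢ S) (i₀, x) :=
    (ContinuousAt.comp (f := Prod.fst) (x := ((i₀, x) : ι × V)) hc
      continuous_fst.continuousAt).continuousWithinAt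
  cases k with
  | zero => exact h0
  | succ k =>
    refine ⟨h0, Eventually.of_forall fun p => differentiableWithinAt_const _, ?_⟩
    refine (FamilyContDiff.const (f := fun _ => (0 : V →L[ℝ] F)) hS hx
      contDiffWithinAt_const).congr hx ?_
    exact Eventually.of_forall fun p => by simp

theorem FamilyContDiff.prodMk (hS : UniqueDiffOn ℝ S) (hx : x ∈ S)
    (hf : FamilyContDiff k f S i₀ x) (hg : FamilyContDiff k g S i₀ x) :
    FamilyContDiff k (fun i y => (f i y, g i y)) S i₀ x := by
  have := (hf.clm_comp hS hx (ContinuousLinearMap.inl ℝ F G)).add hS hx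
    (hg.clm_comp hS hx (ContinuousLinearMap.inr ℝ F G))
  simpa using this

theorem FamilyContDiff.smul (hS : UniqueDiffOn ℝ S) (hx : x ∈ S) {c : ι → V → ℝ}
    (hc : FamilyContDiff k c S i₀ x) (hf : FamilyContDiff k f S i₀ x) :
    FamilyContDiff k (fun i y => c i y • f i y) S i₀ x :=
  hc.bilin hS hx (ContinuousLinearMap.lsmul ℝ ℝ) hf

theorem FamilyContDiff.sum (hS : UniqueDiffOn ℝ S) (hx : x ∈ S) {α : Type*} (s : Finset α)
    {f : α → ι → V → F} (h : ∀ a ∈ s, FamilyContDiff k (f a) S i₀ x) :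
    FamilyContDiff k (fun i y => ∑ a ∈ s, f a i y) S i₀ x := by
  classical
  induction s using Finset.induction_on with
  | empty =>
    simpa using FamilyContDiff.param (k := k) (i₀ := i₀) (c := fun _ : ι => (0 : F)) hS hx
      continuousAt_const
  | insert a s ha ih =>
    simp only [Finset.sum_insert ha]
    exact (h a (by simp)).add hS hx (ih fun b hb => h b (by simp [hb]))

/-- If the family consists of `C^k` functions, joint continuity of the iterated derivatives is
the same as joint continuity of the derivatives. -/
theorem familyContDiff_iff_iteratedFDerivWithin (hS : UniqueDiffOn ℝ S) (hx : x ∈ S) {k : ℕ} :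
    ∀ {F : Type} [NormedAddCommGroup F] [NormedSpace ℝ F] {f : ι → V → F} {T : Set V},
    T ∈ 𝓝[S] x → (∀ i, ∀ y ∈ S ∩ T, ContDiffWithinAt ℝ k (f i) S y) →
    (FamilyContDiff k f S i₀ x ↔ ∀ j ≤ k,
      ContinuousWithinAt (fun p : ι × V => iteratedFDerivWithin ℝ j (f p.1) S p.2)
        (univ ×ˢ S) (i₀, x)) := by
  have hx' : ((i₀, x) : ι × V) ∈ (univ : Set ι) ×ˢ S := ⟨mem_univ _, hx⟩
  have h0 : ∀ {F : Type} [NormedAddCommGroup F] [NormedSpace ℝ F] {f : ι → V → F},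
      ContinuousWithinAt (fun p : ι × V => f p.1 p.2) (univ ×ˢ S) (i₀, x) ↔
      ContinuousWithinAt (fun p : ι × V => iteratedFDerivWithin ℝ 0 (f p.1) S p.2)
        (univ ×ˢ S) (i₀, x) := by
    intro F _ _ f
    simp only [iteratedFDerivWithin_zero_eq_comp]
    exact (continuousMultilinearCurryFin0 ℝ V F).symm.toHomeomorph.isInducing.continuousWithinAt_iff
  have hs : ∀ {F : Type} [NormedAddCommGroup F] [NormedSpace ℝ F] {f : ι → V → F} (j : ℕ),
      ContinuousWithinAt
        (fun p : ι × V => iteratedFDerivWithin ℝ j (fderivWithin ℝ (f p.1) S) S p.2)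
        (univ ×ˢ S) (i₀, x) ↔
      ContinuousWithinAt (fun p : ι × V => iteratedFDerivWithin ℝ (j + 1) (f p.1) S p.2)
        (univ ×ˢ S) (i₀, x) := by
    intro F _ _ f j
    rw [(continuousMultilinearCurryRightEquiv'
      ℝ j V F).symm.toHomeomorph.isInducing.continuousWithinAt_iff]
    apply continuousWithinAt_congr_of_mem _ hx'
    intro p hp
    exact (iteratedFDerivWithin_succ_eq_comp_right hS hp.2).symm
  induction k with
  | zero =>
    intro F _ _ f T hT hf
    constructor
    · intro h j hj
      obtain rfl : j = 0 := by omega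
      exact h0.1 h
    · intro h
      exact h0.2 (h 0 le_rfl)
  | succ k ih =>
    intro F _ _ f T hT hf
    have hf' : ∀ i, ∀ y ∈ S ∩ T,
        ContDiffWithinAt ℝ k (fun y => fderivWithin ℝ (f i) S y) S y :=
      fun i y hy => (hf i y hy).fderivWithin_right hS (by norm_cast) hy.1
    have := ih hT hf'
    constructor
    · rintro ⟨h1, h2, h3⟩ j hj
      cases j with
      | zero => exact h0.1 h1
      | succ j => exact (hs j).1 (this.1 h3 j (by omega))
    · intro h
      refine ⟨h0.2 (h 0 (by omega)), ?_, this.2 fun j hj => (hs j).2 (h (j + 1) (by omega))⟩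
      filter_upwards [eventually_mem_snd, eventually_snd hT] with p hp hp'
      exact (hf p.1 p.2 ⟨hp, hp'⟩).differentiableWithinAt (by norm_cast)

end Family

/-! ### Linear algebra of inner products on `ℝⁿ⁺¹` -/

/-- The closed half-space `{x₀ ≥ 0}`. -/
abbrev halfSpace (n : ℕ) : Set (E n) := Set.range (𝓡∂ (n + 1))

theorem mem_halfSpace {n : ℕ} {y : E n} : y ∈ halfSpace n ↔ 0 ≤ y 0 := by
  rw [halfSpace, range_modelWithCornersEuclideanHalfSpace]; rfl

theorem uniqueDiffOn_halfSpace (n : ℕ) : UniqueDiffOn ℝ (halfSpace n) := (𝓡∂ (n + 1)).uniqueDiffOn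

/-- Symmetric positive definite bilinear forms. -/
def IsInner {n : ℕ} (B : Bil n) : Prop := (∀ v w, B v w = B w v) ∧ ∀ v, v ≠ 0 → 0 < B v v

theorem coordVec_apply {n : ℕ} (i j : Fin (n + 1)) :
    coordVec n i j = if j = i then 1 else 0 := by
  simp [coordVec]

theorem eq_sum_coordVec {n : ℕ} (v : E n) : v = ∑ i, v i • coordVec n i := by
  ext j
  simp [coordVec_apply, Finset.sum_apply]

theorem eq_sum_tangential {n : ℕ} {v : E n} (hv : v 0 = 0) :
    v = ∑ a : Fin n, v a.succ • coordVec n a.succ := by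
  conv_lhs => rw [eq_sum_coordVec v, Fin.sum_univ_succ, hv, zero_smul, zero_add]

theorem apply_eq_sum {n : ℕ} (B : Bil n) (v w : E n) :
    B v w = ∑ i, ∑ j, v i * B (coordVec n i) (coordVec n j) * w j := by
  conv_lhs => rw [eq_sum_coordVec v, eq_sum_coordVec w]
  simp only [map_sum, map_smul, sum_apply, smul_apply,
    smul_eq_mul, Finset.mul_sum]
  rw [Finset.sum_comm]
  refine Finset.sum_congr rfl fun i _ => Finset.sum_congr rfl fun j _ => by ring

theorem posDef_gramMatrix {n : ℕ} {G : E n → Bil n} {x : E n} (h : IsInner (G x)) :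
    (gramMatrix G x).PosDef := by
  refine Matrix.PosDef.of_dotProduct_mulVec_pos ?_ ?_
  · ext i j
    simp [gramMatrix, h.1 (coordVec n j)]
  · intro v hv
    have := h.2 (WithLp.toLp 2 v) (by simpa using hv)
    rw [apply_eq_sum] at this
    simpa [dotProduct, Matrix.mulVec, Finset.mul_sum, gramMatrix, mul_assoc] using this

theorem posDef_boundaryGramMatrix {n : ℕ} {G : E n → Bil n} {x : E n} (h : IsInner (G x)) :
    (boundaryGramMatrix G x).PosDef :=
  (posDef_gramMatrix h).submatrix (Fin.succ_injective n)

theorem inv_gramMatrix_zero_pos {n : ℕ} {G : E n → Bil n} {x : E n} (h : IsInner (G x)) :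
    0 < (gramMatrix G x)⁻¹ 0 0 :=
  (posDef_gramMatrix h).inv.diag_pos

theorem outwardNormal_zero {n : ℕ} {G : E n → Bil n} {x : E n} (h : IsInner (G x)) :
    outwardNormal G x 0 = - √((gramMatrix G x)⁻¹ 0 0) := by
  have := inv_gramMatrix_zero_pos h
  simp only [outwardNormal]
  rw [neg_div, Real.div_sqrt]

/-- Up to normalization the normal is `-dx₀` with its index raised, so pairing it with the metric
multiplies the Gram matrix by a column of its inverse. -/
theorem inner_coordVec_outwardNormal {n : ℕ} {G : E n → Bil n} {x : E n} (h : IsInner (G x))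
    (j : Fin (n + 1)) : G x (coordVec n j) (outwardNormal G x) =
      if j = 0 then - (√((gramMatrix G x)⁻¹ 0 0))⁻¹ else 0 := by
  have hdet : IsUnit (gramMatrix G x).det := (posDef_gramMatrix h).det_pos.ne'.isUnit
  have h1 := congrFun (congrFun (Matrix.mul_nonsing_inv _ hdet) j) 0
  rw [Matrix.mul_apply, Matrix.one_apply] at h1
  have h2 : G x (coordVec n j) (outwardNormal G x) =
      - (∑ i, gramMatrix G x j i * (gramMatrix G x)⁻¹ i 0) / √((gramMatrix G x)⁻¹ 0 0) := by
    conv_lhs => rw [eq_sum_coordVec (outwardNormal G x)]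
    rw [map_sum, ← Finset.sum_neg_distrib, Finset.sum_div]
    refine Finset.sum_congr rfl fun i _ => ?_
    simp only [outwardNormal, map_smul, smul_eq_mul, gramMatrix, Matrix.of_apply]
    ring
  rw [h2, h1]
  split_ifs <;> simp [div_eq_mul_inv]

theorem inner_outwardNormal_tangential {n : ℕ} {G : E n → Bil n} {x : E n} (h : IsInner (G x))
    {v : E n} (hv : v 0 = 0) : G x v (outwardNormal G x) = 0 := by
  rw [eq_sum_tangential hv]
  simp only [map_sum, map_smul, sum_apply, smul_apply,
    inner_coordVec_outwardNormal h]
  simp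

theorem inner_outwardNormal_self {n : ℕ} {G : E n → Bil n} {x : E n} (h : IsInner (G x)) :
    G x (outwardNormal G x) (outwardNormal G x) = 1 := by
  have hp := Real.sqrt_pos.2 (inv_gramMatrix_zero_pos h)
  conv_lhs => enter [1]; rw [eq_sum_coordVec (outwardNormal G x)]
  simp only [map_sum, map_smul, sum_apply, smul_apply,
    inner_coordVec_outwardNormal h]
  simp [outwardNormal_zero h, hp.ne']

/-- The outward unit normal is determined by being normal, of unit length and outward. -/
theorem eq_outwardNormal {n : ℕ} {G : E n → Bil n} {x : E n} (h : IsInner (G x)) {w : E n}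
    (hw : ∀ v : E n, v 0 = 0 → G x v w = 0) (h1 : G x w w = 1) (h0 : w 0 < 0) :
    w = outwardNormal G x := by
  set ν := outwardNormal G x with hν
  have hν0 : ν 0 < 0 := by
    rw [hν, outwardNormal_zero h]
    exact neg_neg_of_pos (Real.sqrt_pos.2 (inv_gramMatrix_zero_pos h))
  -- With this `c` the vector `w - c ν` is tangential, while `w` and `ν` are both normal; it is thus
  -- orthogonal to itself and vanishes. Unit length and the sign then force `c = 1`.
  set c := w 0 / ν 0 with hc
  have hcpos : 0 < c := div_pos_of_neg_of_neg h0 hν0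
  have ht : (w - c • ν) 0 = 0 := by
    simp [hc, hν0.ne]
  have hz : w - c • ν = 0 := by
    by_contra hne
    have := h.2 _ hne
    have e : G x (w - c • ν) (w - c • ν) = G x (w - c • ν) w - c * G x (w - c • ν) ν := by
      rw [map_sub, map_smul, smul_eq_mul]
    rw [e, hw _ ht, inner_outwardNormal_tangential h ht] at this
    simp at this
  have hwc : w = c • ν := sub_eq_zero.1 hz
  have hc1 : c = 1 := by
    rw [hwc] at h1
    simp only [map_smul, smul_apply, smul_eq_mul, hν,
      inner_outwardNormal_self h] at h1
    nlinarith
  rw [hwc, hc1, one_smul]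

theorem IsInner.bilinearComp {n : ℕ} {B : Bil n} (h : IsInner B) {A : E n →L[ℝ] E n}
    (hA : Function.Injective A) : IsInner (B.bilinearComp A A) :=
  ⟨fun v w => h.1 _ _, fun v hv => h.2 _ fun h0 => hv (hA (by simpa using h0))⟩

/-! ### The Koszul formula -/

theorem koszul_sum_left {n : ℕ} (G : E n → Bil n) (x v w : E n) {α : Type*} (s : Finset α)
    (c : α → ℝ) (u : α → E n) :
    koszul G x (∑ a ∈ s, c a • u a) v w = ∑ a ∈ s, c a * koszul G x (u a) v w := by
  classical
  induction s using Finset.induction_on with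
  | empty => simp [koszul]
  | insert a s ha ih =>
    rw [Finset.sum_insert ha, Finset.sum_insert ha, ← ih]
    simp only [koszul, map_add, map_smul, add_apply,
      smul_apply, smul_eq_mul]
    ring

theorem koszul_sum_middle {n : ℕ} (G : E n → Bil n) (x u w : E n) {α : Type*} (s : Finset α)
    (c : α → ℝ) (v : α → E n) :
    koszul G x u (∑ a ∈ s, c a • v a) w = ∑ a ∈ s, c a * koszul G x u (v a) w := by
  classical
  induction s using Finset.induction_on with
  | empty => simp [koszul]
  | insert a s ha ih =>
    rw [Finset.sum_insert ha, Finset.sum_insert ha, ← ih]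
    simp only [koszul, map_add, map_smul, add_apply,
      smul_apply, smul_eq_mul]
    ring

/-- The trace of one bilinear form with respect to another is independent of the basis: `P⁻¹ A`
changes by conjugation. -/
theorem trace_inv_mul_congr {n : ℕ} (P A J : Matrix (Fin n) (Fin n) ℝ) (hJ : IsUnit J.det) :
    ((J.transpose * P * J)⁻¹ * (J.transpose * A * J)).trace = (P⁻¹ * A).trace := by
  have hJt : IsUnit J.transpose.det := by rwa [Matrix.det_transpose]
  rw [Matrix.mul_inv_rev, Matrix.mul_inv_rev]
  have : J⁻¹ * (P⁻¹ * (J.transpose)⁻¹) * (J.transpose * A * J) = J⁻¹ * (P⁻¹ * A * J) := by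
    simp only [Matrix.mul_assoc]
    rw [Matrix.nonsing_inv_mul_cancel_left _ _ hJt]
  rw [this, Matrix.trace_mul_comm, Matrix.mul_assoc, Matrix.mul_nonsing_inv _ hJ, Matrix.mul_one]

/-! ### Invariance of the mean curvature under changes of coordinates -/

/-- The line through `y` in direction `v` stays in the boundary hyperplane, where `ψ` vanishes. -/
theorem fderivWithin_tangential_eq_zero {n : ℕ} {F : Type*} [NormedAddCommGroup F]
    [NormedSpace ℝ F] {ψ : E n → F} {y v : E n} (hψ : DifferentiableWithinAt ℝ ψ (halfSpace n) y)
    (h0 : ∀ᶠ z in 𝓝[halfSpace n] y, z 0 = 0 → ψ z = 0) (hy : y 0 = 0) (hv : v 0 = 0) :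
    fderivWithin ℝ ψ (halfSpace n) y v = 0 := by
  have h1 := hψ.hasFDerivWithinAt.hasLineDerivWithinAt v
  have hz : ∀ t : ℝ, (y + t • v) 0 = 0 := fun t => by simp [hy, hv]
  have hpre : (fun t : ℝ => y + t • v) ⁻¹' (halfSpace n) = univ := by
    ext t
    simp only [mem_preimage, mem_halfSpace, hz, le_refl, mem_univ]
  rw [HasLineDerivWithinAt, hpre, hasDerivWithinAt_univ] at h1
  have ht : Tendsto (fun t : ℝ => y + t • v) (𝓝 0) (𝓝[halfSpace n] y) := by
    refine tendsto_nhdsWithin_iff.2 ⟨?_, Eventually.of_forall fun t => ?_⟩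
    · have : Continuous fun t : ℝ => y + t • v := by fun_prop
      simpa using this.tendsto 0
    · rw [mem_halfSpace, hz]
  have h2 : (fun t : ℝ => ψ (y + t • v)) =ᶠ[𝓝 0] fun _ => 0 := by
    filter_upwards [ht.eventually h0] with t ht' using ht' (hz t)
  exact h1.unique ((hasDerivAt_const (0 : ℝ) (0 : F)).congr_of_eventuallyEq h2)

/-- A `C²` change of coordinates of the half-space near a boundary point `y`, with invertible
derivative and preserving the boundary. -/
structure IsBoundaryChange {n : ℕ} (τ : E n → E n) (y : E n) : Prop where
  mem : y 0 = 0
  contDiff : ContDiffWithinAt ℝ 2 τ (halfSpace n) y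
  mapsTo : ∀ᶠ z in 𝓝[halfSpace n] y, τ z ∈ halfSpace n
  boundary : ∀ᶠ z in 𝓝[halfSpace n] y, z 0 = 0 → τ z 0 = 0
  injective : Function.Injective (fderivWithin ℝ τ (halfSpace n) y)

namespace IsBoundaryChange

variable {n : ℕ} {τ : E n → E n} {y : E n}

theorem mem_halfSpace (h : IsBoundaryChange τ y) : y ∈ halfSpace n :=
  BoundaryMorse.mem_halfSpace.2 h.mem.ge

theorem image_mem (h : IsBoundaryChange τ y) : τ y 0 = 0 :=
  h.boundary.self_of_nhdsWithin h.mem_halfSpace h.mem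

theorem eventually_differentiable (h : IsBoundaryChange τ y) :
    ∀ᶠ z in 𝓝[halfSpace n] y, DifferentiableWithinAt ℝ τ (halfSpace n) z := by
  have := h.contDiff.eventually (by simp)
  rw [insert_eq_of_mem h.mem_halfSpace] at this
  filter_upwards [this] with z hz using hz.differentiableWithinAt (by simp)

theorem differentiable (h : IsBoundaryChange τ y) :
    DifferentiableWithinAt ℝ τ (halfSpace n) y :=
  h.contDiff.differentiableWithinAt (by simp)

theorem fderivWithin_zero_eq {z : E n} (h : DifferentiableWithinAt ℝ τ (halfSpace n) z)
    (hz : z ∈ halfSpace n) (v : E n) :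
    fderivWithin ℝ τ (halfSpace n) z v 0 = fderivWithin ℝ (fun x => τ x 0) (halfSpace n) z v := by
  have := ((EuclideanSpace.proj (𝕜 := ℝ) (0 : Fin (n + 1))).hasFDerivAt.comp_hasFDerivWithinAt z
    h.hasFDerivWithinAt).fderivWithin (uniqueDiffOn_halfSpace n z hz)
  exact (DFunLike.congr_fun this v).symm

theorem tangential_of_mem {z : E n} (hd : DifferentiableWithinAt ℝ τ (halfSpace n) z)
    (hb : ∀ᶠ z in 𝓝[halfSpace n] z, z 0 = 0 → τ z 0 = 0) (hz : z 0 = 0) {v : E n} (hv : v 0 = 0) :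
    fderivWithin ℝ τ (halfSpace n) z v 0 = 0 := by
  have hz' : z ∈ halfSpace n := BoundaryMorse.mem_halfSpace.2 hz.ge
  rw [fderivWithin_zero_eq hd hz']
  refine fderivWithin_tangential_eq_zero ?_ hb hz hv
  exact (EuclideanSpace.proj (𝕜 := ℝ) (0 : Fin (n + 1))).differentiableAt.comp_differentiableWithinAt
    z hd

theorem tangential (h : IsBoundaryChange τ y) {v : E n} (hv : v 0 = 0) :
    fderivWithin ℝ τ (halfSpace n) y v 0 = 0 :=
  tangential_of_mem h.differentiable h.boundary h.mem hv

theorem differentiable_fderivWithin (h : IsBoundaryChange τ y) :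
    DifferentiableWithinAt ℝ (fderivWithin ℝ τ (halfSpace n)) (halfSpace n) y :=
  (h.contDiff.fderivWithin_right (m := 1) (uniqueDiffOn_halfSpace n) (by norm_num)
    h.mem_halfSpace).differentiableWithinAt (by simp)

/-- The function `z ↦ (Dτ(z) v)₀` vanishes along the boundary and is differentiated in a boundary
direction. Hence the inhomogeneous term in the transformation of the connection is orthogonal to the
normal. -/
theorem tangential_second (h : IsBoundaryChange τ y) {u v : E n} (hu : u 0 = 0) (hv : v 0 = 0) :
    fderivWithin ℝ (fderivWithin ℝ τ (halfSpace n)) (halfSpace n) y u v 0 = 0 := by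
  let L : (E n →L[ℝ] E n) →L[ℝ] ℝ :=
    (EuclideanSpace.proj (𝕜 := ℝ) (0 : Fin (n + 1))).comp (ContinuousLinearMap.apply ℝ (E n) v)
  have hd := h.differentiable_fderivWithin
  have h1 := (L.hasFDerivAt.comp_hasFDerivWithinAt y hd.hasFDerivWithinAt).fderivWithin
    (uniqueDiffOn_halfSpace n y h.mem_halfSpace)
  have h2 := fderivWithin_tangential_eq_zero
    (L.differentiableAt.comp_differentiableWithinAt y hd) (v := u) ?_ h.mem hu
  · rw [h1] at h2
    exact h2
  · have hb := h.boundary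
    rw [← eventually_eventually_nhdsWithin] at hb
    filter_upwards [h.eventually_differentiable, hb] with z hz hb' hz0
    exact tangential_of_mem hz hb' hz0 hv

/-- Nonnegativity is that of a one-sided difference quotient, since `τ` preserves the half-space. If
the number were zero, the image of the derivative would lie in `{x₀ = 0}`, contradicting
surjectivity. -/
theorem transversal (h : IsBoundaryChange τ y) :
    0 < fderivWithin ℝ τ (halfSpace n) y (coordVec n 0) 0 := by
  set A := fderivWithin ℝ τ (halfSpace n) y with hA
  have hsurj : Function.Surjective A := LinearMap.injective_iff_surjective.1 h.injective
  have hne : A (coordVec n 0) 0 ≠ 0 := by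
    intro h0
    obtain ⟨v, hv⟩ := hsurj (coordVec n 0)
    have e : A v 0 = 0 := by
      rw [eq_sum_coordVec v, Fin.sum_univ_succ, map_add, map_sum]
      simp only [map_smul, PiLp.add_apply, PiLp.smul_apply, WithLp.ofLp_sum, Finset.sum_apply, h0]
      simp only [smul_eq_mul, mul_zero, zero_add]
      refine Finset.sum_eq_zero fun a _ => ?_
      rw [hA, h.tangential (by simp [coordVec_apply, Fin.ext_iff]), mul_zero]
    rw [hv] at e
    simp [coordVec_apply] at e
  refine lt_of_le_of_ne ?_ hne.symm
  have h1 := h.differentiable.hasFDerivWithinAt.hasLineDerivWithinAt (coordVec n 0)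
  have h2 : HasDerivWithinAt (fun t : ℝ => τ (y + t • coordVec n 0) 0) (A (coordVec n 0) 0)
      (Ici 0) 0 := by
    have h3 := ((EuclideanSpace.proj (𝕜 := ℝ) (0 : Fin (n + 1))).hasFDerivAt
      (x := τ (y + (0 : ℝ) • coordVec n 0))).comp_hasDerivWithinAt (0 : ℝ) h1
    refine h3.mono fun t ht => ?_
    simp only [mem_preimage, BoundaryMorse.mem_halfSpace]
    simpa [h.mem, coordVec_apply] using ht
  have hev : ∀ᶠ t : ℝ in 𝓝[>] 0, 0 ≤ τ (y + t • coordVec n 0) 0 := by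
    have ht : Tendsto (fun t : ℝ => y + t • coordVec n 0) (𝓝[>] 0) (𝓝[halfSpace n] y) := by
      refine tendsto_nhdsWithin_iff.2 ⟨?_, ?_⟩
      · have : Continuous fun t : ℝ => y + t • coordVec n 0 := by fun_prop
        simpa using (this.tendsto 0).mono_left nhdsWithin_le_nhds
      · filter_upwards [self_mem_nhdsWithin] with t ht
        rw [BoundaryMorse.mem_halfSpace]
        simpa [h.mem, coordVec_apply] using le_of_lt ht
    filter_upwards [ht.eventually h.mapsTo] with t ht' using BoundaryMorse.mem_halfSpace.1 ht'
  have h4 := (hasDerivWithinAt_iff_tendsto_slope' (by simp)).1 (h2.mono Ioi_subset_Ici_self)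
  refine ge_of_tendsto h4 ?_
  filter_upwards [hev, self_mem_nhdsWithin] with t ht ht'
  rw [slope_def_field]
  simp only [zero_smul, add_zero, h.image_mem, sub_zero]
  exact div_nonneg ht (le_of_lt ht')

variable {G G' : E n → Bil n}

theorem fderivWithin_pullback (h : IsBoundaryChange τ y)
    (hG : DifferentiableWithinAt ℝ G (halfSpace n) (τ y))
    (hG' : DifferentiableWithinAt ℝ G' (halfSpace n) y)
    (he : ∀ᶠ z in 𝓝[halfSpace n] y, G' z = (G (τ z)).bilinearComp
      (fderivWithin ℝ τ (halfSpace n) z) (fderivWithin ℝ τ (halfSpace n) z)) (u v w : E n) :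
    fderivWithin ℝ G' (halfSpace n) y u v w =
      fderivWithin ℝ G (halfSpace n) (τ y) (fderivWithin ℝ τ (halfSpace n) y u)
        (fderivWithin ℝ τ (halfSpace n) y v) (fderivWithin ℝ τ (halfSpace n) y w)
      + G (τ y) (fderivWithin ℝ (fderivWithin ℝ τ (halfSpace n)) (halfSpace n) y u v)
        (fderivWithin ℝ τ (halfSpace n) y w)
      + G (τ y) (fderivWithin ℝ τ (halfSpace n) y v)
        (fderivWithin ℝ (fderivWithin ℝ τ (halfSpace n)) (halfSpace n) y u w) := by
  set S := halfSpace n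
  have hy : y ∈ S := h.mem_halfSpace
  have hu := uniqueDiffOn_halfSpace n y hy
  have hev : ∀ v : E n, HasFDerivWithinAt (fun z => fderivWithin ℝ τ S z v)
      ((ContinuousLinearMap.apply ℝ (E n) v).comp
        (fderivWithin ℝ (fderivWithin ℝ τ S) S y)) S y := fun v =>
    (ContinuousLinearMap.apply ℝ (E n) v).hasFDerivAt.comp_hasFDerivWithinAt y
      h.differentiable_fderivWithin.hasFDerivWithinAt
  have hGτ : HasFDerivWithinAt (fun z => G (τ z))
      ((fderivWithin ℝ G S (τ y)).comp (fderivWithin ℝ τ S y)) S y := by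
    have h1 : HasFDerivWithinAt τ (fderivWithin ℝ τ S y) (S ∩ {z | τ z ∈ S}) y :=
      h.differentiable.hasFDerivWithinAt.mono inter_subset_left
    have h2 := HasFDerivWithinAt.comp (t := S) (g := G) y hG.hasFDerivWithinAt h1
      fun z hz => hz.2
    exact h2.mono_of_mem_nhdsWithin (inter_mem self_mem_nhdsWithin h.mapsTo)
  have h1 := ((hGτ.clm_apply (hev v)).clm_apply (hev w)).congr_of_eventuallyEq
    (f₁ := fun z => G' z v w) (by filter_upwards [he] with z hz; rw [hz]; rfl)
    (by rw [he.self_of_nhdsWithin hy]; rfl)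
  have h2 : HasFDerivWithinAt (fun z => G' z v w)
      ((ContinuousLinearMap.apply ℝ ℝ w).comp ((ContinuousLinearMap.apply ℝ (E n →L[ℝ] ℝ) v).comp
        (fderivWithin ℝ G' S y))) S y := by
    have h3 := (ContinuousLinearMap.apply ℝ (E n →L[ℝ] ℝ) v).hasFDerivAt.comp_hasFDerivWithinAt
      (f := G') y hG'.hasFDerivWithinAt
    exact (ContinuousLinearMap.apply ℝ ℝ w).hasFDerivAt.comp_hasFDerivWithinAt y h3
  have h3 := DFunLike.congr_fun (hu.eq h2 h1) u
  simp only [ContinuousLinearMap.comp_apply, ContinuousLinearMap.apply_apply,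
    add_apply, ContinuousLinearMap.flip_apply] at h3
  rw [h3]
  ring

/-- Each of the three differentiated metrics contributes two second-derivative terms of `τ`. By
symmetry of `D²τ` and of the metric four of the six cancel, and the other two coincide. -/
theorem koszul_pullback (h : IsBoundaryChange τ y)
    (hG : DifferentiableWithinAt ℝ G (halfSpace n) (τ y))
    (hG' : DifferentiableWithinAt ℝ G' (halfSpace n) y) (hi : IsInner (G (τ y)))
    (he : ∀ᶠ z in 𝓝[halfSpace n] y, G' z = (G (τ z)).bilinearComp
      (fderivWithin ℝ τ (halfSpace n) z) (fderivWithin ℝ τ (halfSpace n) z)) (u v w : E n) :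
    koszul G' y u v w = koszul G (τ y) (fderivWithin ℝ τ (halfSpace n) y u)
        (fderivWithin ℝ τ (halfSpace n) y v) (fderivWithin ℝ τ (halfSpace n) y w)
      + G (τ y) (fderivWithin ℝ (fderivWithin ℝ τ (halfSpace n)) (halfSpace n) y u v)
        (fderivWithin ℝ τ (halfSpace n) y w) := by
  have hsymm : ∀ u v, fderivWithin ℝ (fderivWithin ℝ τ (halfSpace n)) (halfSpace n) y u v =
      fderivWithin ℝ (fderivWithin ℝ τ (halfSpace n)) (halfSpace n) y v u :=
    (h.contDiff.isSymmSndFDerivWithinAt (by simp) (uniqueDiffOn_halfSpace n)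
      ((𝓡∂ (n + 1)).range_subset_closure_interior h.mem_halfSpace) h.mem_halfSpace)
  simp only [koszul]
  rw [h.fderivWithin_pullback hG hG' he, h.fderivWithin_pullback hG hG' he,
    h.fderivWithin_pullback hG hG' he, hsymm v u, hsymm w u, hsymm w v,
    hi.1 (fderivWithin ℝ τ (halfSpace n) y v), hi.1 (fderivWithin ℝ τ (halfSpace n) y u)
      (fderivWithin ℝ (fderivWithin ℝ τ (halfSpace n)) (halfSpace n) y v w)]
  ring

/-- The image vector satisfies the three properties characterizing the normal in `eq_outwardNormal`;
it points outward by `transversal`. -/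
theorem outwardNormal_pullback (h : IsBoundaryChange τ y) (hi : IsInner (G (τ y)))
    (he : G' y = (G (τ y)).bilinearComp
      (fderivWithin ℝ τ (halfSpace n) y) (fderivWithin ℝ τ (halfSpace n) y)) :
    fderivWithin ℝ τ (halfSpace n) y (outwardNormal G' y) = outwardNormal G (τ y) := by
  set A := fderivWithin ℝ τ (halfSpace n) y with hA
  have hi' : IsInner (G' y) := he ▸ hi.bilinearComp h.injective
  have hsurj : Function.Surjective A := LinearMap.injective_iff_surjective.1 h.injective
  have hA0 : ∀ v : E n, A v 0 = v 0 * A (coordVec n 0) 0 := by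
    intro v
    have e : v = v 0 • coordVec n 0 + (v - v 0 • coordVec n 0) := by abel
    have ht : (v - v 0 • coordVec n 0) 0 = 0 := by simp [coordVec_apply]
    conv_lhs => rw [e, map_add, PiLp.add_apply, h.tangential ht, map_smul]
    simp
  have hpos := h.transversal
  refine eq_outwardNormal hi (fun v hv => ?_) ?_ ?_
  · obtain ⟨u, rfl⟩ := hsurj v
    have hu : u 0 = 0 := by
      rw [hA0] at hv
      exact (mul_eq_zero.1 hv).resolve_right hpos.ne'
    have := inner_outwardNormal_tangential hi' hu
    rwa [he] at this
  · have := inner_outwardNormal_self hi'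
    rwa [he] at this
  · rw [hA0, outwardNormal_zero hi']
    exact mul_neg_of_neg_of_pos
      (neg_neg_of_pos (Real.sqrt_pos.2 (inv_gramMatrix_zero_pos hi'))) hpos

/-- The mean curvature does not depend on the coordinates. -/
theorem localMeanCurvature_pullback (h : IsBoundaryChange τ y)
    (hG : DifferentiableWithinAt ℝ G (halfSpace n) (τ y))
    (hG' : DifferentiableWithinAt ℝ G' (halfSpace n) y) (hi : IsInner (G (τ y)))
    (he : ∀ᶠ z in 𝓝[halfSpace n] y, G' z = (G (τ z)).bilinearComp
      (fderivWithin ℝ τ (halfSpace n) z) (fderivWithin ℝ τ (halfSpace n) z)) :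
    localMeanCurvature G' y = localMeanCurvature G (τ y) := by
  have hey := he.self_of_nhdsWithin h.mem_halfSpace
  have hν := h.outwardNormal_pullback hi hey
  have hi' : IsInner (G' y) := hey ▸ hi.bilinearComp h.injective
  set A := fderivWithin ℝ τ (halfSpace n) y with hA
  -- The Jacobian matrix of the change of boundary coordinates: both fundamental forms transform by
  -- congruence with it.
  let J : Matrix (Fin n) (Fin n) ℝ := Matrix.of fun c a => A (coordVec n a.succ) c.succ
  have ht : ∀ a : Fin n, coordVec n a.succ 0 = 0 := fun a => by
    simp [coordVec_apply, Fin.ext_iff]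
  have hJ : ∀ a : Fin n, A (coordVec n a.succ) = ∑ c, J c a • coordVec n c.succ := fun a =>
    eq_sum_tangential (h.tangential (ht a))
  have hP : boundaryGramMatrix G' y = J.transpose * boundaryGramMatrix G (τ y) * J := by
    ext a b
    rw [Matrix.mul_assoc, Matrix.mul_apply]
    simp only [boundaryGramMatrix, Matrix.of_apply, hey, ContinuousLinearMap.bilinearComp_apply,
      hJ, map_sum, map_smul, sum_apply, smul_apply,
      smul_eq_mul, Matrix.mul_apply, Matrix.transpose_apply, Finset.mul_sum]
    rw [Finset.sum_comm]
    exact Finset.sum_congr rfl fun c _ => Finset.sum_congr rfl fun d _ => by ring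
  have hB : secondFundamentalForm G' y = J.transpose * secondFundamentalForm G (τ y) * J := by
    ext a b
    rw [Matrix.mul_assoc, Matrix.mul_apply]
    simp only [secondFundamentalForm, Matrix.of_apply, h.koszul_pullback hG hG' hi he]
    rw [← hA, hν, inner_outwardNormal_tangential hi (h.tangential_second (ht a) (ht b)), add_zero,
      hJ a, hJ b, koszul_sum_left]
    simp only [koszul_sum_middle, Matrix.mul_apply, Matrix.transpose_apply, Matrix.of_apply]
    rw [← Finset.sum_neg_distrib]
    refine Finset.sum_congr rfl fun c _ => ?_
    rw [Finset.mul_sum, Finset.mul_sum, ← Finset.sum_neg_distrib]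
    exact Finset.sum_congr rfl fun d _ => by ring
  -- `J` is invertible because the pulled-back boundary Gram matrix is positive definite and has
  -- `det J` as a factor of its determinant.
  have hJdet : IsUnit J.det := by
    have h1 := (posDef_boundaryGramMatrix hi').det_pos.ne'
    rw [hP, Matrix.det_mul, Matrix.det_mul] at h1
    exact (right_ne_zero_of_mul h1).isUnit
  rw [localMeanCurvature, localMeanCurvature, hP, hB, trace_inv_mul_congr _ _ _ hJdet]

end IsBoundaryChange

/-- Continuous linear maps between normed spaces, with the normed structures made explicit. -/
abbrev Hom (V F : Type) [NormedAddCommGroup V] [NormedSpace ℝ V] [NormedAddCommGroup F]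
    [NormedSpace ℝ F] : Type := V →L[ℝ] F

/-! ### Conformal changes -/

theorem fderivWithin_smul_of_eventuallyEq {V F : Type} [NormedAddCommGroup V] [NormedSpace ℝ V]
    [NormedAddCommGroup F] [NormedSpace ℝ F] {S : Set V} {G G' : V → F} {c : V → ℝ}
    {c' : V →L[ℝ] ℝ} {y : V} (hu : UniqueDiffWithinAt ℝ S y) (hy : y ∈ S)
    (hG : DifferentiableWithinAt ℝ G S y) (he : ∀ᶠ z in 𝓝[S] y, G' z = c z • G z)
    (hc : HasFDerivWithinAt c c' S y) (v : V) :
    fderivWithin ℝ G' S y v = c y • fderivWithin ℝ G S y v + c' v • G y := by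
  rw [((hc.smul hG.hasFDerivWithinAt).congr_of_eventuallyEq he
      (he.self_of_nhdsWithin hy)).fderivWithin hu]
  rfl

theorem gramMatrix_congr {n : ℕ} {G G' : E n → Bil n} {y : E n} (h : G' y = G y) :
    gramMatrix G' y = gramMatrix G y := by
  simp only [gramMatrix, h]

/-- The derivative of the conformal factor is a multiple of `dx₀`, so it vanishes in tangential
directions, and only the term of the Koszul formula differentiated along the normal sees it. The
second fundamental form changes by a multiple of the induced metric, whose trace is `n`. -/
theorem localMeanCurvature_conformal {n : ℕ} {G G' : E n → Bil n} {y : E n} {c : E n → ℝ} {w : ℝ}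
    {c' : E n →L[ℝ] ℝ} (hy : y ∈ halfSpace n) (hi : IsInner (G y))
    (hG : DifferentiableWithinAt ℝ G (halfSpace n) y)
    (he : ∀ᶠ z in 𝓝[halfSpace n] y, G' z = c z • G z) (hc1 : c y = 1)
    (hc : HasFDerivWithinAt c c' (halfSpace n) y) (hc' : ∀ v : E n, c' v = 2 * w * v 0) :
    localMeanCurvature G' y = localMeanCurvature G y - n * w * √((gramMatrix G y)⁻¹ 0 0) := by
  have hu := uniqueDiffOn_halfSpace n y hy
  have hey : G' y = G y := by rw [he.self_of_nhdsWithin hy, hc1, one_smul]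
  have hν : outwardNormal G' y = outwardNormal G y := by
    simp only [outwardNormal, gramMatrix_congr hey]
  have hP : boundaryGramMatrix G' y = boundaryGramMatrix G y := by
    simp only [boundaryGramMatrix, hey]
  have hd : ∀ v : E n, fderivWithin ℝ G' (halfSpace n) y v =
      c y • fderivWithin ℝ G (halfSpace n) y v + c' v • G y :=
    fderivWithin_smul_of_eventuallyEq (F := Bil n) (G := G) (G' := G') hu hy hG he hc
  have hB : secondFundamentalForm G' y = secondFundamentalForm G y
      - (w * √((gramMatrix G y)⁻¹ 0 0)) • boundaryGramMatrix G y := by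
    ext a b
    have h0 : ∀ a : Fin n, coordVec n a.succ 0 = 0 := fun a => by
      simp [coordVec_apply, Fin.ext_iff]
    simp only [secondFundamentalForm, Matrix.of_apply, Matrix.sub_apply, Matrix.smul_apply,
      boundaryGramMatrix, hν, koszul, hd, hc1, one_smul, add_apply,
      smul_apply, hc', h0, outwardNormal_zero hi, smul_eq_mul]
    ring
  rw [localMeanCurvature, localMeanCurvature, hP, hB, Matrix.mul_sub, Matrix.trace_sub,
    Matrix.mul_smul, Matrix.nonsing_inv_mul _ (posDef_boundaryGramMatrix hi).det_pos.ne'.isUnit,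
    Matrix.trace_smul, Matrix.trace_one, Fintype.card_fin, smul_eq_mul]
  ring

/-! ### Smooth dependence on the metric -/

section Smooth

variable {X : Type*} [NormedAddCommGroup X] [NormedSpace ℝ X] {k : ℕ∞ω} {x : X}

theorem contDiffAt_matrix_det {α : Type*} [Fintype α] [DecidableEq α] {A : X → Matrix α α ℝ}
    (h : ∀ i j, ContDiffAt ℝ k (fun x => A x i j) x) : ContDiffAt ℝ k (fun x => (A x).det) x := by
  simp only [Matrix.det_apply']
  exact ContDiffAt.sum fun σ _ => contDiffAt_const.mul (contDiffAt_prod fun i _ => h _ _)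

theorem contDiffAt_matrix_inv {α : Type*} [Fintype α] [DecidableEq α] {A : X → Matrix α α ℝ}
    (h : ∀ i j, ContDiffAt ℝ k (fun x => A x i j) x) (hdet : (A x).det ≠ 0) (i j : α) :
    ContDiffAt ℝ k (fun x => (A x)⁻¹ i j) x := by
  simp only [Matrix.inv_def, Matrix.smul_apply, smul_eq_mul, Ring.inverse_eq_inv',
    Matrix.adjugate_apply]
  refine ((contDiffAt_matrix_det h).inv hdet).mul (contDiffAt_matrix_det fun a b => ?_)
  by_cases ha : a = j
  · subst ha
    simp only [Matrix.updateRow_self]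
    exact contDiffAt_const
  · simp only [Matrix.updateRow_ne ha]
    exact h a b

variable {n : ℕ} {B : X → Bil n}

theorem contDiffAt_bil_apply (hB : ContDiffAt ℝ k B x) (v w : E n) :
    ContDiffAt ℝ k (fun x => B x v w) x :=
  (hB.clm_apply contDiffAt_const).clm_apply contDiffAt_const

theorem contDiffAt_gramMatrix_inv (hB : ContDiffAt ℝ k B x) (hi : IsInner (B x))
    (i j : Fin (n + 1)) : ContDiffAt ℝ k (fun x => (gramMatrix (fun _ => B x) 0)⁻¹ i j) x :=
  contDiffAt_matrix_inv (fun _ _ => contDiffAt_bil_apply hB _ _)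
    (posDef_gramMatrix (G := fun _ => B x) (x := 0) hi).det_pos.ne' i j

theorem contDiffAt_sqrt_gramMatrix_inv (hB : ContDiffAt ℝ k B x) (hi : IsInner (B x)) :
    ContDiffAt ℝ k (fun x => √((gramMatrix (fun _ => B x) 0)⁻¹ 0 0)) x :=
  (contDiffAt_gramMatrix_inv hB hi 0 0).sqrt
    (inv_gramMatrix_zero_pos (G := fun _ => B x) (x := 0) hi).ne'

theorem contDiffAt_outwardNormal (hB : ContDiffAt ℝ k B x) (hi : IsInner (B x)) :
    ContDiffAt ℝ k (fun x => outwardNormal (fun _ => B x) 0) x := by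
  rw [contDiffAt_euclidean]
  intro i
  exact ((contDiffAt_gramMatrix_inv hB hi i 0).neg).div (contDiffAt_sqrt_gramMatrix_inv hB hi)
    (Real.sqrt_pos.2 (inv_gramMatrix_zero_pos (G := fun _ => B x) (x := 0) hi)).ne'

end Smooth

/-- The mean curvature as a function of the value and the derivative of the metric. -/
def meanCurvatureJet {n : ℕ} (p : Bil n × Hom (E n) (Bil n)) : ℝ :=
  ((Matrix.of fun a b : Fin n => p.1 (coordVec n a.succ) (coordVec n b.succ))⁻¹ *
    Matrix.of fun a b : Fin n =>
      -((p.2 (coordVec n a.succ) (coordVec n b.succ) (outwardNormal (fun _ => p.1) 0)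
        + p.2 (coordVec n b.succ) (coordVec n a.succ) (outwardNormal (fun _ => p.1) 0)
        - p.2 (outwardNormal (fun _ => p.1) 0) (coordVec n a.succ) (coordVec n b.succ)) / 2)).trace

theorem contDiffAt_meanCurvatureJet {n : ℕ} {p : Bil n × Hom (E n) (Bil n)} (hi : IsInner p.1)
    {k : ℕ∞ω} : ContDiffAt ℝ k meanCurvatureJet p := by
  have h1 : ContDiffAt ℝ k (fun p : Bil n × Hom (E n) (Bil n) => p.1) p := contDiffAt_fst
  have h2 : ContDiffAt ℝ k (fun p : Bil n × Hom (E n) (Bil n) => p.2) p := contDiffAt_snd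
  have hν := contDiffAt_outwardNormal h1 hi
  have hdet := (posDef_boundaryGramMatrix (G := fun _ => p.1) (x := 0) hi).det_pos.ne'
  unfold meanCurvatureJet
  simp only [Matrix.trace, Matrix.diag, Matrix.mul_apply]
  refine ContDiffAt.sum fun a _ => ContDiffAt.sum fun b _ => ContDiffAt.mul ?_ ?_
  · exact contDiffAt_matrix_inv (A := fun p : Bil n × Hom (E n) (Bil n) =>
      Matrix.of fun a b : Fin n => p.1 (coordVec n a.succ) (coordVec n b.succ))
      (fun _ _ => contDiffAt_bil_apply h1 _ _) hdet a b
  · simp only [Matrix.of_apply]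
    refine (ContDiffAt.div_const ((ContDiffAt.add ?_ ?_).sub ?_) 2).neg
    · exact ((h2.clm_apply contDiffAt_const).clm_apply contDiffAt_const).clm_apply hν
    · exact ((h2.clm_apply contDiffAt_const).clm_apply contDiffAt_const).clm_apply hν
    · exact ((h2.clm_apply hν).clm_apply contDiffAt_const).clm_apply contDiffAt_const

/-- One derivative is spent, since `Φ` is evaluated on the first derivative of `G` as well. -/
theorem contDiffWithinAt_comp_jet {V F : Type} [NormedAddCommGroup V] [NormedSpace ℝ V]
    [NormedAddCommGroup F] [NormedSpace ℝ F] {S : Set V} (hS : UniqueDiffOn ℝ S) {y : V}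
    (hy : y ∈ S) {k : ℕ∞ω} {Φ : F × Hom V F → ℝ} {G : V → F}
    (hΦ : ContDiffAt ℝ k Φ (G y, fderivWithin ℝ G S y)) (hG : ContDiffWithinAt ℝ (k + 1) G S y) :
    ContDiffWithinAt ℝ k (fun z => Φ (G z, fderivWithin ℝ G S z)) S y :=
  hΦ.comp_contDiffWithinAt y ((hG.of_le le_self_add).prodMk (hG.fderivWithin_right hS le_rfl hy))

theorem FamilyContDiff.comp_jet {V F : Type} [NormedAddCommGroup V] [NormedSpace ℝ V]
    [NormedAddCommGroup F] [NormedSpace ℝ F] {S : Set V} (hS : UniqueDiffOn ℝ S) {y : V}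
    (hy : y ∈ S) {k : ℕ} {ι : Type*} [TopologicalSpace ι] {i₀ : ι} {Φ : F × Hom V F → ℝ}
    {G : ι → V → F} (hΦ : ContDiffAt ℝ k Φ (G i₀ y, fderivWithin ℝ (G i₀) S y))
    (hG : FamilyContDiff (k + 1) G S i₀ y) :
    FamilyContDiff k (fun i z => Φ (G i z, fderivWithin ℝ (G i) S z)) S i₀ y :=
  FamilyContDiff.contDiffAt_comp hS hy
    (f := fun i y => (G i y, fderivWithin ℝ (G i) S y)) hΦ
    (hG.of_succ.prodMk hS hy hG.2.2)

theorem contDiffWithinAt_localMeanCurvature {n : ℕ} {G : E n → Bil n} {y : E n} {k : ℕ∞ω}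
    (hy : y ∈ halfSpace n) (hi : IsInner (G y)) (hG : ContDiffWithinAt ℝ (k + 1) G (halfSpace n) y) :
    ContDiffWithinAt ℝ k (localMeanCurvature G) (halfSpace n) y :=
  contDiffWithinAt_comp_jet (Φ := meanCurvatureJet) (uniqueDiffOn_halfSpace n) hy
    (contDiffAt_meanCurvatureJet hi) hG

theorem FamilyContDiff.localMeanCurvature {n : ℕ} {ι : Type*} [TopologicalSpace ι]
    {G : ι → E n → Bil n} {y : E n} {k : ℕ} {i₀ : ι} (hy : y ∈ halfSpace n)
    (hi : IsInner (G i₀ y)) (hG : FamilyContDiff (k + 1) G (halfSpace n) i₀ y) :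
    FamilyContDiff k (fun i => localMeanCurvature (G i)) (halfSpace n) i₀ y :=
  FamilyContDiff.comp_jet (Φ := meanCurvatureJet) (uniqueDiffOn_halfSpace n) hy
    (contDiffAt_meanCurvatureJet hi) hG

/-- Pulling back a bilinear form by an endomorphism depends smoothly on both. -/
theorem contDiff_bilinearComp {V : Type} [NormedAddCommGroup V] [NormedSpace ℝ V] {k : ℕ∞ω} :
    ContDiff ℝ k (fun p : (V →L[ℝ] V →L[ℝ] ℝ) × (V →L[ℝ] V) => p.1.bilinearComp p.2 p.2) := by
  have h1 : ContDiff ℝ k (fun p : (V →L[ℝ] V →L[ℝ] ℝ) × (V →L[ℝ] V) => p.1.comp p.2) :=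
    contDiff_fst.clm_comp contDiff_snd
  have h2 : ContDiff ℝ k (fun p : (V →L[ℝ] V →L[ℝ] ℝ) × (V →L[ℝ] V) =>
      (ContinuousLinearMap.compL ℝ V V ℝ).flip p.2) :=
    (ContinuousLinearMap.contDiff _).comp contDiff_snd
  exact h2.clm_comp h1

/-! ### Bilinear forms on the tangent bundle in coordinates -/

section AbstractBundle

open Bundle
variable {EB : Type*} [NormedAddCommGroup EB] [NormedSpace ℝ EB]
  {HB : Type*} [TopologicalSpace HB] {IB : ModelWithCorners ℝ EB HB} {k : ℕ∞ω}
  {X : Type*} [TopologicalSpace X] [ChartedSpace HB X]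
  {F : Type*} [NormedAddCommGroup F] [NormedSpace ℝ F]
  {V : X → Type*} [TopologicalSpace (TotalSpace F V)]
  [∀ b, TopologicalSpace (V b)] [∀ b, AddCommGroup (V b)] [∀ b, Module ℝ (V b)]
  [FiberBundle F V] [VectorBundle ℝ F V] [ContMDiffVectorBundle k F V IB]

-- The trivialization of the bundle of bilinear forms at `p` evaluates a form on the local frame
-- given by `symmL`, so `f` is exactly the section in that trivialization.
set_option synthInstance.maxHeartbeats 400000 in
set_option maxHeartbeats 1000000 in
theorem contMDiffOn_bilinear_section_iff {s : ∀ x, V x →L[ℝ] V x →L[ℝ] ℝ} {u : Set X}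
    {f : X → F →L[ℝ] F →L[ℝ] ℝ} (p : X) (hu : IsOpen u)
    (hsub : u ⊆ (trivializationAt F V p).baseSet)
    (hf : ∀ x ∈ u, ∀ v w, f x v w = s x ((trivializationAt F V p).symmL ℝ x v)
      ((trivializationAt F V p).symmL ℝ x w)) :
    ContMDiffOn IB (IB.prod 𝓘(ℝ, F →L[ℝ] F →L[ℝ] ℝ)) k
      (fun x => TotalSpace.mk' (F →L[ℝ] F →L[ℝ] ℝ) (E := fun x => V x →L[ℝ] V x →L[ℝ] ℝ) x (s x)) u ↔
    ContMDiffOn IB 𝓘(ℝ, F →L[ℝ] F →L[ℝ] ℝ) k f u := by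
  let e := trivializationAt (F →L[ℝ] F →L[ℝ] ℝ) (fun x : X => V x →L[ℝ] V x →L[ℝ] ℝ) p
  have hb : u ⊆ e.baseSet := by
    intro x hx
    rw [hom_trivializationAt_baseSet, hom_trivializationAt_baseSet]
    exact ⟨hsub hx, hsub hx, mem_univ _⟩
  rw [Trivialization.contMDiffOn_section_iff e hu hb]
  apply contMDiffOn_congr
  intro x hx
  ext v w
  rw [hf x hx, hom_trivializationAt_apply, inCoordinates_apply_eq₂ (hsub hx) (hsub hx) (mem_univ _)]
  simp [hsub hx]
end AbstractBundle

/-! ### Transition maps between charts, and the boundary in coordinates. -/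

section Charts

variable {n : ℕ} {M : Type*} [TopologicalSpace M] [ChartedSpace (EuclideanHalfSpace (n + 1)) M]

/-- The derivative of the inverse of the chart at `p`, as an endomorphism of `ℝⁿ⁺¹`. -/
def chartFrame (p : M) (y : E n) : E n →L[ℝ] E n :=
  mfderivWithin 𝓘(ℝ, E n) (𝓡∂ (n + 1)) (extChartAt (𝓡∂ (n + 1)) p).symm (halfSpace n) y

/-- The value at `x` of a field of bilinear forms, as a bilinear form on `ℝⁿ⁺¹`. -/
def formAt (B : ∀ x : M, TangentSpace (𝓡∂ (n + 1)) x →L[ℝ] TangentSpace (𝓡∂ (n + 1)) x →L[ℝ] ℝ)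
    (x : M) : Bil n := B x

/-- The coordinate expression in the chart at `p` of a field of bilinear forms. -/
def localForm
    (B : ∀ x : M, TangentSpace (𝓡∂ (n + 1)) x →L[ℝ] TangentSpace (𝓡∂ (n + 1)) x →L[ℝ] ℝ)
    (p : M) (y : E n) : Bil n :=
  (formAt B ((extChartAt (𝓡∂ (n + 1)) p).symm y)).bilinearComp (chartFrame p y) (chartFrame p y)

/-- The change of coordinates from the chart at `q` to the chart at `p`. -/
def transition (n : ℕ) {M : Type*} [TopologicalSpace M]
    [ChartedSpace (EuclideanHalfSpace (n + 1)) M] (q p : M) (y : E n) : E n :=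
  extChartAt (𝓡∂ (n + 1)) p ((extChartAt (𝓡∂ (n + 1)) q).symm y)

theorem target_subset_halfSpace (p : M) : (extChartAt (𝓡∂ (n + 1)) p).target ⊆ halfSpace n :=
  extChartAt_target_subset_range p

variable {q p : M} {y : E n}

theorem eventually_mem_source (hy : y ∈ (extChartAt (𝓡∂ (n + 1)) q).target)
    (hp : (extChartAt (𝓡∂ (n + 1)) q).symm y ∈ (extChartAt (𝓡∂ (n + 1)) p).source) :
    ∀ᶠ z in 𝓝[halfSpace n] y, z ∈ (extChartAt (𝓡∂ (n + 1)) q).target ∧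
      (extChartAt (𝓡∂ (n + 1)) q).symm z ∈ (extChartAt (𝓡∂ (n + 1)) p).source := by
  have h1 := extChartAt_target_mem_nhdsWithin_of_mem hy
  have h2 : ContinuousWithinAt (extChartAt (𝓡∂ (n + 1)) q).symm (halfSpace n) y :=
    (continuousAt_extChartAt_symm'' hy).continuousWithinAt
  filter_upwards [h1, h2.eventually ((isOpen_extChartAt_source p).mem_nhds hp)] with z hz hz'
  exact ⟨hz, hz'⟩

theorem symm_transition
    (hp : (extChartAt (𝓡∂ (n + 1)) q).symm y ∈ (extChartAt (𝓡∂ (n + 1)) p).source) :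
    (extChartAt (𝓡∂ (n + 1)) p).symm (transition n q p y) =
      (extChartAt (𝓡∂ (n + 1)) q).symm y :=
  (extChartAt (𝓡∂ (n + 1)) p).left_inv hp

theorem transition_mem
    (hp : (extChartAt (𝓡∂ (n + 1)) q).symm y ∈ (extChartAt (𝓡∂ (n + 1)) p).source) :
    transition n q p y ∈ (extChartAt (𝓡∂ (n + 1)) p).target :=
  (extChartAt (𝓡∂ (n + 1)) p).map_source hp

variable [IsManifold (𝓡∂ (n + 1)) ∞ M]

theorem contDiffWithinAt_transition (hy : y ∈ (extChartAt (𝓡∂ (n + 1)) q).target)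
    (hp : (extChartAt (𝓡∂ (n + 1)) q).symm y ∈ (extChartAt (𝓡∂ (n + 1)) p).source) :
    ContDiffWithinAt ℝ ∞ (transition n q p) (halfSpace n) y := by
  refine contDiffWithinAt_ext_coord_change (I := 𝓡∂ (n + 1)) p q ?_
  simp only [PartialEquiv.trans_source, PartialEquiv.symm_source, mem_inter_iff, mem_preimage]
  exact ⟨hy, hp⟩

/-- Chain rule for `φ_q⁻¹ = φ_p⁻¹ ∘ τ`, with `τ` the transition map. -/
theorem chartFrame_eq_comp (hy : y ∈ (extChartAt (𝓡∂ (n + 1)) q).target)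
    (hp : (extChartAt (𝓡∂ (n + 1)) q).symm y ∈ (extChartAt (𝓡∂ (n + 1)) p).source) :
    chartFrame q y = (chartFrame p (transition n q p y)).comp
      (fderivWithin ℝ (transition n q p) (halfSpace n) y) := by
  have : IsManifold (𝓡∂ (n + 1)) 1 M := IsManifold.of_le (n := ∞) (by norm_cast)
  have hev := eventually_mem_source hy hp
  have hy' := target_subset_halfSpace q hy
  set s : Set (E n) := halfSpace n ∩ {z | transition n q p z ∈ halfSpace n}
  have hs : s ∈ 𝓝[halfSpace n] y := by
    filter_upwards [hev, self_mem_nhdsWithin] with z hz hz'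
    exact ⟨hz', target_subset_halfSpace p (transition_mem hz.2)⟩
  have hd : HasFDerivWithinAt (transition n q p)
      (fderivWithin ℝ (transition n q p) (halfSpace n) y) s y :=
    ((contDiffWithinAt_transition hy hp).differentiableWithinAt
      (by simp)).hasFDerivWithinAt.mono inter_subset_left
  have hg : HasMFDerivWithinAt 𝓘(ℝ, E n) (𝓡∂ (n + 1)) (extChartAt (𝓡∂ (n + 1)) p).symm
      (halfSpace n) (transition n q p y) _ :=
    (mdifferentiableWithinAt_extChartAt_symm (transition_mem hp)).hasMFDerivWithinAt
  have hc := HasMFDerivWithinAt.comp y hg hd.hasMFDerivWithinAt fun z hz => hz.2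
  have hc' := (hc.mono_of_mem_nhdsWithin
    (nhdsWithin_mono y (subset_refl _) hs : s ∈ 𝓝[halfSpace n] y)).congr_of_eventuallyEq
    (f₁ := (extChartAt (𝓡∂ (n + 1)) q).symm)
    (by filter_upwards [hev] with z hz using (symm_transition hz.2).symm) (symm_transition hp).symm
  exact hc'.mfderivWithin (uniqueMDiffWithinAt_iff_uniqueDiffWithinAt.2
    (uniqueDiffOn_halfSpace n y hy'))

/-- The transformation law of bilinear forms under changes of coordinates. -/
theorem localForm_eq_bilinearComp
    (B : ∀ x : M, TangentSpace (𝓡∂ (n + 1)) x →L[ℝ] TangentSpace (𝓡∂ (n + 1)) x →L[ℝ] ℝ)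
    (hy : y ∈ (extChartAt (𝓡∂ (n + 1)) q).target)
    (hp : (extChartAt (𝓡∂ (n + 1)) q).symm y ∈ (extChartAt (𝓡∂ (n + 1)) p).source) :
    localForm B q y = (localForm B p (transition n q p y)).bilinearComp
      (fderivWithin ℝ (transition n q p) (halfSpace n) y)
      (fderivWithin ℝ (transition n q p) (halfSpace n) y) := by
  ext v w
  rw [localForm, localForm, symm_transition hp, chartFrame_eq_comp hy hp]
  rfl

theorem injective_chartFrame (hy : y ∈ (extChartAt (𝓡∂ (n + 1)) q).target) :
    Function.Injective (chartFrame (M := M) q y) := by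
  have : IsManifold (𝓡∂ (n + 1)) 1 M := IsManifold.of_le (n := ∞) (by norm_cast)
  exact (isInvertible_mfderivWithin_extChartAt_symm hy).injective

theorem injective_fderivWithin_transition (hy : y ∈ (extChartAt (𝓡∂ (n + 1)) q).target)
    (hp : (extChartAt (𝓡∂ (n + 1)) q).symm y ∈ (extChartAt (𝓡∂ (n + 1)) p).source) :
    Function.Injective (fderivWithin ℝ (transition n q p) (halfSpace n) y) := by
  have h := injective_chartFrame hy
  rw [chartFrame_eq_comp hy hp] at h
  exact Function.Injective.of_comp h

theorem frontier_halfSpace (n : ℕ) : frontier (halfSpace n) = {y | y 0 = 0} := by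
  rw [halfSpace, frontier_range_modelWithCornersEuclideanHalfSpace]
  ext y
  simp [eq_comm]

/-- A point in the domain of the chart at `p` is a boundary point if and only if its first
coordinate vanishes. -/
theorem mem_boundary_iff {x : M} (hx : x ∈ (extChartAt (𝓡∂ (n + 1)) p).source) :
    x ∈ (𝓡∂ (n + 1)).boundary M ↔ extChartAt (𝓡∂ (n + 1)) p x 0 = 0 := by
  have h := ModelWithCorners.isInteriorPoint_iff_of_mem_atlas (I := 𝓡∂ (n + 1)) (n := ∞)
    (by simp) (chart_mem_atlas _ p) (x := x) (by simpa using hx)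
  have h2 : x ∈ (𝓡∂ (n + 1)).boundary M ↔ ¬ (𝓡∂ (n + 1)).IsInteriorPoint x :=
    (𝓡∂ (n + 1)).isBoundaryPoint_iff_not_isInteriorPoint x
  rw [h2, h]
  have hm := (extChartAt (𝓡∂ (n + 1)) p).map_source hx
  -- The chart target is relatively open in the half-space, so being interior to one is the same as
  -- being interior to the other.
  have hint : ((chartAt (EuclideanHalfSpace (n + 1)) p).extend (𝓡∂ (n + 1))) x ∈
      interior ((chartAt (EuclideanHalfSpace (n + 1)) p).extend (𝓡∂ (n + 1))).target ↔
      extChartAt (𝓡∂ (n + 1)) p x ∈ interior (halfSpace n) := by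
    rw [mem_interior_iff_mem_nhds, mem_interior_iff_mem_nhds]
    constructor
    · intro h
      exact mem_of_superset h (target_subset_halfSpace p)
    · intro h
      have := extChartAt_target_mem_nhdsWithin_of_mem hm
      rwa [nhdsWithin_eq_nhds.2 h] at this
  rw [hint, mem_interior_iff_notMem_frontier (target_subset_halfSpace p hm), frontier_halfSpace,
    not_not]
  rfl

theorem symm_mem_boundary_iff (hy : y ∈ (extChartAt (𝓡∂ (n + 1)) q).target) :
    (extChartAt (𝓡∂ (n + 1)) q).symm y ∈ (𝓡∂ (n + 1)).boundary M ↔ y 0 = 0 := by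
  rw [mem_boundary_iff ((extChartAt (𝓡∂ (n + 1)) q).map_target hy),
    (extChartAt (𝓡∂ (n + 1)) q).right_inv hy]

theorem transition_boundary (hy : y ∈ (extChartAt (𝓡∂ (n + 1)) q).target)
    (hp : (extChartAt (𝓡∂ (n + 1)) q).symm y ∈ (extChartAt (𝓡∂ (n + 1)) p).source)
    (h0 : y 0 = 0) : transition n q p y 0 = 0 :=
  (mem_boundary_iff hp).1 ((symm_mem_boundary_iff hy).2 h0)

theorem isBoundaryChange_transition (hy : y ∈ (extChartAt (𝓡∂ (n + 1)) q).target)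
    (hp : (extChartAt (𝓡∂ (n + 1)) q).symm y ∈ (extChartAt (𝓡∂ (n + 1)) p).source)
    (h0 : y 0 = 0) : IsBoundaryChange (transition n q p) y where
  mem := h0
  contDiff := (contDiffWithinAt_transition hy hp).of_le (by norm_cast)
  mapsTo := by
    filter_upwards [eventually_mem_source hy hp] with z hz
    exact target_subset_halfSpace p (transition_mem hz.2)
  boundary := by
    filter_upwards [eventually_mem_source hy hp] with z hz using transition_boundary hz.1 hz.2
  injective := injective_fderivWithin_transition hy hp

/-! ### Regularity of sections in coordinates -/

theorem contMDiffOn_source_iff {F : Type*} [NormedAddCommGroup F] [NormedSpace ℝ F] {k : ℕ∞ω}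
    (hk : k ≤ ∞) {f : M → F} (p : M) :
    ContMDiffOn (𝓡∂ (n + 1)) 𝓘(ℝ, F) k f (extChartAt (𝓡∂ (n + 1)) p).source ↔
      ContDiffOn ℝ k (f ∘ (extChartAt (𝓡∂ (n + 1)) p).symm)
        (extChartAt (𝓡∂ (n + 1)) p).target := by
  have : IsManifold (𝓡∂ (n + 1)) k M := IsManifold.of_le (n := ∞) hk
  rw [← contMDiffOn_iff_contDiffOn]
  constructor
  · intro h
    exact h.comp (contMDiffOn_extChartAt_symm p) fun y hy =>
      (extChartAt (𝓡∂ (n + 1)) p).map_target hy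
  · intro h
    have h1 : ContMDiffOn (𝓡∂ (n + 1)) 𝓘(ℝ, E n) k (extChartAt (𝓡∂ (n + 1)) p)
        (extChartAt (𝓡∂ (n + 1)) p).source := by
      rw [extChartAt_source]; exact contMDiffOn_extChartAt
    refine (h.comp h1 fun y hy => (extChartAt (𝓡∂ (n + 1)) p).map_source hy).congr fun x hx => ?_
    simp only [Function.comp_apply, (extChartAt (𝓡∂ (n + 1)) p).left_inv hx]

/-- The tangent bundle trivialization at `p` has as inverse the derivative of the inverse chart, so
the coordinate expression used for metrics is the section read in a trivialization. -/
theorem contMDiffOn_section_iff_localForm {k : ℕ∞ω} (hk : k ≤ ∞)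
    (B : ∀ x : M, TangentSpace (𝓡∂ (n + 1)) x →L[ℝ] TangentSpace (𝓡∂ (n + 1)) x →L[ℝ] ℝ) (p : M) :
    ContMDiffOn (𝓡∂ (n + 1)) ((𝓡∂ (n + 1)).prod 𝓘(ℝ, Bil n)) k
      (fun x : M => Bundle.TotalSpace.mk' (Bil n)
        (E := fun x : M => TangentSpace (𝓡∂ (n + 1)) x →L[ℝ] TangentSpace (𝓡∂ (n + 1)) x →L[ℝ] ℝ)
        x (B x)) (extChartAt (𝓡∂ (n + 1)) p).source ↔
    ContDiffOn ℝ k (localForm B p) (extChartAt (𝓡∂ (n + 1)) p).target := by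
  have : IsManifold (𝓡∂ (n + 1)) (k + 1) M := by
    refine IsManifold.of_le (n := ∞) ?_
    calc k + 1 ≤ ∞ + 1 := by gcongr
      _ = ∞ := by rfl
  have : IsManifold (𝓡∂ (n + 1)) 1 M := IsManifold.of_le (n := ∞) (by norm_cast)
  have hb : (extChartAt (𝓡∂ (n + 1)) p).source ⊆
      (trivializationAt (E n) (fun x : M => TangentSpace (𝓡∂ (n + 1)) x) p).baseSet := by
    rw [extChartAt_source]
    exact subset_refl _
  have : ContMDiffVectorBundle k (E n) (fun x : M => TangentSpace (𝓡∂ (n + 1)) x) (𝓡∂ (n + 1)) :=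
    TangentBundle.contMDiffVectorBundle
  have h1 := contMDiffOn_bilinear_section_iff (k := k) (s := B) (IB := 𝓡∂ (n + 1))
    (f := fun x => localForm B p (extChartAt (𝓡∂ (n + 1)) p x))
    p (isOpen_extChartAt_source p) hb fun x hx v w => by
      rw [TangentBundle.symmL_trivializationAt (I := 𝓡∂ (n + 1)) (by rwa [← extChartAt_source
        (𝓡∂ (n + 1))]), localForm, (extChartAt (𝓡∂ (n + 1)) p).left_inv hx]
      rfl
  have h2 := contMDiffOn_source_iff (n := n) (M := M) (F := Bil n) hk
    (f := fun x => localForm B p (extChartAt (𝓡∂ (n + 1)) p x)) p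
  refine h1.trans (h2.trans (contDiffOn_congr fun y hy => ?_))
  simp only [Function.comp_apply, (extChartAt (𝓡∂ (n + 1)) p).right_inv hy]

end Charts

/-! ### The `C^m` topology on metrics -/

section Topology

variable {n : ℕ} {M : Type*} [TopologicalSpace M] [ChartedSpace (EuclideanHalfSpace (n + 1)) M]
  [IsManifold (𝓡∂ (n + 1)) ∞ M] {m : ℕ} {p : M} {y : E n}

theorem contDiffOn_localMetric (g : Metric n M m) (p : M) :
    ContDiffOn ℝ m (localMetric g p) (extChartAt (𝓡∂ (n + 1)) p).target :=
  (contMDiffOn_section_iff_localForm (by norm_cast; simp) g.inner p).1 g.contMDiff.contMDiffOn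

theorem IsSmoothMetric.contDiffOn_localMetric {g : Metric n M m} (h : IsSmoothMetric g) (p : M) :
    ContDiffOn ℝ ∞ (localMetric g p) (extChartAt (𝓡∂ (n + 1)) p).target :=
  (contMDiffOn_section_iff_localForm le_rfl g.inner p).1 h.contMDiffOn

omit [IsManifold (𝓡∂ (n + 1)) ∞ M] in
theorem contDiffWithinAt_halfSpace {F : Type*} [NormedAddCommGroup F] [NormedSpace ℝ F] {k : ℕ∞ω}
    {f : E n → F} (h : ContDiffOn ℝ k f (extChartAt (𝓡∂ (n + 1)) p).target)
    (hy : y ∈ (extChartAt (𝓡∂ (n + 1)) p).target) : ContDiffWithinAt ℝ k f (halfSpace n) y :=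
  (h y hy).mono_of_mem_nhdsWithin (extChartAt_target_mem_nhdsWithin_of_mem hy)

theorem contDiffWithinAt_localMetric (g : Metric n M m)
    (hy : y ∈ (extChartAt (𝓡∂ (n + 1)) p).target) :
    ContDiffWithinAt ℝ m (localMetric g p) (halfSpace n) y :=
  contDiffWithinAt_halfSpace (contDiffOn_localMetric g p) hy

theorem isInner_formAt (g : Metric n M m) (x : M) : IsInner (formAt g.inner x) :=
  ⟨fun v w => g.symm x v w, fun v hv => g.pos x v hv⟩

theorem isInner_localMetric (g : Metric n M m) (hy : y ∈ (extChartAt (𝓡∂ (n + 1)) p).target) :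
    IsInner (localMetric g p y) :=
  (isInner_formAt g _).bilinearComp (injective_chartFrame hy)

omit [IsManifold (𝓡∂ (n + 1)) ∞ M] in
theorem exists_compact_nhdsWithin (hy : y ∈ (extChartAt (𝓡∂ (n + 1)) p).target) :
    ∃ K ∈ 𝓝[halfSpace n] y, IsCompact K ∧ K ⊆ (extChartAt (𝓡∂ (n + 1)) p).target := by
  obtain ⟨r, hr, hsub⟩ := Metric.mem_nhdsWithin_iff.1
    (extChartAt_target_mem_nhdsWithin_of_mem hy)
  refine ⟨Metric.closedBall y (r / 2) ∩ halfSpace n, ?_, ?_, ?_⟩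
  · exact inter_mem (mem_nhdsWithin_of_mem_nhds (Metric.closedBall_mem_nhds y (by positivity)))
      self_mem_nhdsWithin
  · exact (isCompact_closedBall y (r / 2)).inter_right (𝓡∂ (n + 1)).isClosed_range
  · refine (inter_subset_inter_left _ (Metric.closedBall_subset_ball (by linarith))).trans hsub

/-- The derivatives of the coordinate expressions of a metric depend continuously on the metric
and the point. -/
theorem familyContDiff_localMetric (g₀ : Metric n M m)
    (hy : y ∈ (extChartAt (𝓡∂ (n + 1)) p).target) :
    FamilyContDiff m (fun g : Metric n M m => localMetric g p) (halfSpace n) g₀ y := by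
  have hyS := target_subset_halfSpace p hy
  obtain ⟨K, hK, hKc, hKt⟩ := exists_compact_nhdsWithin hy
  rw [familyContDiff_iff_iteratedFDerivWithin (uniqueDiffOn_halfSpace n) hyS
    (extChartAt_target_mem_nhdsWithin_of_mem hy) fun g z hz => contDiffWithinAt_localMetric g hz.2]
  intro j hj
  have hcont : Continuous (fun g : Metric n M m =>
      UniformOnFun.ofFun {K : Set (E n) | IsCompact K ∧ K ⊆ (extChartAt (𝓡∂ (n + 1)) p).target}
        (iteratedFDerivWithin ℝ j (localMetric g p) (Set.range (𝓡∂ (n + 1))))) :=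
    continuous_iInf_dom (i := p) (continuous_iInf_dom (i := ⟨j, by omega⟩) continuous_induced_dom)
  have hunif := (UniformOnFun.tendsto_iff_tendstoUniformlyOn.1 (hcont.tendsto g₀)) K ⟨hKc, hKt⟩
  have hc : ContinuousWithinAt (iteratedFDerivWithin ℝ j (localMetric g₀ p) (halfSpace n))
      (halfSpace n) y := by
    have h1 : ContinuousOn (iteratedFDerivWithin ℝ j (localMetric g₀ p)
        ((extChartAt (𝓡∂ (n + 1)) p).target)) (extChartAt (𝓡∂ (n + 1)) p).target :=
      (contDiffOn_localMetric g₀ p).continuousOn_iteratedFDerivWithin (by norm_cast)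
        (uniqueDiffOn_extChartAt_target p)
    have h2 : ∀ z ∈ (extChartAt (𝓡∂ (n + 1)) p).target,
        iteratedFDerivWithin ℝ j (localMetric g₀ p) (halfSpace n) z =
        iteratedFDerivWithin ℝ j (localMetric g₀ p) (extChartAt (𝓡∂ (n + 1)) p).target z := by
      intro z hz
      apply iteratedFDerivWithin_congr_set
      rw [eventuallyEq_set]
      have := extChartAt_target_mem_nhdsWithin_of_mem hz
      rw [mem_nhdsWithin_iff_eventually] at this
      filter_upwards [this] with w hw using ⟨hw, fun h => target_subset_halfSpace p h⟩
    exact ((h1.congr h2) y hy).mono_of_mem_nhdsWithin (extChartAt_target_mem_nhdsWithin_of_mem hy)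
  rw [ContinuousWithinAt, nhdsWithin_prod_eq, nhdsWithin_univ]
  -- Convergence is uniform on the compact neighbourhood `K` and the limit is continuous at `y`,
  -- which together give joint continuity.
  refine tendsto_comp_of_locally_uniform_limit_within
    (F := fun (q : Metric n M m × E n) z =>
      iteratedFDerivWithin ℝ j (localMetric q.1 p) (halfSpace n) z) hc tendsto_snd fun u hu => ?_
  exact ⟨K, hK, (hunif u hu).prod_inl _⟩

/-- A family of metrics is continuous if the derivatives of the coordinate expressions depend
continuously on the parameter and the point. -/
theorem continuousAt_metric {ι : Type*} [TopologicalSpace ι] {γ : ι → Metric n M m} {i₀ : ι}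
    (h : ∀ (p : M), ∀ y ∈ (extChartAt (𝓡∂ (n + 1)) p).target,
      FamilyContDiff m (fun i => localMetric (γ i) p) (halfSpace n) i₀ y) :
    ContinuousAt γ i₀ := by
  rw [ContinuousAt, nhds_iInf, tendsto_iInf]
  intro p
  rw [nhds_iInf, tendsto_iInf]
  intro j
  rw [nhds_induced, tendsto_comap_iff, UniformOnFun.tendsto_iff_tendstoUniformlyOn]
  rintro K ⟨hKc, hKt⟩
  rw [← tendstoLocallyUniformlyOn_iff_tendstoUniformlyOn_of_compact hKc,
    Metric.tendstoLocallyUniformlyOn_iff]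
  intro ε hε x hx
  have hxT := hKt hx
  have hc := (familyContDiff_iff_iteratedFDerivWithin (uniqueDiffOn_halfSpace n)
    (target_subset_halfSpace p hxT) (extChartAt_target_mem_nhdsWithin_of_mem hxT)
    fun i z hz => contDiffWithinAt_localMetric (γ i) hz.2).1 (h p x hxT) j (by omega)
  rw [ContinuousWithinAt, nhdsWithin_prod_eq, nhdsWithin_univ, Metric.tendsto_nhds] at hc
  obtain ⟨A, hA, B, hB, hAB⟩ := eventually_prod_iff.1 (hc (ε / 2) (half_pos hε))
  refine ⟨{z | B z}, nhdsWithin_mono x (hKt.trans (target_subset_halfSpace p)) hB, ?_⟩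
  filter_upwards [hA] with i hi z hz
  -- Both `(i, z)` and `(i₀, z)` are compared with the same value at `(i₀, x)`, whence the halved
  -- `ε`. Local uniformity in `z` becomes uniformity on `K` by compactness.
  have h1 := hAB hi hz
  have h2 := hAB hA.self_of_nhds hz
  calc dist _ _ ≤ _ := dist_triangle_right _ _ _
    _ < ε / 2 + ε / 2 := add_lt_add h2 h1
    _ = ε := add_halves ε

end Topology

/-! ### Nondegenerate critical points -/

/-- `f` is twice continuously differentiable at `x` and `x` is not a degenerate critical point. -/
def NondegAt {V : Type} [NormedAddCommGroup V] [NormedSpace ℝ V] (f : V → ℝ) (x : V) : Prop :=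
  ContDiffAt ℝ 2 f x ∧ (fderiv ℝ f x = 0 → ∀ v, (∀ w, fderiv ℝ (fderiv ℝ f) x v w = 0) → v = 0)

/-- At a critical point the Hessian transforms as a bilinear form: the term containing the second
derivative of `σ` is multiplied by `df = 0`. -/
theorem NondegAt.comp {V W : Type} [NormedAddCommGroup V] [NormedSpace ℝ V]
    [NormedAddCommGroup W] [NormedSpace ℝ W] {f : V → ℝ} {f' : W → ℝ} {σ : W → V} {x : W}
    (hf : NondegAt f (σ x)) (hσ : ContDiffAt ℝ 2 σ x)
    (hb : Function.Bijective (fderiv ℝ σ x)) (he : ∀ᶠ z in 𝓝 x, f' z = f (σ z)) :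
    NondegAt f' x := by
  refine ⟨(hf.1.comp x hσ).congr_of_eventuallyEq he, fun h0 v hv => ?_⟩
  have hfe : ∀ᶠ z in 𝓝 x, DifferentiableAt ℝ f (σ z) := by
    have := hσ.continuousAt.eventually (hf.1.eventually (by simp))
    filter_upwards [this] with z hz using hz.differentiableAt (by simp)
  have hσe : ∀ᶠ z in 𝓝 x, DifferentiableAt ℝ σ z := by
    filter_upwards [hσ.eventually (by simp)] with z hz using hz.differentiableAt (by simp)
  have hd : ∀ᶠ z in 𝓝 x, fderiv ℝ f' z = (fderiv ℝ f (σ z)).comp (fderiv ℝ σ z) := by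
    filter_upwards [eventually_eventually_nhds.2 he, hfe, hσe] with z hz hz1 hz2
    rw [EventuallyEq.fderiv_eq hz]
    exact fderiv_comp z hz1 hz2
  have hf0 : fderiv ℝ f (σ x) = 0 := by
    ext w
    obtain ⟨u, rfl⟩ := hb.2 w
    have := DFunLike.congr_fun (hd.self_of_nhds.symm.trans h0) u
    simpa using this
  have h2f : HasFDerivAt (fun z => fderiv ℝ f (σ z))
      ((fderiv ℝ (fderiv ℝ f) (σ x)).comp (fderiv ℝ σ x)) x :=
    (((hf.1.fderiv_right (m := 1) (by norm_num)).differentiableAt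
      (by simp)).hasFDerivAt).comp x hσe.self_of_nhds.hasFDerivAt
  have h2σ : HasFDerivAt (fderiv ℝ σ) (fderiv ℝ (fderiv ℝ σ) x) x :=
    ((hσ.fderiv_right (m := 1) (by norm_num)).differentiableAt (by simp)).hasFDerivAt
  have h2 : ∀ w, fderiv ℝ (fderiv ℝ f') x v w =
      fderiv ℝ (fderiv ℝ f) (σ x) (fderiv ℝ σ x v) (fderiv ℝ σ x w) := by
    intro w
    rw [EventuallyEq.fderiv_eq hd, (h2f.clm_comp h2σ).fderiv]
    simp [hf0]
  have h3 : fderiv ℝ σ x v = 0 := by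
    refine hf.2 hf0 _ fun w => ?_
    obtain ⟨u, rfl⟩ := hb.2 w
    rw [← h2, hv]
  exact hb.1 (by rw [h3, map_zero])

theorem NondegAt.congr {V : Type} [NormedAddCommGroup V] [NormedSpace ℝ V] {f f' : V → ℝ} {x : V}
    (hf : NondegAt f x) (he : ∀ᶠ z in 𝓝 x, f' z = f z) : NondegAt f' x :=
  hf.comp (σ := id) contDiffAt_id (by rw [fderiv_id]; exact Function.bijective_id) he

/-- Being nondegenerate is an open condition on the parameter and the point. -/
theorem NondegAt.eventually {V : Type} [NormedAddCommGroup V] [NormedSpace ℝ V]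
    [FiniteDimensional ℝ V] {ι : Type*} [TopologicalSpace ι] {f : ι → V → ℝ} {i₀ : ι} {x : V}
    (h : NondegAt (f i₀) x) (hf : FamilyContDiff 2 f univ i₀ x)
    (hc : ∀ᶠ z in 𝓝 x, ∀ i, ContDiffAt ℝ 2 (f i) z) :
    ∀ᶠ q in 𝓝 ((i₀, x) : ι × V), NondegAt (f q.1) q.2 := by
  have h1 : ContinuousAt (fun q : ι × V => fderiv ℝ (f q.1) q.2) (i₀, x) := by
    have := hf.2.2.continuousWithinAt
    simpa [univ_prod_univ, continuousWithinAt_univ, fderivWithin_univ] using this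
  have h2 : ContinuousAt (fun q : ι × V => fderiv ℝ (fderiv ℝ (f q.1)) q.2) (i₀, x) := by
    have := hf.2.2.2.2.continuousWithinAt
    simpa [univ_prod_univ, continuousWithinAt_univ, fderivWithin_univ] using this
  have hc' : ∀ᶠ q in 𝓝 ((i₀, x) : ι × V), ContDiffAt ℝ 2 (f q.1) q.2 := by
    rw [nhds_prod_eq]
    filter_upwards [hc.prod_inr (𝓝 i₀)] with q hq using hq q.1
  -- Either the differential is nonzero at the base pair or the Hessian is injective there. Each
  -- alternative is open, the second because `V` is finite-dimensional.
  have key : ∀ᶠ q in 𝓝 ((i₀, x) : ι × V), fderiv ℝ (f q.1) q.2 ≠ 0 ∨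
      Function.Injective (fderiv ℝ (fderiv ℝ (f q.1)) q.2) := by
    by_cases h0 : fderiv ℝ (f i₀) x = 0
    · have hinj : Function.Injective (fderiv ℝ (fderiv ℝ (f i₀)) x) := by
        rw [injective_iff_map_eq_zero]
        intro v hv
        exact h.2 h0 v fun w => by rw [hv]; rfl
      have hopen := ContinuousLinearMap.isOpen_injective (𝕜 := ℝ) (E := V) (F := V →L[ℝ] ℝ)
      filter_upwards [h2.eventually (hopen.mem_nhds hinj)] with q hq using Or.inr hq
    · filter_upwards [h1.eventually_ne h0] with q hq using Or.inl hq
  filter_upwards [hc', key] with q hq1 hq2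
  refine ⟨hq1, fun h0 v hv => ?_⟩
  rcases hq2 with hq2 | hq2
  · exact absurd h0 hq2
  · exact hq2 (by ext w; rw [hv w, map_zero]; rfl)

/-! ### Boundary coordinates -/

/-- The inclusion of `ℝⁿ` as the boundary of the half-space. -/
def boundaryEmb (n : ℕ) (x : EuclideanSpace ℝ (Fin n)) : E n :=
  WithLp.toLp 2 (Fin.cons (α := fun _ => ℝ) 0 x)

/-- The last `n` coordinates. -/
def tangentialPart {n : ℕ} (y : E n) : EuclideanSpace ℝ (Fin n) :=
  WithLp.toLp 2 fun a => y a.succ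

section Coordinates

variable {n : ℕ}

@[simp] theorem boundaryEmb_zero (x : EuclideanSpace ℝ (Fin n)) : boundaryEmb n x 0 = 0 := rfl

@[simp] theorem boundaryEmb_succ (x : EuclideanSpace ℝ (Fin n)) (a : Fin n) :
    boundaryEmb n x a.succ = x a := rfl

theorem tangentialPart_boundaryEmb (x : EuclideanSpace ℝ (Fin n)) :
    tangentialPart (boundaryEmb n x) = x := rfl

theorem boundaryEmb_tangentialPart {y : E n} (hy : y 0 = 0) :
    boundaryEmb n (tangentialPart y) = y := by
  ext i
  refine Fin.cases ?_ (fun a => ?_) i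
  · exact hy.symm
  · rfl

/-- `boundaryEmb` as a continuous linear map. -/
def boundaryEmbL (n : ℕ) : EuclideanSpace ℝ (Fin n) →L[ℝ] E n :=
  LinearMap.toContinuousLinearMap
    { toFun := boundaryEmb n
      map_add' := fun x y => by
        ext i; refine Fin.cases ?_ (fun a => ?_) i <;> simp
      map_smul' := fun c x => by
        ext i; refine Fin.cases ?_ (fun a => ?_) i <;> simp }

/-- `tangentialPart` as a continuous linear map. -/
def tangentialPartL (n : ℕ) : E n →L[ℝ] EuclideanSpace ℝ (Fin n) :=
  LinearMap.toContinuousLinearMap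
    { toFun := tangentialPart
      map_add' := fun _ _ => rfl
      map_smul' := fun _ _ => rfl }

theorem boundaryEmb_mem_halfSpace (x : EuclideanSpace ℝ (Fin n)) :
    boundaryEmb n x ∈ halfSpace n := by
  rw [mem_halfSpace, boundaryEmb_zero]

theorem tendsto_boundaryEmb (x : EuclideanSpace ℝ (Fin n)) :
    Tendsto (boundaryEmb n) (𝓝 x) (𝓝[halfSpace n] (boundaryEmb n x)) :=
  tendsto_nhdsWithin_iff.2 ⟨(boundaryEmbL n).continuous.tendsto x,
    Eventually.of_forall boundaryEmb_mem_halfSpace⟩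

theorem contDiffAt_comp_boundaryEmb {F : Type*} [NormedAddCommGroup F] [NormedSpace ℝ F]
    {k : ℕ∞ω} {f : E n → F} {x : EuclideanSpace ℝ (Fin n)}
    (hf : ContDiffWithinAt ℝ k f (halfSpace n) (boundaryEmb n x)) :
    ContDiffAt ℝ k (fun x => f (boundaryEmb n x)) x := by
  rw [← contDiffWithinAt_univ]
  exact hf.comp x (boundaryEmbL n).contDiff.contDiffWithinAt
    fun z _ => boundaryEmb_mem_halfSpace z

theorem hasFDerivAt_comp_boundaryEmb {F : Type*} [NormedAddCommGroup F] [NormedSpace ℝ F]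
    {f : E n → F} {x : EuclideanSpace ℝ (Fin n)}
    (hf : DifferentiableWithinAt ℝ f (halfSpace n) (boundaryEmb n x)) :
    HasFDerivAt (fun x => f (boundaryEmb n x))
      ((fderivWithin ℝ f (halfSpace n) (boundaryEmb n x)).comp (boundaryEmbL n)) x := by
  rw [← hasFDerivWithinAt_univ]
  exact HasFDerivWithinAt.comp x hf.hasFDerivWithinAt
    (boundaryEmbL n).hasFDerivAt.hasFDerivWithinAt fun z _ => boundaryEmb_mem_halfSpace z

end Coordinates

/-! ### The Morse condition in boundary charts and its openness. -/

section Boundary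

variable {n : ℕ} {M : Type*} [TopologicalSpace M] [ChartedSpace (EuclideanHalfSpace (n + 1)) M]
  [IsManifold (𝓡∂ (n + 1)) ∞ M] {m : ℕ}

theorem boundaryEmb_coord {p : M} {q : M} (hq : q ∈ (𝓡∂ (n + 1)).boundary M)
    (hqp : q ∈ (extChartAt (𝓡∂ (n + 1)) p).source) :
    boundaryEmb n (tangentialPart (extChartAt (𝓡∂ (n + 1)) p q)) =
      extChartAt (𝓡∂ (n + 1)) p q :=
  boundaryEmb_tangentialPart ((mem_boundary_iff hqp).1 hq)

theorem boundaryEmb_boundaryCoord (p : (𝓡∂ (n + 1)).boundary M) :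
    boundaryEmb n (boundaryCoord p) = extChartAt (𝓡∂ (n + 1)) (p : M) p :=
  boundaryEmb_coord p.2 (mem_extChartAt_source _)

/-- The mean curvature may be computed in any chart. -/
theorem boundaryMeanCurvature_eq (hm : 1 ≤ m) (g : Metric n M m) {p : M}
    (q : (𝓡∂ (n + 1)).boundary M) (hq : (q : M) ∈ (extChartAt (𝓡∂ (n + 1)) p).source) :
    boundaryMeanCurvature g q =
      localMeanCurvature (localMetric g p) (extChartAt (𝓡∂ (n + 1)) p q) := by
  have hy := mem_extChartAt_target (I := 𝓡∂ (n + 1)) (q : M)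
  have hsymm := extChartAt_to_inv (I := 𝓡∂ (n + 1)) (q : M)
  have hp : (extChartAt (𝓡∂ (n + 1)) (q : M)).symm (extChartAt (𝓡∂ (n + 1)) (q : M) q) ∈
      (extChartAt (𝓡∂ (n + 1)) p).source := by rwa [hsymm]
  have ht : transition n (q : M) p (extChartAt (𝓡∂ (n + 1)) (q : M) q) =
      extChartAt (𝓡∂ (n + 1)) p q := by rw [transition, hsymm]
  have h0 := (mem_boundary_iff (mem_extChartAt_source (I := 𝓡∂ (n + 1)) (q : M))).1 q.2
  have hmem := transition_mem hp
  have hm' : (m : ℕ∞ω) ≠ 0 := by norm_cast; omega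
  have := (isBoundaryChange_transition hy hp h0).localMeanCurvature_pullback
    (G := localMetric g p) (G' := localMetric g q)
    ((contDiffWithinAt_localMetric g hmem).differentiableWithinAt hm')
    ((contDiffWithinAt_localMetric g hy).differentiableWithinAt hm')
    (isInner_localMetric g hmem) (by
      filter_upwards [eventually_mem_source hy hp] with z hz
      exact localForm_eq_bilinearComp g.inner hz.1 hz.2)
  rw [ht] at this
  exact this

omit [IsManifold (𝓡∂ (n + 1)) ∞ M] in
theorem eventually_boundaryEmb_mem_target {p : M} {x : EuclideanSpace ℝ (Fin n)}
    (hx : boundaryEmb n x ∈ (extChartAt (𝓡∂ (n + 1)) p).target) :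
    ∀ᶠ z in 𝓝 x, boundaryEmb n z ∈ (extChartAt (𝓡∂ (n + 1)) p).target :=
  (tendsto_boundaryEmb x).eventually (extChartAt_target_mem_nhdsWithin_of_mem hx)

theorem boundaryExpr_apply (f : (𝓡∂ (n + 1)).boundary M → ℝ) (p : (𝓡∂ (n + 1)).boundary M)
    {x : EuclideanSpace ℝ (Fin n)}
    (hx : boundaryEmb n x ∈ (extChartAt (𝓡∂ (n + 1)) (p : M)).target) :
    boundaryExpr f p x = f ⟨(extChartAt (𝓡∂ (n + 1)) (p : M)).symm (boundaryEmb n x),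
      (symm_mem_boundary_iff hx).2 rfl⟩ :=
  Subtype.val_injective.extend_apply f _
    (⟨_, (symm_mem_boundary_iff hx).2 rfl⟩ : (𝓡∂ (n + 1)).boundary M)

theorem boundaryExpr_meanCurvature (hm : 1 ≤ m) (g : Metric n M m) (p : (𝓡∂ (n + 1)).boundary M)
    {x : EuclideanSpace ℝ (Fin n)}
    (hx : boundaryEmb n x ∈ (extChartAt (𝓡∂ (n + 1)) (p : M)).target) :
    boundaryExpr (boundaryMeanCurvature g) p x =
      localMeanCurvature (localMetric g (p : M)) (boundaryEmb n x) := by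
  rw [boundaryExpr_apply _ _ hx, boundaryMeanCurvature_eq hm g (p := (p : M)) _
    ((extChartAt (𝓡∂ (n + 1)) (p : M)).map_target hx),
    (extChartAt (𝓡∂ (n + 1)) (p : M)).right_inv hx]

/-- Nondegeneracy does not depend on the boundary chart. -/
theorem nondegAt_boundaryExpr (f : (𝓡∂ (n + 1)).boundary M → ℝ) (p q : (𝓡∂ (n + 1)).boundary M)
    (hq : (q : M) ∈ (extChartAt (𝓡∂ (n + 1)) (p : M)).source)
    (h : NondegAt (boundaryExpr f p) (tangentialPart (extChartAt (𝓡∂ (n + 1)) (p : M) q))) :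
    NondegAt (boundaryExpr f q) (boundaryCoord q) := by
  set y := extChartAt (𝓡∂ (n + 1)) (q : M) q with hydef
  have hy : y ∈ (extChartAt (𝓡∂ (n + 1)) (q : M)).target := mem_extChartAt_target _
  have hsymm : (extChartAt (𝓡∂ (n + 1)) (q : M)).symm y = q := extChartAt_to_inv _
  have hp : (extChartAt (𝓡∂ (n + 1)) (q : M)).symm y ∈
      (extChartAt (𝓡∂ (n + 1)) (p : M)).source := by rwa [hsymm]
  have hemb : boundaryEmb n (boundaryCoord q) = y := boundaryEmb_boundaryCoord q
  have h0 : y 0 = 0 := by rw [← hemb]; rfl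
  have hch := isBoundaryChange_transition hy hp h0
  set σ : EuclideanSpace ℝ (Fin n) → EuclideanSpace ℝ (Fin n) := fun x =>
    tangentialPartL n (transition n (q : M) (p : M) (boundaryEmb n x)) with hσ
  have hσq : σ (boundaryCoord q) = tangentialPart (extChartAt (𝓡∂ (n + 1)) (p : M) q) := by
    simp only [hσ, hemb, transition, hsymm]
    rfl
  have hder : HasFDerivAt σ ((tangentialPartL n).comp
      ((fderivWithin ℝ (transition n (q : M) (p : M)) (halfSpace n) y).comp (boundaryEmbL n)))
      (boundaryCoord q) := by
    have := hasFDerivAt_comp_boundaryEmb (x := boundaryCoord q)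
      (by rw [hemb]; exact hch.differentiable)
    rw [hemb] at this
    exact (tangentialPartL n).hasFDerivAt.comp _ this
  -- The derivative of the transition map is injective and preserves boundary directions, so nothing
  -- is lost by dropping the component of index zero.
  have hinj : Function.Injective (fderiv ℝ σ (boundaryCoord q)) := by
    rw [hder.fderiv, injective_iff_map_eq_zero]
    intro v hv
    have h1 : tangentialPart (fderivWithin ℝ (transition n (q : M) (p : M)) (halfSpace n) y
      (boundaryEmb n v)) = 0 := hv
    have h2 := boundaryEmb_tangentialPart (hch.tangential (boundaryEmb_zero v))
    rw [h1] at h2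
    have h3 : boundaryEmb n v = 0 := hch.injective (by
      rw [map_zero, ← h2]; exact (boundaryEmbL n).map_zero)
    rw [← tangentialPart_boundaryEmb v, h3]
    rfl
  refine NondegAt.comp (f := boundaryExpr f p) (σ := σ) (by rwa [hσq]) ?_
    ⟨hinj, LinearMap.injective_iff_surjective.1 hinj⟩ ?_
  · exact (tangentialPartL n).contDiff.contDiffAt.comp _
      (contDiffAt_comp_boundaryEmb (by rw [hemb]; exact hch.contDiff))
  · have hev := eventually_mem_source hy hp
    rw [← hemb] at hev
    filter_upwards [(tendsto_boundaryEmb _).eventually hev] with x hx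
    have hb : boundaryEmb n (σ x) = transition n (q : M) (p : M) (boundaryEmb n x) :=
      boundaryEmb_tangentialPart (transition_boundary hx.1 hx.2 rfl)
    have hm : boundaryEmb n (σ x) ∈ (extChartAt (𝓡∂ (n + 1)) (p : M)).target := by
      rw [hb]; exact transition_mem hx.2
    rw [boundaryExpr_apply f q hx.1, boundaryExpr_apply f p hm]
    congr 2
    rw [hb, symm_transition hx.2]

/-- The mean curvature of `g` does not have a degenerate critical point at `q`. -/
def MorseAt (g : Metric n M m) (q : (𝓡∂ (n + 1)).boundary M) : Prop :=
  NondegAt (boundaryExpr (boundaryMeanCurvature g) q) (boundaryCoord q)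

theorem mem_morseMetrics {g : Metric n M m} : g ∈ morseMetrics n M m ↔ ∀ q, MorseAt g q := Iff.rfl

/-- `MorseAt` is phrased in the chart centred at `q`; this allows `q` to vary while the chart at `p`
stays fixed. -/
theorem morseAt_of_nondegAt (hm : 1 ≤ m) (g : Metric n M m) (p q : (𝓡∂ (n + 1)).boundary M)
    (hq : (q : M) ∈ (extChartAt (𝓡∂ (n + 1)) (p : M)).source)
    (h : NondegAt (fun x => localMeanCurvature (localMetric g (p : M)) (boundaryEmb n x))
      (tangentialPart (extChartAt (𝓡∂ (n + 1)) (p : M) q))) : MorseAt g q := by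
  refine nondegAt_boundaryExpr _ p q hq (h.congr ?_)
  have : boundaryEmb n (tangentialPart (extChartAt (𝓡∂ (n + 1)) (p : M) q)) ∈
      (extChartAt (𝓡∂ (n + 1)) (p : M)).target := by
    rw [boundaryEmb_coord q.2 hq]
    exact (extChartAt (𝓡∂ (n + 1)) (p : M)).map_source hq
  filter_upwards [eventually_boundaryEmb_mem_target this] with x hx
  exact boundaryExpr_meanCurvature hm g p hx

theorem MorseAt.nondegAt (hm : 1 ≤ m) {g : Metric n M m} {p : (𝓡∂ (n + 1)).boundary M}
    (h : MorseAt g p) :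
    NondegAt (fun x => localMeanCurvature (localMetric g (p : M)) (boundaryEmb n x))
      (boundaryCoord p) := by
  refine NondegAt.congr h ?_
  have : boundaryEmb n (boundaryCoord p) ∈ (extChartAt (𝓡∂ (n + 1)) (p : M)).target := by
    rw [boundaryEmb_boundaryCoord]
    exact mem_extChartAt_target _
  filter_upwards [eventually_boundaryEmb_mem_target this] with x hx
  exact (boundaryExpr_meanCurvature hm g p hx).symm

theorem contDiffAt_localMeanCurvature_boundary {k : ℕ∞ω} {p : M} {g : Metric n M m}
    (hg : ContDiffOn ℝ (k + 1) (localMetric g p) (extChartAt (𝓡∂ (n + 1)) p).target)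
    {x : EuclideanSpace ℝ (Fin n)}
    (hx : boundaryEmb n x ∈ (extChartAt (𝓡∂ (n + 1)) p).target) :
    ContDiffAt ℝ k (fun x => localMeanCurvature (localMetric g p) (boundaryEmb n x)) x :=
  contDiffAt_comp_boundaryEmb (contDiffWithinAt_localMeanCurvature (boundaryEmb_mem_halfSpace x)
    (isInner_localMetric g hx) (contDiffWithinAt_halfSpace hg hx))

/-- Three derivatives of the metric are needed: one in the mean curvature and two in its Hessian. -/
theorem isOpen_setOf_morseAt (hm : 3 ≤ m) :
    IsOpen {z : Metric n M m × (𝓡∂ (n + 1)).boundary M | MorseAt z.1 z.2} := by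
  rw [isOpen_iff_mem_nhds]
  rintro ⟨g₀, p⟩ hp
  have hnd := MorseAt.nondegAt (by omega) hp
  have hx₀ : boundaryEmb n (boundaryCoord p) ∈ (extChartAt (𝓡∂ (n + 1)) (p : M)).target := by
    rw [boundaryEmb_boundaryCoord]
    exact mem_extChartAt_target _
  have hfam : FamilyContDiff 2 (fun (g : Metric n M m) x =>
      localMeanCurvature (localMetric g (p : M)) (boundaryEmb n x)) univ g₀ (boundaryCoord p) := by
    refine FamilyContDiff.comp_inner (S := halfSpace n) (τ := boundaryEmb n) uniqueDiffOn_univ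
      (mem_univ _) (Eventually.of_forall boundaryEmb_mem_halfSpace)
      (boundaryEmbL n).contDiff.contDiffWithinAt ?_
    exact FamilyContDiff.localMeanCurvature (boundaryEmb_mem_halfSpace _)
      (isInner_localMetric g₀ hx₀) ((familyContDiff_localMetric g₀ hx₀).of_le hm)
  have hev := hnd.eventually hfam (by
    filter_upwards [eventually_boundaryEmb_mem_target hx₀] with x hx g
    exact contDiffAt_localMeanCurvature_boundary
      ((contDiffOn_localMetric g p).of_le (by norm_cast)) hx)
  have hcont : ContinuousAt (fun z : Metric n M m × (𝓡∂ (n + 1)).boundary M =>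
      (z.1, tangentialPartL n (extChartAt (𝓡∂ (n + 1)) (p : M) z.2))) (g₀, p) := by
    refine continuousAt_fst.prodMk ((tangentialPartL n).continuous.continuousAt.comp ?_)
    exact ContinuousAt.comp (f := fun z : Metric n M m × (𝓡∂ (n + 1)).boundary M => (z.2 : M))
      (continuousAt_extChartAt (p : M)) (by fun_prop)
  have hsrc : ∀ᶠ z : Metric n M m × (𝓡∂ (n + 1)).boundary M in 𝓝 (g₀, p),
      (z.2 : M) ∈ (extChartAt (𝓡∂ (n + 1)) (p : M)).source := by
    have : ContinuousAt (fun z : Metric n M m × (𝓡∂ (n + 1)).boundary M => (z.2 : M)) (g₀, p) := by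
      fun_prop
    exact this.eventually (extChartAt_source_mem_nhds (p : M))
  filter_upwards [hcont.eventually hev, hsrc] with z hz hz'
  exact morseAt_of_nondegAt (by omega) z.1 p z.2 hz' hz

/-- Tube lemma: joint openness and compactness of `K` give a neighbourhood of the metric that serves
all points of `K`. -/
theorem isOpen_setOf_forall_morseAt (hm : 3 ≤ m) {K : Set ((𝓡∂ (n + 1)).boundary M)}
    (hK : IsCompact K) : IsOpen {g : Metric n M m | ∀ q ∈ K, MorseAt g q} := by
  rw [isOpen_iff_mem_nhds]
  intro g hg
  exact hK.eventually_forall_of_forall_eventually fun q hq =>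
    (isOpen_setOf_morseAt hm).mem_nhds (hg q hq)

theorem compactSpace_boundary [CompactSpace M] : CompactSpace ((𝓡∂ (n + 1)).boundary M) :=
  isCompact_iff_compactSpace.1
    ((𝓡∂ (n + 1)).isClosed_boundary (M := M) (n := ∞) (by simp)).isCompact

theorem isOpen_morseMetrics [CompactSpace M] (hm : 3 ≤ m) : IsOpen (morseMetrics n M m) := by
  have := compactSpace_boundary (n := n) (M := M)
  simpa [morseMetrics, IsMorse, MorseAt, NondegAt] using
    isOpen_setOf_forall_morseAt (n := n) (M := M) hm isCompact_univ

end Boundary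

/-! ### Morse functions by linear perturbation -/

/-- Critical points of `f + ⟨a, ·⟩` are the points where `∇f = -a`, and they are nondegenerate when
`-a` is a regular value of `∇f`. By Sard's theorem in equal dimensions, almost every value is
regular. -/
theorem exists_nondegAt_add_inner {V : Type} [NormedAddCommGroup V] [InnerProductSpace ℝ V]
    [FiniteDimensional ℝ V] {f : V → ℝ} {O : Set V} (hO : IsOpen O) (hf : ContDiffOn ℝ 2 f O)
    {A : Set V} (hA : A ∈ 𝓝 (0 : V)) :
    ∃ a ∈ A, ∀ x ∈ O, NondegAt (fun z => f z + inner ℝ a z) x := by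
  let _ : MeasurableSpace V := borel V
  have : BorelSpace V := ⟨rfl⟩
  let μ : MeasureTheory.Measure V := MeasureTheory.Measure.addHaar
  have hfa : ∀ x ∈ O, ContDiffAt ℝ 2 f x := fun x hx => hf.contDiffAt (hO.mem_nhds hx)
  let L : (V →L[ℝ] ℝ) →L[ℝ] V :=
    (InnerProductSpace.toDual ℝ V).symm.toContinuousLinearEquiv.toContinuousLinearMap
  have hL : ∀ (φ : V →L[ℝ] ℝ) (w : V), inner ℝ (L φ) w = φ w := fun φ w =>
    InnerProductSpace.toDual_symm_apply
  have hD : ∀ x ∈ O, HasFDerivAt (fderiv ℝ f) (fderiv ℝ (fderiv ℝ f) x) x := fun x hx =>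
    (((hfa x hx).fderiv_right (m := 1) (by norm_num)).differentiableAt (by simp)).hasFDerivAt
  let N : Set V := {x ∈ O | ∃ v ≠ 0, ∀ w, fderiv ℝ (fderiv ℝ f) x v w = 0}
  have hnull : μ ((fun x => L (fderiv ℝ f x)) '' N) = 0 := by
    refine MeasureTheory.addHaar_image_eq_zero_of_det_fderivWithin_eq_zero μ
      (f' := fun x => L.comp (fderiv ℝ (fderiv ℝ f) x))
      (fun x hx => (L.hasFDerivAt.comp x (hD x hx.1)).hasFDerivWithinAt) ?_
    rintro x ⟨-, v, hv, hv0⟩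
    rw [ContinuousLinearMap.det]
    refine LinearMap.det_eq_zero_iff_ker_ne_bot.2 fun hbot => hv ?_
    have : v ∈ (L.comp (fderiv ℝ (fderiv ℝ f) x) : V →ₗ[ℝ] V).ker := by
      rw [LinearMap.mem_ker]
      change L (fderiv ℝ (fderiv ℝ f) x v) = 0
      rw [show fderiv ℝ (fderiv ℝ f) x v = 0 from ContinuousLinearMap.ext hv0, map_zero]
    rwa [hbot, Submodule.mem_bot] at this
  have hneg : (fun a : V => -a) ⁻¹' A ∈ 𝓝 (0 : V) := by
    refine continuous_neg.continuousAt.preimage_mem_nhds ?_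
    simpa using hA
  have hpos : 0 < μ ((fun a : V => -a) ⁻¹' A) := MeasureTheory.Measure.measure_pos_of_mem_nhds μ hneg
  -- `b` is a regular value of the gradient, and the perturbation vector is `a = -b`. It exists
  -- since `-A` has positive measure and the critical values form a null set.
  obtain ⟨b, hbA, hb⟩ : ∃ b ∈ (fun a : V => -a) ⁻¹' A, b ∉ (fun x => L (fderiv ℝ f x)) '' N := by
    by_contra! hcon
    exact absurd (MeasureTheory.measure_mono_null hcon hnull) hpos.ne'
  refine ⟨-b, hbA, fun x hx => ⟨?_, fun h0 v hv => ?_⟩⟩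
  · exact (hfa x hx).add ((innerSL ℝ (-b)).contDiff.contDiffAt)
  · have hd : ∀ᶠ z in 𝓝 x, fderiv ℝ (fun z => f z + inner ℝ (-b) z) z =
        fderiv ℝ f z + innerSL ℝ (-b) := by
      filter_upwards [hO.mem_nhds hx] with z hz
      exact (((hfa z hz).differentiableAt (by simp)).hasFDerivAt.add
        (innerSL ℝ (-b)).hasFDerivAt).fderiv
    have h1 := hd.self_of_nhds
    rw [h0] at h1
    have hLb : L (fderiv ℝ f x) = b := by
      refine ext_inner_right ℝ fun w => ?_
      have := DFunLike.congr_fun h1 w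
      simp only [zero_apply, add_apply, innerSL_apply_apply, inner_neg_left] at this
      rw [hL]
      linarith
    by_contra hv0
    refine hb ⟨x, ⟨hx, v, hv0, fun w => ?_⟩, hLb⟩
    have h2 := hv w
    rwa [EventuallyEq.fderiv_eq hd, ((hD x hx).add_const _).fderiv] at h2

/-! ### Constructing metrics -/

/-- The minimum of `B v v` over the compact unit sphere is positive, so `B` dominates a multiple of
the squared Euclidean norm. -/
theorem IsInner.isVonNBounded {n : ℕ} {B : Bil n} (h : IsInner B) :
    Bornology.IsVonNBounded ℝ {v : E n | B v v < 1} := by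
  rw [NormedSpace.isVonNBounded_iff]
  obtain ⟨c, hc, hcB⟩ : ∃ c > 0, ∀ v : E n, c * ‖v‖ ^ 2 ≤ B v v := by
    have hcont : Continuous fun v : E n => B v v := by fun_prop
    obtain ⟨v₀, hv₀, hmin⟩ := (isCompact_sphere (0 : E n) 1).exists_isMinOn
      ((NormedSpace.sphere_nonempty (E := E n)).2 zero_le_one) hcont.continuousOn
    have hv0 : v₀ ≠ 0 := by
      rintro rfl
      simp at hv₀
    refine ⟨B v₀ v₀, h.2 v₀ hv0, fun v => ?_⟩
    by_cases hv : v = 0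
    · simp [hv]
    have hn : 0 < ‖v‖ := norm_pos_iff.2 hv
    have hs : ‖v‖⁻¹ • v ∈ Metric.sphere (0 : E n) 1 := by
      rw [mem_sphere_zero_iff_norm, norm_smul, norm_inv, norm_norm, inv_mul_cancel₀ hn.ne']
    have h1 := isMinOn_iff.1 hmin _ hs
    simp only [map_smul, smul_apply, smul_eq_mul] at h1
    calc B v₀ v₀ * ‖v‖ ^ 2 ≤ (‖v‖⁻¹ * (‖v‖⁻¹ * B v v)) * ‖v‖ ^ 2 := by gcongr
      _ = B v v := by field_simp
  refine (Metric.isBounded_iff_subset_closedBall 0).2 ⟨√(1 / c), fun v hv => ?_⟩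
  rw [mem_closedBall_zero_iff]
  apply Real.le_sqrt_of_sq_le
  rw [le_div_iff₀ hc]
  have h1 := hcB v
  have h2 : B v v < 1 := hv
  linarith

section Construct

variable {n : ℕ} {M : Type*} [TopologicalSpace M] [ChartedSpace (EuclideanHalfSpace (n + 1)) M]
  [IsManifold (𝓡∂ (n + 1)) ∞ M] {m : ℕ}

theorem contMDiff_section_iff_localForm {k : ℕ∞ω} (hk : k ≤ ∞)
    (B : ∀ x : M, TangentSpace (𝓡∂ (n + 1)) x →L[ℝ] TangentSpace (𝓡∂ (n + 1)) x →L[ℝ] ℝ) :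
    ContMDiff (𝓡∂ (n + 1)) ((𝓡∂ (n + 1)).prod 𝓘(ℝ, Bil n)) k
      (fun x : M => Bundle.TotalSpace.mk' (Bil n)
        (E := fun x : M => TangentSpace (𝓡∂ (n + 1)) x →L[ℝ] TangentSpace (𝓡∂ (n + 1)) x →L[ℝ] ℝ)
        x (B x)) ↔
    ∀ p, ContDiffOn ℝ k (localForm B p) (extChartAt (𝓡∂ (n + 1)) p).target := by
  constructor
  · exact fun h p => (contMDiffOn_section_iff_localForm hk B p).1 h.contMDiffOn
  · exact fun h p => ((contMDiffOn_section_iff_localForm hk B p).2 (h p)).contMDiffAt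
      (extChartAt_source_mem_nhds p)

/-- The metric with given inner products, of class `C^m` in coordinates. -/
def mkMetric
    (B : ∀ x : M, TangentSpace (𝓡∂ (n + 1)) x →L[ℝ] TangentSpace (𝓡∂ (n + 1)) x →L[ℝ] ℝ)
    (hi : ∀ x, IsInner (formAt B x))
    (hB : ∀ p, ContDiffOn ℝ m (localForm B p) (extChartAt (𝓡∂ (n + 1)) p).target) :
    Metric n M m where
  inner := B
  symm x v w := (hi x).1 v w
  pos x v hv := (hi x).2 v hv
  isVonNBounded x := (hi x).isVonNBounded
  contMDiff := (contMDiff_section_iff_localForm (by norm_cast; simp) B).2 hB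

theorem metric_ext {g g' : Metric n M m} (h : ∀ x, g.inner x = g'.inner x) : g = g' := by
  cases g; cases g'
  congr
  exact funext h

/-- The field of bilinear forms `e^{2u} g`. -/
def conformalForm (g : Metric n M m) (u : M → ℝ) (x : M) :
    TangentSpace (𝓡∂ (n + 1)) x →L[ℝ] TangentSpace (𝓡∂ (n + 1)) x →L[ℝ] ℝ :=
  (Real.exp (2 * u x) • formAt g.inner x : Bil n)

theorem contDiffOn_comp_symm {k : ℕ∞ω} (hk : k ≤ ∞) {u : M → ℝ}
    (hu : ContMDiff (𝓡∂ (n + 1)) 𝓘(ℝ, ℝ) ∞ u) (p : M) :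
    ContDiffOn ℝ k (fun y => u ((extChartAt (𝓡∂ (n + 1)) p).symm y))
      (extChartAt (𝓡∂ (n + 1)) p).target :=
  (contMDiffOn_source_iff hk p).1 (hu.of_le hk).contMDiffOn

theorem contDiffOn_exp_smul {V F : Type} [NormedAddCommGroup V] [NormedSpace ℝ V]
    [NormedAddCommGroup F] [NormedSpace ℝ F] {k : ℕ∞ω} {u : V → ℝ} {G : V → F} {S : Set V}
    (hu : ContDiffOn ℝ k u S) (hG : ContDiffOn ℝ k G S) :
    ContDiffOn ℝ k (fun y => Real.exp (2 * u y) • G y) S :=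
  ((contDiffOn_const.mul hu).exp).smul hG

theorem contDiffOn_localForm_conformalForm {k : ℕ∞ω} (hk : k ≤ ∞) {g : Metric n M m} {p : M}
    (hg : ContDiffOn ℝ k (localMetric g p) (extChartAt (𝓡∂ (n + 1)) p).target) {u : M → ℝ}
    (hu : ContMDiff (𝓡∂ (n + 1)) 𝓘(ℝ, ℝ) ∞ u) :
    ContDiffOn ℝ k (localForm (conformalForm g u) p) (extChartAt (𝓡∂ (n + 1)) p).target :=
  contDiffOn_exp_smul (F := Bil n) (contDiffOn_comp_symm hk hu p) hg

/-- The conformal metric `e^{2u} g`. -/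
def conformal (g : Metric n M m) {u : M → ℝ} (hu : ContMDiff (𝓡∂ (n + 1)) 𝓘(ℝ, ℝ) ∞ u) :
    Metric n M m :=
  mkMetric (conformalForm g u)
    (fun x => ⟨fun v w => congrArg (Real.exp (2 * u x) * ·) ((isInner_formAt g x).1 v w),
      fun v hv => mul_pos (Real.exp_pos _) ((isInner_formAt g x).2 v hv)⟩)
    (fun p => contDiffOn_localForm_conformalForm (by norm_cast; simp) (contDiffOn_localMetric g p) hu)

theorem localMetric_conformal (g : Metric n M m) {u : M → ℝ}
    (hu : ContMDiff (𝓡∂ (n + 1)) 𝓘(ℝ, ℝ) ∞ u) (p : M) (y : E n) :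
    localMetric (conformal g hu) p y =
      Real.exp (2 * u ((extChartAt (𝓡∂ (n + 1)) p).symm y)) • localMetric g p y := rfl

theorem IsSmoothMetric.conformal {g : Metric n M m} (hg : IsSmoothMetric g) {u : M → ℝ}
    (hu : ContMDiff (𝓡∂ (n + 1)) 𝓘(ℝ, ℝ) ∞ u) : IsSmoothMetric (conformal g hu) :=
  (contMDiff_section_iff_localForm le_rfl _).2 fun p =>
    contDiffOn_localForm_conformalForm le_rfl (hg.contDiffOn_localMetric p) hu

/-- `g' = e^{2u} g` with `u` smooth and vanishing on the boundary. -/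
def IsBoundaryConformal (g g' : Metric n M m) : Prop :=
  ∃ u : M → ℝ, ContMDiff (𝓡∂ (n + 1)) 𝓘(ℝ, ℝ) ∞ u ∧ (∀ x ∈ (𝓡∂ (n + 1)).boundary M, u x = 0) ∧
    ∀ (x : M) (v w : TangentSpace (𝓡∂ (n + 1)) x),
      g'.inner x v w = Real.exp (2 * u x) * g.inner x v w

theorem IsBoundaryConformal.refl (g : Metric n M m) : IsBoundaryConformal g g :=
  ⟨fun _ => 0, contMDiff_const, fun _ _ => rfl, fun x v w => by simp⟩

theorem IsBoundaryConformal.trans {g g' g'' : Metric n M m} (h : IsBoundaryConformal g g')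
    (h' : IsBoundaryConformal g' g'') : IsBoundaryConformal g g'' := by
  obtain ⟨u, hu, hu0, hg⟩ := h
  obtain ⟨u', hu', hu0', hg'⟩ := h'
  refine ⟨fun x => u' x + u x, hu'.add hu, fun x hx => by simp [hu0 x hx, hu0' x hx],
    fun x v w => ?_⟩
  rw [hg', hg, ← mul_assoc, ← Real.exp_add, mul_add]

end Construct

/-! ### Conformal perturbation to a Morse mean curvature -/

section Conformal

variable {n : ℕ} {M : Type*} [TopologicalSpace M] [ChartedSpace (EuclideanHalfSpace (n + 1)) M]
  [IsManifold (𝓡∂ (n + 1)) ∞ M] {m : ℕ}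

omit [IsManifold (𝓡∂ (n + 1)) ∞ M] in
theorem contMDiff_sum_mul {u : Fin n → M → ℝ} (hu : ∀ j, ContMDiff (𝓡∂ (n + 1)) 𝓘(ℝ, ℝ) ∞ (u j))
    (a : EuclideanSpace ℝ (Fin n)) :
    ContMDiff (𝓡∂ (n + 1)) 𝓘(ℝ, ℝ) ∞ (fun x => ∑ j, a j * u j x) :=
  ContMDiff.sum fun j _ => contMDiff_const.mul (hu j)

theorem continuousAt_conformal_sum (g : Metric n M m) {u : Fin n → M → ℝ}
    (hu : ∀ j, ContMDiff (𝓡∂ (n + 1)) 𝓘(ℝ, ℝ) ∞ (u j)) (a₀ : EuclideanSpace ℝ (Fin n)) :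
    ContinuousAt (fun a => conformal g (contMDiff_sum_mul hu a)) a₀ := by
  refine continuousAt_metric fun p y hy => ?_
  have hS := uniqueDiffOn_halfSpace n
  have hx := target_subset_halfSpace p hy
  have h1 : FamilyContDiff m (fun (a : EuclideanSpace ℝ (Fin n)) z =>
      ∑ j, a j * u j ((extChartAt (𝓡∂ (n + 1)) p).symm z)) (halfSpace n) a₀ y := by
    refine FamilyContDiff.sum hS hx _ fun j _ => FamilyContDiff.smul hS hx
      (FamilyContDiff.param hS hx (by fun_prop)) (FamilyContDiff.const hS hx ?_)
    exact contDiffWithinAt_halfSpace (contDiffOn_comp_symm (by norm_cast; simp) (hu j) p) hy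
  have h2 := FamilyContDiff.contDiffAt_comp (Φ := fun t : ℝ => Real.exp (2 * t)) hS hx
    ((contDiff_const.mul contDiff_id).exp.contDiffAt) h1
  exact FamilyContDiff.smul (F := Bil n) hS hx h2
    (FamilyContDiff.const hS hx (contDiffWithinAt_localMetric g hy))

theorem conformal_zero (g : Metric n M m) {u : M → ℝ} (hu : ContMDiff (𝓡∂ (n + 1)) 𝓘(ℝ, ℝ) ∞ u)
    (h : ∀ x, u x = 0) : conformal g hu = g := by
  refine metric_ext fun x => ?_
  change (Real.exp (2 * u x) • formAt g.inner x : Bil n) = formAt g.inner x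
  rw [h, mul_zero, Real.exp_zero, one_smul]

/-- The norm of `dx₀` with respect to the metric. -/
def conormalLength {n : ℕ} (G : E n → Bil n) (y : E n) : ℝ := √((gramMatrix G y)⁻¹ 0 0)

theorem conormalLength_pos {n : ℕ} {G : E n → Bil n} {y : E n} (h : IsInner (G y)) :
    0 < conormalLength G y := Real.sqrt_pos.2 (inv_gramMatrix_zero_pos h)

theorem contDiffWithinAt_conormalLength {n : ℕ} {k : ℕ∞ω} {G : E n → Bil n} {S : Set (E n)}
    {y : E n} (hG : ContDiffWithinAt ℝ k G S y) (h : IsInner (G y)) :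
    ContDiffWithinAt ℝ k (conormalLength G) S y :=
  ContDiffAt.comp_contDiffWithinAt (f := G) (g := fun B => √((gramMatrix (fun _ => B) 0)⁻¹ 0 0)) y
    (contDiffAt_sqrt_gramMatrix_inv contDiffAt_id h) hG

/-- The conformal factors, supported near `p` and vanishing on the boundary, which change the mean
curvature near `p` by the coordinate functions. -/
def conformalBump (g : Metric n M m) (p : M) (χ : SmoothBumpFunction (𝓡∂ (n + 1)) p) (j : Fin n)
    (x : M) : ℝ :=
  χ x • (extChartAt (𝓡∂ (n + 1)) p x 0 * (extChartAt (𝓡∂ (n + 1)) p x j.succ *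
    -(n * conormalLength (localMetric g p) (extChartAt (𝓡∂ (n + 1)) p x))⁻¹))

/-- Smoothness of the metric enters because the factor contains `|dx₀|_g`: it is as regular as the
metric coefficients. -/
theorem contMDiff_conformalBump [T2Space M] (hn : n ≠ 0) {g : Metric n M m} (hg : IsSmoothMetric g)
    (p : M) (χ : SmoothBumpFunction (𝓡∂ (n + 1)) p) (j : Fin n) :
    ContMDiff (𝓡∂ (n + 1)) 𝓘(ℝ, ℝ) ∞ (conformalBump g p χ j) := by
  refine χ.contMDiff_smul ?_
  rw [← extChartAt_source (𝓡∂ (n + 1)), contMDiffOn_source_iff le_rfl]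
  have hc : ∀ i : Fin (n + 1), ContDiff ℝ ∞ fun y : E n => y i := fun i => by fun_prop
  have : ContDiffOn ℝ ∞ (fun y : E n => y 0 * (y j.succ * -(n * conormalLength (localMetric g p) y)⁻¹))
      (extChartAt (𝓡∂ (n + 1)) p).target := fun y hy => by
    refine (hc 0).contDiffWithinAt.mul ((hc j.succ).contDiffWithinAt.mul (ContDiffWithinAt.neg ?_))
    refine ContDiffWithinAt.inv (contDiffWithinAt_const.mul (contDiffWithinAt_conormalLength
      (hg.contDiffOn_localMetric p y hy) (isInner_localMetric g hy))) ?_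
    exact mul_ne_zero (Nat.cast_ne_zero.2 hn) (conormalLength_pos (isInner_localMetric g hy)).ne'
  refine this.congr fun y hy => ?_
  simp only [Function.comp_apply, (extChartAt (𝓡∂ (n + 1)) p).right_inv hy]

theorem conformalBump_boundary [T2Space M] (g : Metric n M m) (p : M)
    (χ : SmoothBumpFunction (𝓡∂ (n + 1)) p) (j : Fin n) {x : M} (hx : x ∈ (𝓡∂ (n + 1)).boundary M) :
    conformalBump g p χ j x = 0 := by
  by_cases hs : x ∈ (extChartAt (𝓡∂ (n + 1)) p).source
  · rw [conformalBump, (mem_boundary_iff hs).1 hx, zero_mul, smul_zero]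
  · have : χ x = 0 := by
      by_contra h
      refine hs ?_
      rw [extChartAt_source]
      exact χ.tsupport_subset_chartAt_source (subset_tsupport _ h)
    rw [conformalBump, this, zero_smul]

/-- Where the cutoff is one, `u = x₀ ψ` with `ψ = -⟨a, x⟩ / (n |dx₀|_g)` on the boundary, which
cancels the factor `-n |dx₀|_g` of the conformal formula. -/
theorem localMeanCurvature_conformalBump [T2Space M] (hn : n ≠ 0) (hm : 1 ≤ m) {g : Metric n M m}
    (hg : IsSmoothMetric g) (p : M) (χ : SmoothBumpFunction (𝓡∂ (n + 1)) p)
    (a : EuclideanSpace ℝ (Fin n)) {x : EuclideanSpace ℝ (Fin n)}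
    (hx : boundaryEmb n x ∈ (extChartAt (𝓡∂ (n + 1)) p).target)
    (hχ : χ =ᶠ[𝓝 ((extChartAt (𝓡∂ (n + 1)) p).symm (boundaryEmb n x))] 1) :
    localMeanCurvature (localMetric
        (conformal g (contMDiff_sum_mul (contMDiff_conformalBump hn hg p χ) a)) p)
        (boundaryEmb n x) =
      localMeanCurvature (localMetric g p) (boundaryEmb n x) + inner ℝ a x := by
  set y := boundaryEmb n x with hy
  set ψ : E n → ℝ := fun z => ∑ j, a j * (z j.succ *
    -(n * conormalLength (localMetric g p) z)⁻¹) with hψ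
  have hi := isInner_localMetric g hx
  have hl := conormalLength_pos hi
  have hn' : (n : ℝ) ≠ 0 := by exact_mod_cast hn
  have hd : DifferentiableWithinAt ℝ (localMetric g p) (halfSpace n) y :=
    (contDiffWithinAt_localMetric g hx).differentiableWithinAt (by norm_cast; omega)
  have hψd : DifferentiableWithinAt ℝ ψ (halfSpace n) y := by
    have h1 : DifferentiableWithinAt ℝ (conormalLength (localMetric g p)) (halfSpace n) y :=
      (contDiffWithinAt_conormalLength (k := 1) ((contDiffWithinAt_localMetric g hx).of_le
        (by norm_cast)) hi).differentiableWithinAt (by simp)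
    have h2 : DifferentiableWithinAt ℝ (fun z => -(n * conormalLength (localMetric g p) z)⁻¹)
      (halfSpace n) y := ((h1.const_mul _).inv (mul_ne_zero hn' hl.ne')).neg
    have hc : ∀ i : Fin (n + 1), Differentiable ℝ fun y : E n => y i := fun i => by fun_prop
    exact DifferentiableWithinAt.fun_sum fun j _ =>
      (((hc j.succ).differentiableAt.differentiableWithinAt).mul h2).const_mul _
  have hy0 : y 0 = 0 := rfl
  have h0 : HasFDerivWithinAt (fun z : E n => z 0) (EuclideanSpace.proj (𝕜 := ℝ) (0 : Fin (n + 1)))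
      (halfSpace n) y := (EuclideanSpace.proj (𝕜 := ℝ) (0 : Fin (n + 1))).hasFDerivWithinAt
  -- As `y₀ = 0`, the derivative of `x₀ ψ` at `y` is `ψ(y) dx₀`; the derivative of `ψ` drops out.
  have hprod := ((h0.mul hψd.hasFDerivWithinAt).const_mul 2).exp
  have hev : ∀ᶠ z in 𝓝[halfSpace n] y, z ∈ (extChartAt (𝓡∂ (n + 1)) p).target ∧
      χ ((extChartAt (𝓡∂ (n + 1)) p).symm z) = 1 := by
    refine Eventually.and (extChartAt_target_mem_nhdsWithin_of_mem hx) ?_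
    exact ((continuousAt_extChartAt_symm'' hx).continuousWithinAt (s := halfSpace n)).eventually hχ
  have key := localMeanCurvature_conformal (w := ψ y) (target_subset_halfSpace p hx) hi hd
    (G' := localMetric (conformal g (contMDiff_sum_mul (contMDiff_conformalBump hn hg p χ) a)) p)
    (c := fun z => Real.exp (2 * (z 0 * ψ z))) (by
      filter_upwards [hev] with z hz
      rw [localMetric_conformal]
      congr 3
      rw [hψ, Finset.mul_sum]
      refine Finset.sum_congr rfl fun j _ => ?_
      simp only [conformalBump, hz.2, one_smul, (extChartAt (𝓡∂ (n + 1)) p).right_inv hz.1]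
      ring) (by simp [hy0]) hprod (by
      intro v
      simp [hy0]
      ring)
  rw [key, sub_eq_add_neg]
  congr 1
  change -(n * ψ y * conormalLength (localMetric g p) y) = _
  have : ψ y = inner ℝ a x * -(n * conormalLength (localMetric g p) y)⁻¹ := by
    rw [hψ, PiLp.inner_apply, Finset.sum_mul]
    refine Finset.sum_congr rfl fun j _ => ?_
    change a j * (x j * _) = x j * a j * _
    ring
  rw [this]
  field_simp

theorem exists_conformal_morseAt_of_bump [T2Space M] (hn : n ≠ 0) (hm : 1 ≤ m) {g : Metric n M m}
    (hg : IsSmoothMetric g) {U : Set (Metric n M m)} (hU : U ∈ 𝓝 g)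
    (p : (𝓡∂ (n + 1)).boundary M)
    (χ : SmoothBumpFunction (𝓡∂ (n + 1)) (p : M)) :
    ∃ g' ∈ U, IsSmoothMetric g' ∧ IsBoundaryConformal g g' ∧
      ∀ q : (𝓡∂ (n + 1)).boundary M, (q : M) ∈ (extChartAt (𝓡∂ (n + 1)) (p : M)).source →
        χ =ᶠ[𝓝 (q : M)] 1 → MorseAt g' q := by
  let γ : EuclideanSpace ℝ (Fin n) → Metric n M m := fun a =>
    conformal g (contMDiff_sum_mul (contMDiff_conformalBump hn hg (p : M) χ) a)
  have hγ : ContinuousAt γ 0 := continuousAt_conformal_sum g (contMDiff_conformalBump hn hg (p : M) χ) 0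
  have hγ0 : γ 0 = g := conformal_zero g _ fun x => by simp
  have hA : γ ⁻¹' U ∈ 𝓝 (0 : EuclideanSpace ℝ (Fin n)) := hγ (by rwa [hγ0])
  have hO : IsOpen {x | boundaryEmb n x ∈ (extChartAt (𝓡∂ (n + 1)) (p : M)).target} :=
    isOpen_iff_mem_nhds.2 fun x hx => eventually_boundaryEmb_mem_target hx
  obtain ⟨a, haU, ha⟩ := exists_nondegAt_add_inner hO (f := fun x =>
    localMeanCurvature (localMetric g (p : M)) (boundaryEmb n x)) (fun x hx =>
      (contDiffAt_localMeanCurvature_boundary ((hg.contDiffOn_localMetric (p : M)).of_le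
        (by norm_cast)) hx).contDiffWithinAt) hA
  refine ⟨γ a, haU, hg.conformal _, ⟨_, contMDiff_sum_mul (contMDiff_conformalBump hn hg (p : M) χ) a,
    fun x hx => ?_, fun x v w => rfl⟩, fun q hq hχ => ?_⟩
  · simp [conformalBump_boundary g (p : M) χ _ hx]
  · have hemb := boundaryEmb_coord q.2 hq
    have hmem : boundaryEmb n (tangentialPart (extChartAt (𝓡∂ (n + 1)) (p : M) q)) ∈
        (extChartAt (𝓡∂ (n + 1)) (p : M)).target := by
      rw [hemb]
      exact (extChartAt (𝓡∂ (n + 1)) (p : M)).map_source hq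
    have hq' : (extChartAt (𝓡∂ (n + 1)) (p : M)).symm (boundaryEmb n (tangentialPart
        (extChartAt (𝓡∂ (n + 1)) (p : M) q))) = q := by
      rw [hemb]
      exact (extChartAt (𝓡∂ (n + 1)) (p : M)).left_inv hq
    refine morseAt_of_nondegAt hm _ p q hq ((ha _ hmem).congr ?_)
    have hχ' : ∀ᶠ x in 𝓝 (tangentialPart (extChartAt (𝓡∂ (n + 1)) (p : M) q)),
        χ =ᶠ[𝓝 ((extChartAt (𝓡∂ (n + 1)) (p : M)).symm (boundaryEmb n x))] 1 := by
      have h1 : Tendsto (fun x => (extChartAt (𝓡∂ (n + 1)) (p : M)).symm (boundaryEmb n x))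
          (𝓝 (tangentialPart (extChartAt (𝓡∂ (n + 1)) (p : M) q))) (𝓝 (q : M)) := by
        have h2 := (continuousAt_extChartAt_symm'' hmem).continuousWithinAt (s := halfSpace n)
        have h3 := Tendsto.comp h2 (tendsto_boundaryEmb (tangentialPart
          (extChartAt (𝓡∂ (n + 1)) (p : M) q)))
        rw [hq'] at h3
        exact h3
      exact h1.eventually hχ.eventually_nhds
    filter_upwards [eventually_boundaryEmb_mem_target hmem, hχ'] with x hx hx'
    exact (localMeanCurvature_conformalBump hn hm hg (p : M) χ a hx hx')

/-- Every smooth metric can be perturbed within its conformal class, without changing it on the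
boundary, to one with Morse boundary mean curvature. -/
theorem exists_conformal_morse [T2Space M] [CompactSpace M] (hn : n ≠ 0) (hm : 3 ≤ m)
    {g : Metric n M m} (hg : IsSmoothMetric g) {U : Set (Metric n M m)} (hU : U ∈ 𝓝 g) :
    ∃ g' ∈ U, IsSmoothMetric g' ∧ IsBoundaryConformal g g' ∧ g' ∈ morseMetrics n M m := by
  have := compactSpace_boundary (n := n) (M := M)
  let χ : ∀ p : (𝓡∂ (n + 1)).boundary M, SmoothBumpFunction (𝓡∂ (n + 1)) (p : M) := fun p =>
    Classical.choice inferInstance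
  -- Compact neighbourhoods are chosen so that nondegeneracy at all points of one of them is an open
  -- condition on the metric.
  have h1 : ∀ p : (𝓡∂ (n + 1)).boundary M, ∃ K ∈ 𝓝 p, IsCompact K ∧
      K ⊆ {q | (q : M) ∈ (extChartAt (𝓡∂ (n + 1)) (p : M)).source ∧
        χ p =ᶠ[𝓝 (q : M)] 1} := by
    intro p
    have h2 : ∀ᶠ q : M in 𝓝 (p : M), q ∈ (extChartAt (𝓡∂ (n + 1)) (p : M)).source ∧
        χ p =ᶠ[𝓝 q] 1 :=
      Eventually.and (extChartAt_source_mem_nhds (p : M)) (χ p).eventuallyEq_one.eventually_nhds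
    obtain ⟨K, hK, hsub, hKc⟩ := local_compact_nhds (continuous_subtype_val.continuousAt.eventually h2)
    exact ⟨K, hK, hKc, hsub⟩
  choose K hK hKc hKsub using h1
  obtain ⟨t, ht⟩ := isCompact_univ.elim_nhds_subcover K fun p _ => hK p
  have h3 : ∀ s : Finset ((𝓡∂ (n + 1)).boundary M), ∃ g' ∈ U, IsSmoothMetric g' ∧
      IsBoundaryConformal g g' ∧ ∀ p ∈ s, ∀ q ∈ K p, MorseAt g' q := by
    classical
    obtain ⟨V, hVU, hVo, hgV⟩ := mem_nhds_iff.1 hU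
    intro s
    suffices h : ∃ g' ∈ V, IsSmoothMetric g' ∧ IsBoundaryConformal g g' ∧
        ∀ p ∈ s, ∀ q ∈ K p, MorseAt g' q by
      obtain ⟨g', h1, h2⟩ := h
      exact ⟨g', hVU h1, h2⟩
    induction s using Finset.induction_on with
    | empty => exact ⟨g, hgV, hg, .refl g, by simp⟩
    | insert p s _ ih =>
      obtain ⟨g₁, hg₁V, hg₁, hc₁, hM₁⟩ := ih
      -- The next perturbation is confined to this open set, so it cannot destroy nondegeneracy
      -- where it has been achieved.
      have hW : IsOpen (V ∩ ⋂ p ∈ s, {g : Metric n M m | ∀ q ∈ K p, MorseAt g q}) :=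
        hVo.inter (isOpen_biInter_finset fun p _ => isOpen_setOf_forall_morseAt hm (hKc p))
      obtain ⟨g₂, hg₂W, hg₂, hc₂, hM₂⟩ := exists_conformal_morseAt_of_bump hn (by omega) hg₁
        (hW.mem_nhds ⟨hg₁V, mem_iInter₂.2 hM₁⟩) p (χ p)
      refine ⟨g₂, hg₂W.1, hg₂, hc₁.trans hc₂, fun p' hp' q hq => ?_⟩
      rcases Finset.mem_insert.1 hp' with rfl | hp'
      · exact hM₂ q (hKsub _ hq).1 (hKsub _ hq).2
      · exact mem_iInter₂.1 hg₂W.2 p' hp' q hq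
  obtain ⟨g', h4, h5, h6, h7⟩ := h3 t
  refine ⟨g', h4, h5, h6, mem_morseMetrics.2 fun q => ?_⟩
  obtain ⟨p, hp, hq⟩ := mem_iUnion₂.1 (ht.2 (mem_univ q))
  exact h7 p hp q hq

end Conformal

/-! ### Smoothing of functions on the half-space -/

section Smoothing

open MeasureTheory

/-- A bump function supported in the interior of the half-space. -/
def interiorBump (n : ℕ) : ContDiffBump ((2 : ℝ) • coordVec n 0) := ⟨1 / 2, 1, by norm_num, by norm_num⟩

/-- A mollifier supported in the interior of the half-space. -/
def mollifier (n : ℕ) : E n → ℝ := (interiorBump n).normed volume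

theorem mollifier_nonneg {n : ℕ} (a : E n) : 0 ≤ mollifier n a := (interiorBump n).nonneg_normed a

theorem contDiff_mollifier (n : ℕ) : ContDiff ℝ ∞ (mollifier n) :=
  (interiorBump n).contDiff_normed (n := ⊤)

theorem continuous_mollifier (n : ℕ) : Continuous (mollifier n) := (contDiff_mollifier n).continuous

theorem support_mollifier (n : ℕ) :
    Function.support (mollifier n) = Metric.ball ((2 : ℝ) • coordVec n 0) 1 :=
  (interiorBump n).support_normed_eq

theorem hasCompactSupport_mollifier (n : ℕ) : HasCompactSupport (mollifier n) :=
  (interiorBump n).hasCompactSupport_normed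

theorem mollifier_eq_zero {n : ℕ} {a : E n} (ha : a ∉ Metric.closedBall ((2 : ℝ) • coordVec n 0) 1) :
    mollifier n a = 0 := by
  by_contra h
  exact ha (Metric.ball_subset_closedBall (support_mollifier n ▸ h))

theorem one_lt_of_mollifier_ne_zero {n : ℕ} {a : E n} (ha : mollifier n a ≠ 0) : 1 < a 0 := by
  have h1 : a ∈ Metric.ball ((2 : ℝ) • coordVec n 0) 1 := support_mollifier n ▸ ha
  rw [mem_ball_iff_norm] at h1
  have h2 := (PiLp.norm_apply_le (a - (2 : ℝ) • coordVec n 0) 0).trans_lt h1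
  simp only [PiLp.sub_apply, PiLp.smul_apply, coordVec, PiLp.single_apply, if_true,
    smul_eq_mul, mul_one, Real.norm_eq_abs, abs_lt] at h2
  linarith

/-- The nearest point retraction onto the half-space. -/
def clamp {n : ℕ} (x : E n) : E n := x + max 0 (-x 0) • coordVec n 0

theorem continuous_clamp (n : ℕ) : Continuous (clamp (n := n)) := by
  unfold clamp
  fun_prop

theorem clamp_mem {n : ℕ} (x : E n) : clamp x ∈ halfSpace n := by
  rw [mem_halfSpace]
  simp only [clamp, PiLp.add_apply, PiLp.smul_apply, coordVec, PiLp.single_apply, if_true,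
    smul_eq_mul, mul_one]
  linarith [le_max_right 0 (-x 0)]

theorem clamp_of_mem {n : ℕ} {x : E n} (hx : x ∈ halfSpace n) : clamp x = x := by
  rw [clamp, max_eq_left (by linarith [mem_halfSpace.1 hx]), zero_smul, add_zero]

/-- The average of `f` over interior translates of `x` by vectors of length of order `ε ^ 2`. -/
def smoothing {n : ℕ} {F : Type} [NormedAddCommGroup F] [NormedSpace ℝ F] (ε : ℝ) (f : E n → F)
    (x : E n) : F :=
  ∫ a, mollifier n a • f (x + ε ^ 2 • a)

variable {n : ℕ} {F : Type} [NormedAddCommGroup F] [NormedSpace ℝ F] {f : E n → F} {ε : ℝ} {x : E n}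

/-- The translation points into the half-space for either sign of `ε`, which is the reason for the
square: the parameter can then range over a full neighbourhood of zero. -/
theorem add_smul_mem {a : E n} (hx : x ∈ halfSpace n) (ha : mollifier n a ≠ 0) :
    x + ε ^ 2 • a ∈ halfSpace n := by
  rw [mem_halfSpace] at hx ⊢
  have := one_lt_of_mollifier_ne_zero ha
  simp only [PiLp.add_apply, PiLp.smul_apply, smul_eq_mul]
  positivity

theorem smoothing_congr {f' : E n → F} (h : EqOn f f' (halfSpace n)) (hx : x ∈ halfSpace n) :
    smoothing ε f x = smoothing ε f' x := by
  refine integral_congr_ae (Eventually.of_forall fun a => ?_)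
  by_cases ha : mollifier n a = 0
  · simp [ha]
  · exact congrArg (mollifier n a • ·) (h (add_smul_mem hx ha))

theorem eqOn_clamp {X : Type*} (f : E n → X) : EqOn f (f ∘ clamp) (halfSpace n) := fun x hx => by
  rw [Function.comp_apply, clamp_of_mem hx]

/-- Smoothings on the half-space only see values there, so `f` may be replaced by this globally
continuous function. -/
theorem continuous_comp_clamp {X : Type*} [TopologicalSpace X] {f : E n → X} (hf : ContinuousOn f (halfSpace n)) :
    Continuous (f ∘ clamp) :=
  hf.comp_continuous (continuous_clamp n) clamp_mem

theorem smoothing_zero [CompleteSpace F] (f : E n → F) : smoothing 0 f = f := by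
  funext x
  simp only [smoothing, ne_eq, OfNat.ofNat_ne_zero, not_false_eq_true, zero_pow, zero_smul,
    add_zero]
  exact (interiorBump n).integral_normed_smul _ (f x)

theorem continuous_smoothing (hf : Continuous f) :
    Continuous fun p : ℝ × E n => smoothing p.1 f p.2 := by
  have h1 : Continuous (Function.uncurry fun (p : ℝ × E n) a =>
      mollifier n a • f (p.2 + p.1 ^ 2 • a)) := by
    have := continuous_mollifier n
    unfold Function.uncurry
    fun_prop
  refine (continuous_parametric_integral_of_continuous (μ := volume) h1
    (isCompact_closedBall ((2 : ℝ) • coordVec n 0) 1)).congr fun p => ?_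
  exact setIntegral_eq_integral_of_forall_compl_eq_zero fun a ha => by
    rw [mollifier_eq_zero ha, zero_smul]

theorem continuousOn_smoothing (hf : ContinuousOn f (halfSpace n)) :
    ContinuousOn (fun p : ℝ × E n => smoothing p.1 f p.2) (univ ×ˢ halfSpace n) :=
  (continuous_smoothing (continuous_comp_clamp hf)).continuousOn.congr fun _ hp =>
    smoothing_congr (eqOn_clamp f) hp.2

theorem integrable_mollifier_smul (hf : Continuous f) (ε : ℝ) (x : E n) :
    Integrable fun a => mollifier n a • f (x + ε ^ 2 • a) := by
  have := continuous_mollifier n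
  exact Continuous.integrable_of_hasCompactSupport (by fun_prop)
    (hasCompactSupport_mollifier n).smul_right

/-- Differentiation under the integral. Only the open half-space matters: for `z` in the ball of
radius `ε ^ 2` about `x` and `a` in the support of the mollifier, `z₀ > -ε ^ 2` and `a₀ > 1`, so the
translate is interior. -/
theorem hasFDerivAt_smoothing {f' : E n → E n →L[ℝ] F} (hf : Continuous f) (hf' : Continuous f')
    (hd : ∀ z : E n, 0 < z 0 → HasFDerivAt f (f' z) z) (hε : ε ≠ 0) (hx : x ∈ halfSpace n) :
    HasFDerivAt (smoothing ε f) (smoothing ε f' x) x := by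
  have hε2 : 0 < ε ^ 2 := by positivity
  obtain ⟨C, hC⟩ := ((isCompact_closedBall x (ε ^ 2)).prod
    (isCompact_closedBall ((2 : ℝ) • coordVec n 0) 1)).exists_bound_of_continuousOn
    (f := fun q : E n × E n => f' (q.1 + ε ^ 2 • q.2)) (by fun_prop)
  have hint : Integrable (mollifier n) := (interiorBump n).integrable_normed
  refine hasFDerivAt_integral_of_dominated_of_fderiv_le (bound := fun a => mollifier n a * C)
    (F' := fun z a => mollifier n a • f' (z + ε ^ 2 • a)) (Metric.ball_mem_nhds x hε2)
    (Eventually.of_forall fun z => (integrable_mollifier_smul hf ε z).aestronglyMeasurable)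
    (integrable_mollifier_smul hf ε x) (integrable_mollifier_smul hf' ε x).aestronglyMeasurable
    (Eventually.of_forall fun a z hz => ?_) (hint.mul_const C)
    (Eventually.of_forall fun a z hz => ?_)
  · rw [norm_smul, Real.norm_of_nonneg (mollifier_nonneg a)]
    by_cases ha : a ∈ Metric.closedBall ((2 : ℝ) • coordVec n 0) 1
    · exact mul_le_mul_of_nonneg_left (hC (z, a) ⟨Metric.ball_subset_closedBall hz, ha⟩)
        (mollifier_nonneg a)
    · simp [mollifier_eq_zero ha]
  · by_cases ha : mollifier n a = 0
    · simpa [ha] using hasFDerivAt_const (0 : F) z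
    · have h1 : 0 < (z + ε ^ 2 • a) 0 := by
        have h2 := one_lt_of_mollifier_ne_zero ha
        have h3 := (PiLp.norm_apply_le (z - x) 0).trans_lt (mem_ball_iff_norm.1 hz)
        have h4 := mem_halfSpace.1 hx
        simp only [PiLp.sub_apply, Real.norm_eq_abs, abs_lt] at h3
        simp only [PiLp.add_apply, PiLp.smul_apply, smul_eq_mul]
        nlinarith
      have h5 := (hd _ h1).comp z ((hasFDerivAt_id z).add_const (ε ^ 2 • a))
      exact h5.const_smul (mollifier n a)

theorem halfSpace_mem_nhds {z : E n} (hz : 0 < z 0) : halfSpace n ∈ 𝓝 z := by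
  have : Continuous fun z : E n => z 0 := by fun_prop
  filter_upwards [this.continuousAt.eventually (lt_mem_nhds hz)] with w hw
  exact mem_halfSpace.2 hw.le

/-- Smoothing commutes with differentiation. -/
theorem hasFDerivWithinAt_smoothing [CompleteSpace F] (hf : ContDiffOn ℝ 1 f (halfSpace n)) (ε : ℝ)
    (hx : x ∈ halfSpace n) :
    HasFDerivWithinAt (smoothing ε f) (smoothing ε (fderivWithin ℝ f (halfSpace n)) x)
      (halfSpace n) x := by
  have hu := uniqueDiffOn_halfSpace n
  by_cases hε : ε = 0
  · rw [hε, smoothing_zero, smoothing_zero]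
    exact (hf.differentiableOn (by simp) x hx).hasFDerivWithinAt
  have hc' := hf.continuousOn_fderivWithin hu (by simp)
  have h1 := hasFDerivAt_smoothing (continuous_comp_clamp hf.continuousOn)
    (continuous_comp_clamp hc') (fun z hz => ?_) hε hx
  · rw [smoothing_congr (eqOn_clamp _) hx]
    exact h1.hasFDerivWithinAt.congr (fun y hy => smoothing_congr (eqOn_clamp f) hy)
      (smoothing_congr (eqOn_clamp f) hx)
  · have hn := halfSpace_mem_nhds hz
    have hz' := mem_halfSpace.2 hz.le
    have h2 := (hf.differentiableOn (by simp) z hz').hasFDerivWithinAt.hasFDerivAt hn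
    rw [Function.comp_apply, clamp_of_mem hz']
    exact h2.congr_of_eventuallyEq (by
      filter_upwards [hn] with w hw using (eqOn_clamp f hw).symm)

/-- The derivatives of the smoothings depend continuously on the parameter and the point. -/
theorem familyContDiff_smoothing (ε : ℝ) (hx : x ∈ halfSpace n) {k : ℕ} :
    ∀ {F : Type} [NormedAddCommGroup F] [NormedSpace ℝ F] [CompleteSpace F] {f : E n → F},
    ContDiffOn ℝ k f (halfSpace n) → FamilyContDiff k (fun ε => smoothing ε f) (halfSpace n) ε x := by
  have hu := uniqueDiffOn_halfSpace n
  induction k with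
  | zero =>
    intro F _ _ _ f hf
    exact continuousOn_smoothing hf.continuousOn _ ⟨mem_univ _, hx⟩
  | succ k ih =>
    intro F _ _ _ f hf
    have hf1 : ContDiffOn ℝ 1 f (halfSpace n) := hf.of_le (by norm_cast; omega)
    refine ⟨continuousOn_smoothing hf.continuousOn _ ⟨mem_univ _, hx⟩, ?_, ?_⟩
    · filter_upwards [eventually_mem_snd] with p hp
      exact (hasFDerivWithinAt_smoothing hf1 p.1 hp).differentiableWithinAt
    · refine (ih (hf.fderivWithin hu (m := k) (by norm_cast))).congr hx ?_
      filter_upwards [eventually_mem_snd] with p hp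
      exact (hasFDerivWithinAt_smoothing hf1 p.1 hp).fderivWithin (hu _ hp)

/-- The substitution `t = -ε ^ 2 a` turns the average into a constant multiple of the convolution of
`f` with a smooth compactly supported kernel. -/
theorem contDiff_smoothing [CompleteSpace F] (hf : Continuous f) (hε : ε ≠ 0) :
    ContDiff ℝ ∞ (smoothing ε f) := by
  have hε2 : -ε ^ 2 ≠ 0 := by simpa using hε
  set ψ : E n → ℝ := fun t => mollifier n ((-ε ^ 2)⁻¹ • t) with hψ
  have h1 : HasCompactSupport ψ :=
    (hasCompactSupport_mollifier n).comp_smul (inv_ne_zero hε2)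
  have h2 : ContDiff ℝ ∞ ψ := (contDiff_mollifier n).comp (contDiff_const_smul _)
  have h3 := h1.contDiff_convolution_left (μ := volume) (n := ⊤) (ContinuousLinearMap.lsmul ℝ ℝ) h2
    hf.locallyIntegrable
  have h5 := h3.const_smul |((-ε ^ 2) ^ Module.finrank ℝ (E n))⁻¹|
  convert h5 using 1
  funext x
  have h4 := Measure.integral_comp_smul volume (fun t : E n => ψ t • f (x - t)) (-ε ^ 2)
  rw [smoothing]
  refine Eq.trans (integral_congr_ae (Eventually.of_forall fun a => ?_)) h4
  rw [hψ]
  dsimp only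
  rw [inv_smul_smul₀ hε2, neg_smul, sub_neg_eq_add]

theorem contDiffOn_smoothing [CompleteSpace F] {k : ℕ} (hf : ContDiffOn ℝ k f (halfSpace n))
    (ε : ℝ) : ContDiffOn ℝ k (smoothing ε f) (halfSpace n) := by
  by_cases hε : ε = 0
  · rwa [hε, smoothing_zero]
  · exact ((contDiff_smoothing (continuous_comp_clamp hf.continuousOn) hε).of_le
      (by norm_cast; simp)).contDiffOn.congr fun y hy => smoothing_congr (eqOn_clamp f) hy

theorem contDiffOn_smoothing_infty [CompleteSpace F] (hf : ContinuousOn f (halfSpace n))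
    (hε : ε ≠ 0) : ContDiffOn ℝ ∞ (smoothing ε f) (halfSpace n) :=
  (contDiff_smoothing (continuous_comp_clamp hf) hε).contDiffOn.congr
    fun _ hy => smoothing_congr (eqOn_clamp f) hy

theorem smoothing_apply_apply {B : E n → Bil n} (hB : ContinuousOn B (halfSpace n)) (ε : ℝ)
    (hx : x ∈ halfSpace n) (v w : E n) :
    smoothing ε B x v w = ∫ a, mollifier n a * (B (clamp (x + ε ^ 2 • a)) v w) := by
  rw [smoothing_congr (eqOn_clamp B) hx]
  have hi := integrable_mollifier_smul (F := Bil n) (continuous_comp_clamp hB) ε x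
  have hi' := hi.apply_continuousLinearMap v
  rw [smoothing, ContinuousLinearMap.integral_apply hi, ContinuousLinearMap.integral_apply hi']
  rfl

/-- Strict positivity survives averaging because the integrand is nonnegative with support a ball,
which has positive measure. -/
theorem IsInner.smoothing {B : E n → Bil n} (hB : ContinuousOn B (halfSpace n))
    (hi : ∀ y ∈ halfSpace n, IsInner (B y)) (ε : ℝ) (hx : x ∈ halfSpace n) :
    IsInner (smoothing ε B x) := by
  refine ⟨fun v w => ?_, fun v hv => ?_⟩
  · rw [smoothing_apply_apply hB ε hx, smoothing_apply_apply hB ε hx]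
    simp only [(hi _ (clamp_mem _)).1 v w]
  · rw [smoothing_apply_apply hB ε hx]
    have hpos : ∀ a : E n, 0 < B (clamp (x + ε ^ 2 • a)) v v := fun a =>
      (hi _ (clamp_mem _)).2 v hv
    have hint : Integrable fun a => mollifier n a * (B (clamp (x + ε ^ 2 • a)) v v) :=
      integrable_mollifier_smul (F := ℝ) (f := fun z => B (clamp z) v v)
        ((Continuous.comp (g := fun B : Bil n => B v v) (by fun_prop)
          (continuous_comp_clamp hB) :)) ε x
    rw [integral_pos_iff_support_of_nonneg
      (fun a => mul_nonneg (mollifier_nonneg a) (hpos a).le) hint]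
    have : Function.support (fun a => mollifier n a * (B (clamp (x + ε ^ 2 • a)) v v)) =
        Metric.ball ((2 : ℝ) • coordVec n 0) 1 := by
      rw [← support_mollifier]
      ext a
      simp [(hpos a).ne']
    rw [this]
    exact Metric.measure_ball_pos _ _ one_pos

end Smoothing

/-! ### Density of smooth metrics -/

/-- The standard inner product. -/
def euclideanForm (n : ℕ) : Bil n := innerSL ℝ

theorem isInner_euclideanForm (n : ℕ) : IsInner (euclideanForm n) :=
  ⟨fun v w => real_inner_comm w v, fun _ hv => real_inner_self_pos.2 hv⟩

theorem IsInner.convex_comb {n : ℕ} {B B' : Bil n} (h : IsInner B) (h' : IsInner B') {t : ℝ}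
    (h0 : 0 ≤ t) (h1 : t ≤ 1) : IsInner (t • B + (1 - t) • B') := by
  refine ⟨fun v w => ?_, fun v hv => ?_⟩
  · simp only [add_apply, smul_apply, h.1 v w, h'.1 v w]
  · have h2 := h.2 v hv
    have h3 := h'.2 v hv
    simp only [add_apply, smul_apply, smul_eq_mul]
    rcases h0.eq_or_lt with rfl | h4
    · linarith
    · have := mul_pos h4 h2
      have := mul_nonneg (sub_nonneg.2 h1) h3.le
      linarith

theorem contDiffWithinAt_smul {V F : Type*} [NormedAddCommGroup V] [NormedSpace ℝ V]
    [NormedAddCommGroup F] [NormedSpace ℝ F] {k : ℕ∞ω} {c : V → ℝ} {B : V → F} {S : Set V} {x : V}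
    (hc : ContDiffWithinAt ℝ k c S x) (hB : ContDiffWithinAt ℝ k B S x) :
    ContDiffWithinAt ℝ k (fun y => c y • B y) S x := hc.smul hB

theorem smul_eq_zero_of_eq_zero {F : Type*} [NormedAddCommGroup F] [NormedSpace ℝ F] {c : ℝ}
    (hc : c = 0) (B : F) : c • B = 0 := by rw [hc, zero_smul]

theorem interpolation_of_eq_zero {F : Type*} [NormedAddCommGroup F] [NormedSpace ℝ F] {c : ℝ}
    (hc : c = 0) (B B' : F) : c • B + (1 - c) • B' = B' := by simp [hc]

theorem interpolation_of_eq_one {F : Type*} [NormedAddCommGroup F] [NormedSpace ℝ F] {c : ℝ}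
    (hc : c = 1) (B B' : F) : c • B + (1 - c) • B' = B := by simp [hc]

theorem contDiffWithinAt_bilinearComp_comp {V W : Type} [NormedAddCommGroup V] [NormedSpace ℝ V]
    [NormedAddCommGroup W] [NormedSpace ℝ W] {k : ℕ∞ω} {A : W → V →L[ℝ] V →L[ℝ] ℝ} {S : Set W}
    {T : Set W} {τ : W → W} {D : W → V →L[ℝ] V} {w : W} (hA : ContDiffWithinAt ℝ k A S (τ w))
    (hτ : ContDiffWithinAt ℝ k τ T w) (hD : ContDiffWithinAt ℝ k D T w)
    (hmaps : ∀ᶠ z in 𝓝[T] w, τ z ∈ S) :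
    ContDiffWithinAt ℝ k (fun z => (A (τ z)).bilinearComp (D z) (D z)) T w := by
  have h1 : ContDiffWithinAt ℝ k (fun z => A (τ z)) T w := by
    have := hA.comp (s := T ∩ {z | τ z ∈ S}) w (hτ.mono inter_subset_left) fun z hz => hz.2
    exact this.mono_of_mem_nhdsWithin (inter_mem self_mem_nhdsWithin hmaps)
  have h2 : ContDiffAt ℝ k (fun p : (V →L[ℝ] V →L[ℝ] ℝ) × (V →L[ℝ] V) => p.1.bilinearComp p.2 p.2)
    (A (τ w), D w) := (contDiff_bilinearComp (V := V)).contDiffAt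
  exact ContDiffAt.comp_contDiffWithinAt (f := fun z => (A (τ z), D z)) w h2 (h1.prodMk hD)

theorem FamilyContDiff.bilinearComp_comp {ι : Type*} [TopologicalSpace ι] {V W : Type}
    [NormedAddCommGroup V] [NormedSpace ℝ V] [NormedAddCommGroup W] [NormedSpace ℝ W] {k : ℕ}
    {A : ι → W → V →L[ℝ] V →L[ℝ] ℝ} {S T : Set W} {τ : W → W} {D : W → V →L[ℝ] V} {w : W} {i₀ : ι}
    (hT : UniqueDiffOn ℝ T) (hw : w ∈ T) (hA : FamilyContDiff k A S i₀ (τ w))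
    (hτ : ContDiffWithinAt ℝ k τ T w) (hD : ContDiffWithinAt ℝ k D T w)
    (hmaps : ∀ᶠ z in 𝓝[T] w, τ z ∈ S) :
    FamilyContDiff k (fun i z => (A i (τ z)).bilinearComp (D z) (D z)) T i₀ w :=
  FamilyContDiff.contDiffAt_comp (f := fun i z => (A i (τ z), D z))
    (Φ := fun p : (V →L[ℝ] V →L[ℝ] ℝ) × (V →L[ℝ] V) => p.1.bilinearComp p.2 p.2) hT hw
    (contDiff_bilinearComp (V := V)).contDiffAt
    (FamilyContDiff.prodMk hT hw (FamilyContDiff.comp_inner hT hw hmaps hτ hA)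
      (FamilyContDiff.const hT hw hD))

section Density

variable {n : ℕ} {M : Type*} [TopologicalSpace M] [ChartedSpace (EuclideanHalfSpace (n + 1)) M]

/-- The field of bilinear forms with coordinate expression `B` in the chart at `p`. -/
def chartForm (p : M) (B : E n → Bil n) (x : M) :
    TangentSpace (𝓡∂ (n + 1)) x →L[ℝ] TangentSpace (𝓡∂ (n + 1)) x →L[ℝ] ℝ :=
  ((B (extChartAt (𝓡∂ (n + 1)) p x)).bilinearComp
    (chartFrame p (extChartAt (𝓡∂ (n + 1)) p x)).inverse
    (chartFrame p (extChartAt (𝓡∂ (n + 1)) p x)).inverse : Bil n)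

variable [IsManifold (𝓡∂ (n + 1)) ∞ M] {m : ℕ} {p q : M} {y : E n}

theorem isInvertible_chartFrame (hy : y ∈ (extChartAt (𝓡∂ (n + 1)) p).target) :
    (chartFrame p y).IsInvertible := by
  have : IsManifold (𝓡∂ (n + 1)) 1 M := IsManifold.of_le (n := ∞) (by norm_cast)
  exact isInvertible_mfderivWithin_extChartAt_symm hy

theorem localForm_chartForm (B : E n → Bil n) (hy : y ∈ (extChartAt (𝓡∂ (n + 1)) p).target) :
    localForm (chartForm p B) p y = B y := by
  have h1 := (extChartAt (𝓡∂ (n + 1)) p).right_inv hy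
  have h2 : ∀ v, (chartFrame p y).inverse (chartFrame p y v) = v := fun v =>
    DFunLike.congr_fun (isInvertible_chartFrame hy).inverse_comp_self v
  ext v w
  change B (extChartAt (𝓡∂ (n + 1)) p ((extChartAt (𝓡∂ (n + 1)) p).symm y))
    ((chartFrame p (extChartAt (𝓡∂ (n + 1)) p ((extChartAt (𝓡∂ (n + 1)) p).symm y))).inverse
      (chartFrame p y v))
    ((chartFrame p (extChartAt (𝓡∂ (n + 1)) p ((extChartAt (𝓡∂ (n + 1)) p).symm y))).inverse
      (chartFrame p y w)) = _
  rw [h1, h2, h2]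

theorem isInner_chartForm {B : E n → Bil n} {x : M} (hx : x ∈ (extChartAt (𝓡∂ (n + 1)) p).source)
    (hB : IsInner (B (extChartAt (𝓡∂ (n + 1)) p x))) : IsInner (formAt (chartForm p B) x) := by
  refine hB.bilinearComp (Function.LeftInverse.injective (g := chartFrame p
    (extChartAt (𝓡∂ (n + 1)) p x)) fun v => ?_)
  exact DFunLike.congr_fun (isInvertible_chartFrame
    ((extChartAt (𝓡∂ (n + 1)) p).map_source hx)).self_comp_inverse v

theorem chartForm_localMetric (g : Metric n M m) {B : E n → Bil n} {x : M}
    (hx : x ∈ (extChartAt (𝓡∂ (n + 1)) p).source)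
    (hB : B (extChartAt (𝓡∂ (n + 1)) p x) = localMetric g p (extChartAt (𝓡∂ (n + 1)) p x)) :
    formAt (chartForm p B) x = formAt g.inner x := by
  have h1 := (extChartAt (𝓡∂ (n + 1)) p).left_inv hx
  have h2 : ∀ v, chartFrame p (extChartAt (𝓡∂ (n + 1)) p x)
      ((chartFrame p (extChartAt (𝓡∂ (n + 1)) p x)).inverse v) = v := fun v =>
    DFunLike.congr_fun (isInvertible_chartFrame
      ((extChartAt (𝓡∂ (n + 1)) p).map_source hx)).self_comp_inverse v
  ext v w
  change B (extChartAt (𝓡∂ (n + 1)) p x)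
    ((chartFrame p (extChartAt (𝓡∂ (n + 1)) p x)).inverse v)
    ((chartFrame p (extChartAt (𝓡∂ (n + 1)) p x)).inverse w) = _
  rw [hB]
  change formAt g.inner ((extChartAt (𝓡∂ (n + 1)) p).symm (extChartAt (𝓡∂ (n + 1)) p x))
    (chartFrame p (extChartAt (𝓡∂ (n + 1)) p x)
      ((chartFrame p (extChartAt (𝓡∂ (n + 1)) p x)).inverse v))
    (chartFrame p (extChartAt (𝓡∂ (n + 1)) p x)
      ((chartFrame p (extChartAt (𝓡∂ (n + 1)) p x)).inverse w)) = _
  rw [h1, h2, h2]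

theorem localForm_chartForm_transition (B : E n → Bil n)
    (hy : y ∈ (extChartAt (𝓡∂ (n + 1)) q).target)
    (hp : (extChartAt (𝓡∂ (n + 1)) q).symm y ∈ (extChartAt (𝓡∂ (n + 1)) p).source) :
    localForm (chartForm p B) q y = (B (transition n q p y)).bilinearComp
      (fderivWithin ℝ (transition n q p) (halfSpace n) y)
      (fderivWithin ℝ (transition n q p) (halfSpace n) y) := by
  rw [localForm_eq_bilinearComp _ hy hp, localForm_chartForm _ (transition_mem hp)]

theorem contDiffWithinAt_fderivWithin_transition (hy : y ∈ (extChartAt (𝓡∂ (n + 1)) q).target)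
    (hp : (extChartAt (𝓡∂ (n + 1)) q).symm y ∈ (extChartAt (𝓡∂ (n + 1)) p).source) :
    ContDiffWithinAt ℝ ∞ (fderivWithin ℝ (transition n q p) (halfSpace n)) (halfSpace n) y :=
  (contDiffWithinAt_transition hy hp).fderivWithin_right (uniqueDiffOn_halfSpace n) le_rfl
    (target_subset_halfSpace q hy)

omit [IsManifold (𝓡∂ (n + 1)) ∞ M] in
theorem eventually_transition_mem (hy : y ∈ (extChartAt (𝓡∂ (n + 1)) q).target)
    (hp : (extChartAt (𝓡∂ (n + 1)) q).symm y ∈ (extChartAt (𝓡∂ (n + 1)) p).source) :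
    ∀ᶠ z in 𝓝[halfSpace n] y, transition n q p z ∈ halfSpace n := by
  filter_upwards [eventually_mem_source hy hp] with z hz
  exact target_subset_halfSpace p (transition_mem hz.2)

omit [IsManifold (𝓡∂ (n + 1)) ∞ M] in
theorem eventually_eq_zero_of_notMem {χ : M → ℝ}
    (hy : y ∈ (extChartAt (𝓡∂ (n + 1)) q).target)
    (hχ : (extChartAt (𝓡∂ (n + 1)) q).symm y ∉ tsupport χ) :
    ∀ᶠ z in 𝓝[halfSpace n] y, χ ((extChartAt (𝓡∂ (n + 1)) q).symm z) = 0 :=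
  ((continuousAt_extChartAt_symm'' hy).continuousWithinAt (s := halfSpace n)).eventually
    (notMem_tsupport_iff_eventuallyEq.1 hχ)

/-- Within the chart at `p` the form is a pullback of `B` by the transition map; elsewhere the
cutoff vanishes locally. -/
theorem contDiffWithinAt_smul_localForm_chartForm {k : ℕ∞ω} (hk : k ≤ ∞) {χ : M → ℝ}
    (hχ : ContMDiff (𝓡∂ (n + 1)) 𝓘(ℝ, ℝ) ∞ χ) (hsupp : tsupport χ ⊆ (extChartAt (𝓡∂ (n + 1)) p).source)
    {B : E n → Bil n} (hB : ContDiffOn ℝ k B (halfSpace n))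
    (hy : y ∈ (extChartAt (𝓡∂ (n + 1)) q).target) :
    ContDiffWithinAt ℝ k (fun z => χ ((extChartAt (𝓡∂ (n + 1)) q).symm z) •
      localForm (chartForm p B) q z) (halfSpace n) y := by
  have hyS := target_subset_halfSpace q hy
  by_cases hp : (extChartAt (𝓡∂ (n + 1)) q).symm y ∈ (extChartAt (𝓡∂ (n + 1)) p).source
  · refine contDiffWithinAt_smul (F := Bil n)
      (contDiffWithinAt_halfSpace (contDiffOn_comp_symm hk hχ q) hy) ?_
    have h1 : (fun z => localForm (chartForm p B) q z) =ᶠ[𝓝[halfSpace n] y] fun z =>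
        (B (transition n q p z)).bilinearComp
          (fderivWithin ℝ (transition n q p) (halfSpace n) z)
          (fderivWithin ℝ (transition n q p) (halfSpace n) z) := by
      filter_upwards [eventually_mem_source hy hp] with z hz
      exact localForm_chartForm_transition B hz.1 hz.2
    refine ContDiffWithinAt.congr_of_eventuallyEq_of_mem ?_ h1 hyS
    exact contDiffWithinAt_bilinearComp_comp
      (hB _ (target_subset_halfSpace p (transition_mem hp)))
      ((contDiffWithinAt_transition hy hp).of_le hk)
      ((contDiffWithinAt_fderivWithin_transition hy hp).of_le hk) (eventually_transition_mem hy hp)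
  · refine ContDiffWithinAt.congr_of_eventuallyEq_of_mem
      (contDiffWithinAt_const (c := (0 : Bil n))) ?_ hyS
    filter_upwards [eventually_eq_zero_of_notMem hy fun h => hp (hsupp h)] with z hz
    exact smul_eq_zero_of_eq_zero (F := Bil n) hz _

theorem familyContDiff_smul_localForm_chartForm {ι : Type*} [TopologicalSpace ι] {i₀ : ι} {k : ℕ}
    {χ : M → ℝ} (hχ : ContMDiff (𝓡∂ (n + 1)) 𝓘(ℝ, ℝ) ∞ χ)
    (hsupp : tsupport χ ⊆ (extChartAt (𝓡∂ (n + 1)) p).source) {B : ι → E n → Bil n}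
    (hB : ∀ z ∈ halfSpace n, FamilyContDiff k B (halfSpace n) i₀ z)
    (hy : y ∈ (extChartAt (𝓡∂ (n + 1)) q).target) :
    FamilyContDiff k (fun i z => χ ((extChartAt (𝓡∂ (n + 1)) q).symm z) •
      localForm (chartForm p (B i)) q z) (halfSpace n) i₀ y := by
  have hyS := target_subset_halfSpace q hy
  have hu := uniqueDiffOn_halfSpace n
  have hk : (k : ℕ∞ω) ≤ ∞ := by norm_cast; simp
  by_cases hp : (extChartAt (𝓡∂ (n + 1)) q).symm y ∈ (extChartAt (𝓡∂ (n + 1)) p).source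
  · refine FamilyContDiff.smul (F := Bil n) hu hyS (FamilyContDiff.const hu hyS
      (contDiffWithinAt_halfSpace (contDiffOn_comp_symm hk hχ q) hy)) ?_
    refine (FamilyContDiff.bilinearComp_comp hu hyS
      (hB _ (target_subset_halfSpace p (transition_mem hp)))
      ((contDiffWithinAt_transition hy hp).of_le hk)
      ((contDiffWithinAt_fderivWithin_transition hy hp).of_le hk)
      (eventually_transition_mem hy hp)).congr hyS ?_
    filter_upwards [eventually_snd (eventually_mem_source hy hp)] with z hz
    exact localForm_chartForm_transition (B z.1) hz.1 hz.2
  · refine (FamilyContDiff.param (c := fun _ : ι => (0 : Bil n)) hu hyS continuousAt_const).congr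
      hyS ?_
    filter_upwards [eventually_snd (eventually_eq_zero_of_notMem hy fun h => hp (hsupp h))]
      with z hz
    exact smul_eq_zero_of_eq_zero (F := Bil n) hz _

/-- The metric in the chart at `p` can be extended from a compact set to the half-space. -/
theorem exists_extension_localMetric (g : Metric n M m) (p : M) {C : Set (E n)} (hC : IsCompact C)
    (hCt : C ⊆ (extChartAt (𝓡∂ (n + 1)) p).target) :
    ∃ B : E n → Bil n, ContDiffOn ℝ m B (halfSpace n) ∧ (∀ y ∈ halfSpace n, IsInner (B y)) ∧
      EqOn B (localMetric g p) C := by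
  -- The chart target is open only relative to the half-space. `O` is an open set of `ℝⁿ⁺¹` with the
  -- same trace on the half-space; the cutoff `η` lives there and interpolates to the Euclidean
  -- metric.
  set O : Set (E n) := interior ((extChartAt (𝓡∂ (n + 1)) p).target ∪ (halfSpace n)ᶜ)
  have hO : ∀ y ∈ (extChartAt (𝓡∂ (n + 1)) p).target, y ∈ O := fun y hy => by
    rw [mem_interior_iff_mem_nhds]
    filter_upwards [mem_nhdsWithin_iff_eventually.1 (extChartAt_target_mem_nhdsWithin_of_mem hy)]
      with z hz
    by_cases h : z ∈ halfSpace n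
    · exact Or.inl (hz h)
    · exact Or.inr h
  obtain ⟨η, h0, h1, hη⟩ := exists_contMDiffMap_zero_one_nhds_of_isClosed (n := ⊤) 𝓘(ℝ, E n)
    (isOpen_interior (s := (extChartAt (𝓡∂ (n + 1)) p).target ∪ (halfSpace n)ᶜ)).isClosed_compl
    hC.isClosed (disjoint_compl_left_iff_subset.2 fun y hy => hO y (hCt hy))
  have hηs : ContDiff ℝ m η := η.contMDiff.contDiff.of_le (by norm_cast; simp)
  have hnot : ∀ y ∈ halfSpace n, y ∉ (extChartAt (𝓡∂ (n + 1)) p).target →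
      ∀ᶠ z in 𝓝 y, η z = 0 := by
    intro y hy hyt
    refine (eventually_nhdsSet_iff_forall.1 h0) y fun hyO => ?_
    rcases interior_subset hyO with h | h
    · exact hyt h
    · exact h hy
  refine ⟨fun y => η y • localMetric g p y + (1 - η y) • euclideanForm n, fun y hy => ?_,
    fun y hy => ?_, fun y hy => ?_⟩
  · refine ContDiffWithinAt.add ?_ (contDiffWithinAt_smul (F := Bil n)
      (contDiff_const.sub hηs).contDiffWithinAt contDiffWithinAt_const)
    by_cases hyt : y ∈ (extChartAt (𝓡∂ (n + 1)) p).target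
    · exact contDiffWithinAt_smul (F := Bil n) hηs.contDiffWithinAt
        (contDiffWithinAt_localMetric g hyt)
    · refine ContDiffWithinAt.congr_of_eventuallyEq_of_mem
        (contDiffWithinAt_const (c := (0 : Bil n))) ?_ hy
      filter_upwards [mem_nhdsWithin_of_mem_nhds (hnot y hy hyt)] with z hz
      exact smul_eq_zero_of_eq_zero (F := Bil n) hz _
  · by_cases hyt : y ∈ (extChartAt (𝓡∂ (n + 1)) p).target
    · exact (isInner_localMetric g hyt).convex_comb (isInner_euclideanForm n) (hη y).1 (hη y).2
    · have := (hnot y hy hyt).self_of_nhds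
      have h2 := interpolation_of_eq_zero (F := Bil n) this (localMetric g p y) (euclideanForm n)
      exact (congrArg IsInner h2).mpr (isInner_euclideanForm n)
  · exact interpolation_of_eq_one (F := Bil n)
      (eventually_nhdsSet_iff_forall.1 h1 y hy).self_of_nhds _ _

/-! ### Gluing by a partition of unity, and approximation by smooth metrics. -/

variable {ι : Type*} [Fintype ι]

/-- The field of bilinear forms glued from coordinate expressions in the charts at `c i`. -/
def glueForm (ρ : ι → M → ℝ) (c : ι → M) (B : ι → E n → Bil n) (x : M) :
    TangentSpace (𝓡∂ (n + 1)) x →L[ℝ] TangentSpace (𝓡∂ (n + 1)) x →L[ℝ] ℝ :=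
  (∑ i, ρ i x • formAt (chartForm (c i) (B i)) x : Bil n)

omit [IsManifold (𝓡∂ (n + 1)) ∞ M] in
theorem localForm_glueForm (ρ : ι → M → ℝ) (c : ι → M) (B : ι → E n → Bil n) (q : M) (y : E n) :
    localForm (glueForm ρ c B) q y = ∑ i, ρ i ((extChartAt (𝓡∂ (n + 1)) q).symm y) •
      localForm (chartForm (c i) (B i)) q y := by
  ext v w
  change (∑ i, ρ i ((extChartAt (𝓡∂ (n + 1)) q).symm y) • formAt (chartForm (c i) (B i))
    ((extChartAt (𝓡∂ (n + 1)) q).symm y) : Bil n) (chartFrame q y v) (chartFrame q y w) = _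
  simp only [sum_apply, smul_apply]
  rfl

/-- Terms with nonzero weight are inner products since `x` lies in their chart domain, and some
weight is positive because the weights sum to one. -/
theorem isInner_glueForm {ρ : ι → M → ℝ} {c : ι → M} {B : ι → E n → Bil n} {x : M}
    (h0 : ∀ i, 0 ≤ ρ i x) (h1 : ∑ i, ρ i x = 1)
    (hsupp : ∀ i, tsupport (ρ i) ⊆ (extChartAt (𝓡∂ (n + 1)) (c i)).source)
    (hB : ∀ i, ∀ y ∈ halfSpace n, IsInner (B i y)) : IsInner (formAt (glueForm ρ c B) x) := by
  have hB' : ∀ i, ρ i x ≠ 0 → IsInner (formAt (chartForm (c i) (B i)) x) := fun i hi => by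
    have hx := hsupp i (subset_tsupport _ hi)
    exact isInner_chartForm hx (hB i _ (target_subset_halfSpace (c i)
      ((extChartAt (𝓡∂ (n + 1)) (c i)).map_source hx)))
  have happ : ∀ v w, formAt (glueForm ρ c B) x v w =
      ∑ i, ρ i x * formAt (chartForm (c i) (B i)) x v w := fun v w => by
    change (∑ i, ρ i x • formAt (chartForm (c i) (B i)) x : Bil n) v w = _
    simp only [sum_apply, smul_apply, smul_eq_mul]
  refine ⟨fun v w => ?_, fun v hv => ?_⟩
  · rw [happ, happ]
    refine Finset.sum_congr rfl fun i _ => ?_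
    by_cases hi : ρ i x = 0
    · rw [hi, zero_mul, zero_mul]
    · rw [(hB' i hi).1 v w]
  · rw [happ]
    have hpos : ∀ i, ρ i x ≠ 0 → 0 < ρ i x * formAt (chartForm (c i) (B i)) x v v := fun i hi =>
      mul_pos ((h0 i).lt_of_ne' hi) ((hB' i hi).2 v hv)
    obtain ⟨i, -, hi⟩ := Finset.exists_ne_zero_of_sum_ne_zero (h1.trans_ne one_ne_zero)
    refine Finset.sum_pos' (fun j _ => ?_) ⟨i, Finset.mem_univ _, hpos i hi⟩
    by_cases hj : ρ j x = 0
    · rw [hj, zero_mul]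
    · exact (hpos j hj).le

theorem contDiffOn_localForm_glueForm {k : ℕ∞ω} (hk : k ≤ ∞) {ρ : ι → M → ℝ} {c : ι → M}
    {B : ι → E n → Bil n} (hρ : ∀ i, ContMDiff (𝓡∂ (n + 1)) 𝓘(ℝ, ℝ) ∞ (ρ i))
    (hsupp : ∀ i, tsupport (ρ i) ⊆ (extChartAt (𝓡∂ (n + 1)) (c i)).source)
    (hB : ∀ i, ContDiffOn ℝ k (B i) (halfSpace n)) (q : M) :
    ContDiffOn ℝ k (localForm (glueForm ρ c B) q) (extChartAt (𝓡∂ (n + 1)) q).target := by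
  intro y hy
  rw [funext (localForm_glueForm ρ c B q)]
  exact ContDiffWithinAt.sum fun i _ => (contDiffWithinAt_smul_localForm_chartForm hk (hρ i)
    (hsupp i) (hB i) hy).mono (target_subset_halfSpace q)

theorem exists_partition [T2Space M] [CompactSpace M] :
    ∃ (t : Finset M) (ρ : t → M → ℝ), (∀ i, ContMDiff (𝓡∂ (n + 1)) 𝓘(ℝ, ℝ) ∞ (ρ i)) ∧
      (∀ i x, 0 ≤ ρ i x) ∧ (∀ x, ∑ i, ρ i x = 1) ∧
      ∀ i : t, tsupport (ρ i) ⊆ (extChartAt (𝓡∂ (n + 1)) (i : M)).source := by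
  obtain ⟨t, ht⟩ := (isCompact_univ (X := M)).elim_nhds_subcover
    (fun p => (extChartAt (𝓡∂ (n + 1)) p).source) fun p _ => extChartAt_source_mem_nhds p
  obtain ⟨ρ, hρ⟩ := SmoothPartitionOfUnity.exists_isSubordinate (𝓡∂ (n + 1)) (isClosed_univ (X := M))
    (fun i : t => (extChartAt (𝓡∂ (n + 1)) (i : M)).source) (fun i => isOpen_extChartAt_source _)
    (by simpa [iUnion_subtype] using ht.2)
  refine ⟨t, fun i => ρ i, fun i => (ρ i).contMDiff, fun i x => ρ.nonneg i x, fun x => ?_, hρ⟩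
  rw [← finsum_eq_sum_of_fintype]
  exact ρ.sum_eq_one (mem_univ x)

/-- Smooth metrics are dense in the `C^m` metrics. -/
theorem dense_smoothMetrics [T2Space M] [CompactSpace M] : Dense (smoothMetrics n M m) := by
  intro g
  obtain ⟨t, ρ, hρ, hρ0, hρ1, hsupp⟩ := exists_partition (n := n) (M := M)
  have hext : ∀ i : t, ∃ B : E n → Bil n, ContDiffOn ℝ m B (halfSpace n) ∧
      (∀ y ∈ halfSpace n, IsInner (B y)) ∧
      EqOn B (localMetric g (i : M)) (extChartAt (𝓡∂ (n + 1)) (i : M) '' tsupport (ρ i)) := by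
    intro i
    refine exists_extension_localMetric g (i : M) ?_ ?_
    · exact (isClosed_tsupport (ρ i)).isCompact.image_of_continuousOn
        ((continuousOn_extChartAt (i : M)).mono (hsupp i))
    · rintro _ ⟨x, hx, rfl⟩
      exact (extChartAt (𝓡∂ (n + 1)) (i : M)).map_source (hsupp i hx)
  choose B hB hBi hBe using hext
  have hm : (m : ℕ∞ω) ≤ ∞ := by norm_cast; simp
  let γ : ℝ → Metric n M m := fun ε => mkMetric
    (glueForm ρ (fun i => (i : M)) fun i => smoothing ε (B i))
    (fun x => isInner_glueForm (fun i => hρ0 i x) (hρ1 x) hsupp fun i _ hy =>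
      IsInner.smoothing (hB i).continuousOn (hBi i) ε hy)
    (fun q => contDiffOn_localForm_glueForm hm hρ hsupp (fun i => contDiffOn_smoothing (hB i) ε) q)
  have hγ : ContinuousAt γ 0 := by
    refine continuousAt_metric fun q y hy => ?_
    have hyS := target_subset_halfSpace q hy
    have hu := uniqueDiffOn_halfSpace n
    have h1 := FamilyContDiff.sum (F := Bil n) hu hyS Finset.univ fun i _ =>
      familyContDiff_smul_localForm_chartForm (q := q) (k := m) (i₀ := (0 : ℝ)) (hρ i) (hsupp i)
        (fun z hz => familyContDiff_smoothing 0 hz (hB i)) hy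
    refine h1.congr hyS (Eventually.of_forall fun z => ?_)
    exact localForm_glueForm _ _ _ q z.2
  -- At `ε = 0` nothing is averaged, and each extension agrees with the metric on the support of its
  -- weight, so the glued form is `g` times the sum of the weights.
  have hγ0 : γ 0 = g := by
    refine metric_ext fun x => ?_
    change (∑ i, ρ i x • formAt (chartForm (i : M) (smoothing 0 (B i))) x : Bil n) =
      formAt g.inner x
    calc (∑ i, ρ i x • formAt (chartForm (i : M) (smoothing 0 (B i))) x : Bil n)
        = ∑ i, ρ i x • formAt g.inner x := by
          refine Finset.sum_congr rfl fun i _ => ?_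
          by_cases hi : ρ i x = 0
          · exact (smul_eq_zero_of_eq_zero (F := Bil n) hi _).trans
              (smul_eq_zero_of_eq_zero (F := Bil n) hi _).symm
          · have hx : x ∈ tsupport (ρ i) := subset_tsupport _ hi
            rw [smoothing_zero, chartForm_localMetric g (hsupp i hx)
              (hBe i (mem_image_of_mem _ hx))]
      _ = formAt g.inner x := by rw [← Finset.sum_smul, hρ1, one_smul]
  have hsm : ∀ ε ≠ 0, γ ε ∈ smoothMetrics n M m := fun ε hε =>
    (contMDiff_section_iff_localForm le_rfl _).2 fun q =>
      contDiffOn_localForm_glueForm le_rfl hρ hsupp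
        (fun i => contDiffOn_smoothing_infty (hB i).continuousOn hε) q
  rw [ContinuousAt, hγ0] at hγ
  refine mem_closure_of_tendsto (hγ.mono_left (nhdsWithin_le_nhds (s := {0}ᶜ))) ?_
  filter_upwards [self_mem_nhdsWithin] with ε hε using hsm ε hε

end Density

end BoundaryMorse

end

/-! ### The main theorem. -/

theorem lemma2p1 (n : ℕ) (hn : 2 ≤ n) (M : Type*) [TopologicalSpace M] [T2Space M] [CompactSpace M]
    [ChartedSpace (EuclideanHalfSpace (n + 1)) M] [IsManifold (𝓡∂ (n + 1)) ∞ M]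
    (m : ℕ) (hm : 4 ≤ m) :
    -- openness, among all `C^m` metrics and among the smooth metrics, in the `C^m` topology
    IsOpen (BoundaryMorse.morseMetrics n M m) ∧
    IsOpen {g : BoundaryMorse.smoothMetrics n M m | g.1 ∈ BoundaryMorse.morseMetrics n M m} ∧
    -- the smooth metrics with Morse boundary mean curvature are dense in all `C^m` metrics
    Dense (BoundaryMorse.smoothMetrics n M m ∩ BoundaryMorse.morseMetrics n M m) ∧
    -- near a smooth metric `g` they can be found among `e^{2u} g` with `u = 0` on the boundary
    ∀ g ∈ BoundaryMorse.smoothMetrics n M m, ∀ U ∈ 𝓝 g,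
      ∃ u : M → ℝ, ContMDiff (𝓡∂ (n + 1)) 𝓘(ℝ, ℝ) ∞ u ∧
        (∀ x ∈ (𝓡∂ (n + 1)).boundary M, u x = 0) ∧
        ∃ g' ∈ U ∩ (BoundaryMorse.smoothMetrics n M m ∩ BoundaryMorse.morseMetrics n M m),
          ∀ (x : M) (v w : TangentSpace (𝓡∂ (n + 1)) x),
            g'.inner x v w = Real.exp (2 * u x) * g.inner x v w := by
  have hopen := BoundaryMorse.isOpen_morseMetrics (n := n) (M := M) (m := m) (by omega)
  refine ⟨hopen, hopen.preimage continuous_subtype_val, ?_, ?_⟩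
  · refine dense_iff_inter_open.2 fun V hV hVne => ?_
    -- A smooth metric is found in `V` first, then perturbed conformally without leaving `V`.
    obtain ⟨g, hgV, hg⟩ := BoundaryMorse.dense_smoothMetrics.inter_open_nonempty V hV hVne
    obtain ⟨g', hg'V, hs, -, hM⟩ := BoundaryMorse.exists_conformal_morse (by omega) (by omega) hg
      (hV.mem_nhds hgV)
    exact ⟨g', hg'V, hs, hM⟩
  · intro g hg U hU
    obtain ⟨g', hg'U, hs, ⟨u, hu, hu0, huv⟩, hM⟩ :=
      BoundaryMorse.exists_conformal_morse (by omega) (by omega) hg hU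
    exact ⟨u, hu, hu0, g', ⟨hg'U, hs, hM⟩, huv⟩
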